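/- **Setting.** Let $(A\xrightarrow{\partial}H,\triangleright)$ be a crossed module of finite-dimensional semisimple Hopf algebras over $\mathbb C$: $\partial$ is a Hopf algebra morphism and $\triangleright$ a left $H$-action making $A$ an $H$-module algebra and $H$-module coalgebra, such that $h_{(1)}\otimes h_{(2)}\triangleright a=h_{(2)}\otimes h_{(1)}\triangleright a$, $\partial(h\triangleright a)=h_{(1)}\,\partial a\,S h_{(2)}$ and $\partial(a)\triangleright b=a_{(1)}\,b\,S a_{(2)}$. Let $L$ be a regular cell decomposition of a closed oriented surface, encoded by its rotation system: vertices $L^0$, oriented edges $L^1$ and plaquettes $L^2$, every vertex and every plaquette being incident to an edge, no loops, no univalent vertices, the boundary of each plaquette passing at most once through each vertex, each plaquette having a base-point in its boundary. Put $\mathcal H_L=H^{\otimes L^1}\otimes A^{\otimes L^2}$. Write $x^{\langle +1\rangle}=x$, $x^{\langle -1\rangle}=S(x)$; all operators below act as the identity on the tensor factors that are not mentioned. * *Vertex operators.* For a vertex $v$ in the boundary of a plaquette $P$ and $h\in H$, $V_{v,P}^h$ acts by $v_{e_i}\mapsto (h_{(i)}v_{e_i}^{\langle\theta_i\rangle})^{\langle\theta_i\rangle}$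 on the edges $e_1,\dots,e_n$ at $v$, listed counter-clockwise starting right after $P$ ($\theta_i=+1$ if $e_i$ leaves $v$, $-1$ otherwise), and by $X_{P_j}\mapsto h_{(n+j)}\triangleright X_{P_j}$ on the plaquettes $P_1,\dots,P_k$ with base-point $v$. * *Edge operators.* Let $e$ be an edge with starting vertex $s$, let $P$ and $Q$ be the plaquettes to its left and right, let $(e_1,\dots,e_\ell)$ be the path from the base-point of $P$ counter-clockwise along $\partial P$ to $s$, and $(d_1,\dots,d_r)$ the path from the base-point of $Q$ clockwise along $\partial Q$ to $s$, with signs $\theta_i,\sigma_j=+1$ for edges oriented along the path and $-1$ otherwise. For $a\in A$, $E_e^a$ sends $v_e\mapsto\partial a_{(3)}v_e$, $v_{e_i}\mapsto (v_{e_i})_{(1)}$, $v_{d_j}\mapsto(v_{d_j})_{(2)}$, $X_P\mapsto\big((v_{e_1})_{(2)}^{\langle\theta_1\rangle}\cdots(v_{e_\ell})_{(2)}^{\langle\theta_\ell\rangle}\triangleright a_{(1)}\big)X_P$, $X_Q\mapsto X_Q\big((v_{d_1})_{(1)}^{\langle\sigma_1\rangle}\cdots(v_{d_r})_{(1)}^{\langle\sigma_r\rangle}\triangleright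 S a_{(2)}\big)$. (An edge on both paths is comultiplied twice.) * *Plaquette operators.* Let $(e_1,\dots,e_n)$ be the boundary of $P$ counter-clockwise from its base-point, with $\theta_i=+1$ if $e_i$ is oriented counter-clockwise around $P$ and $-1$ otherwise. For $\varphi\in H^*$, $F_P^\varphi$ sends $v_{e_i}\mapsto (v_{e_i}^{\langle\theta_i\rangle})_{(1)}^{\langle\theta_i\rangle}$, $X_P\mapsto(X_P)_{(2)}$, with scalar factor $\varphi\big((v_{e_1}^{\langle\theta_1\rangle})_{(2)}\cdots(v_{e_n}^{\langle\theta_n\rangle})_{(2)}\,S\partial(X_P)_{(1)}\big)$. **Proposition.** Let $P$ be a plaquette with base-point $v$ and let $e$ be an edge in the boundary of $P$, oriented counter-clockwise around $P$, with starting vertex $v$. Then: 1. $h\mapsto V_{v,P}^h$, $a\mapsto E_e^a$, $\varphi\mapsto F_P^\varphi$ are (unital) representations of the algebras $H$, $A$, $H^*$ on $\mathcal H_L$. 2. For all $h\in H$, $a\in A$, $\varphi\in H^*$: $$E_e^{h_{(1)}\triangleright a}\,V_{v,P}^{h_{(2)}}=V_{v,P}^h\,E_e^a,\qquad F_P^{\varphi(S\partial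 a_{(3)}\,\cdot\,?\,\cdot\,\partial a_{(1)})}\,E_e^{a_{(2)}}=E_e^a\,F_P^\varphi,\qquad F_P^{\varphi(Sh_{(3)}\,\cdot\,?\,\cdot\,h_{(1)})}\,V_{v,P}^{h_{(2)}}=V_{v,P}^h\,F_P^\varphi .$$ If $e'$ is an edge in the boundary of $P$ with starting vertex $v$ that is oriented clockwise around $P$, then $E_{e'}^aF_P^\varphi=F_P^\varphi E_{e'}^a$ for all $a,\varphi$. 3. The vector space $H^*\otimes(A\otimes H)$ is an associative algebra with unit $\varepsilon\otimes(1\otimes 1)$ and multiplication $$(\varphi\otimes(a\otimes h))\cdot(\psi\otimes(b\otimes k))=\varphi\,\psi\big(S(\partial a_{(3)}h_{(3)})\cdot\,?\,\cdot\partial a_{(1)}h_{(1)}\big)\otimes (a_{(2)}\otimes h_{(2)})\cdot_\rtimes(b\otimes k),$$ where $(a\otimes h)\cdot_\rtimes(b\otimes k)=a(h_{(1)}\triangleright b)\otimes h_{(2)}k$ is the multiplication of the crossed product $A\rtimes H$, and $\varphi\otimes(a\otimes h)\mapsto F_P^\varphi E_e^aV_{v,P}^h$ defines a unital representation of this algebra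 on $\mathcal H_L$. 4. For the trivial Hopf algebra $A=\mathbb C$ (with $\partial$ the unit map and $h\triangleright z=\varepsilon(h)z$), the identification $H^*\otimes(\mathbb C\otimes H)\cong H^*\otimes H$ turns this algebra into the Drinfeld double $D(H)$, with multiplication $(\varphi\otimes h)(\psi\otimes k)=\varphi\,\psi(S^{-1}h_{(3)}\cdot\,?\,\cdot h_{(1)})\otimes h_{(2)}k$. -/

import Mathlib

open scoped TensorProduct

noncomputable section

/-! ### Crossed modules of Hopf algebras -/

/-- A crossed module of Hopf algebras `(∂ : A → H, ▷)` over `ℂ`. The left action `h ▷ a` is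
`act h a`. (A bialgebra morphism of Hopf algebras automatically respects the antipodes.) -/
structure HopfCrossedModule (A H : Type*) [Ring A] [HopfAlgebra ℂ A]
    [Ring H] [HopfAlgebra ℂ H] where
  /-- the boundary map `∂` -/
  bd : A →ₐc[ℂ] H
  /-- the left action `▷` of the algebra `H` on the vector space `A` -/
  act : H →ₐ[ℂ] Module.End ℂ A
  /-- `h ▷ (a b) = (h₁ ▷ a) (h₂ ▷ b)` -/
  act_mul : ∀ (h : H) (a b : A),
    act h (a * b) =
      LinearMap.mul' ℂ A (TensorProduct.map (act.toLinearMap.flip a) (act.toLinearMap.flip b)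
        (Coalgebra.comul (R := ℂ) h))
  /-- `h ▷ 1 = ε(h) 1` -/
  act_one : ∀ h : H, act h 1 = Coalgebra.counit (R := ℂ) h • (1 : A)
  /-- `Δ(h ▷ a) = (h₁ ▷ a₁) ⊗ (h₂ ▷ a₂)` -/
  comul_act : ∀ (h : H) (a : A),
    Coalgebra.comul (R := ℂ) (act h a) =
      TensorProduct.map₂ act.toLinearMap act.toLinearMap
        (Coalgebra.comul (R := ℂ) h) (Coalgebra.comul (R := ℂ) a)
  /-- `ε(h ▷ a) = ε(h) ε(a)` -/
  counit_act : ∀ (h : H) (a : A),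
    Coalgebra.counit (R := ℂ) (act h a) =
      Coalgebra.counit (R := ℂ) h * Coalgebra.counit (R := ℂ) a
  /-- Yetter-Drinfeld condition: `h₁ ⊗ (h₂ ▷ a) = h₂ ⊗ (h₁ ▷ a)` -/
  yetterDrinfeld : ∀ (h : H) (a : A),
    TensorProduct.map LinearMap.id (act.toLinearMap.flip a) (Coalgebra.comul (R := ℂ) h) =
      TensorProduct.map LinearMap.id (act.toLinearMap.flip a)
        (TensorProduct.comm ℂ H H (Coalgebra.comul (R := ℂ) h))
  /-- first Peiffer relation: `∂(h ▷ a) = h₁ ∂(a) S(h₂)` -/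
  peiffer_one : ∀ (h : H) (a : A),
    bd (act h a) =
      LinearMap.mul' ℂ H (TensorProduct.map (LinearMap.mulRight ℂ (bd a))
        (HopfAlgebra.antipode ℂ) (Coalgebra.comul (R := ℂ) h))
  /-- second Peiffer relation: `∂(a) ▷ b = a₁ b S(a₂)` -/
  peiffer_two : ∀ a b : A,
    act (bd a) b =
      LinearMap.mul' ℂ A (TensorProduct.map (LinearMap.mulRight ℂ b)
        (HopfAlgebra.antipode ℂ) (Coalgebra.comul (R := ℂ) a))

/-- The crossed module with `A = ℂ`: `∂` is the unit map and `h ▷ z = ε(h) z`. -/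
def HopfCrossedModule.trivial (H : Type*) [Ring H] [HopfAlgebra ℂ H] :
    HopfCrossedModule ℂ H where
  bd := Bialgebra.unitBialgHom ℂ H
  act := (Algebra.lmul ℂ ℂ).comp (Bialgebra.counitAlgHom ℂ H)
  act_mul h a b := by
    have key : h = ∑ i ∈ (Coalgebra.Repr.arbitrary ℂ h).index,
        Coalgebra.counit (R := ℂ) ((Coalgebra.Repr.arbitrary ℂ h).left i) •
          (Coalgebra.Repr.arbitrary ℂ h).right i :=
      (Coalgebra.sum_counit_smul (Coalgebra.Repr.arbitrary ℂ h)).symm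
    have key2 := congrArg (Coalgebra.counit (R := ℂ)) key
    simp only [map_sum, map_smul, smul_eq_mul] at key2
    rw [← (Coalgebra.Repr.arbitrary ℂ h).eq]
    simp [key2]
    exact Finset.sum_congr rfl fun i _ => by ring
  act_one h := by simp
  comul_act h a := by
    have key := congrArg (Coalgebra.counit (R := ℂ))
      (Coalgebra.sum_counit_smul (Coalgebra.Repr.arbitrary ℂ h))
    simp only [map_sum, map_smul, smul_eq_mul] at key
    rw [← (Coalgebra.Repr.arbitrary ℂ h).eq]
    simp
    rw [← key, Finset.sum_mul, TensorProduct.tmul_sum]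
    refine Finset.sum_congr rfl fun i _ => ?_
    rw [mul_assoc, ← smul_eq_mul, ← TensorProduct.smul_tmul, smul_eq_mul, mul_one]
  counit_act h a := by simp
  yetterDrinfeld h a := by
    have e1 := congrArg (TensorProduct.map LinearMap.id (LinearMap.mulRight ℂ a))
      (Coalgebra.sum_tmul_counit_eq (Coalgebra.Repr.arbitrary ℂ h))
    have e2 := congrArg (fun t => TensorProduct.map LinearMap.id (LinearMap.mulRight ℂ a)
      (TensorProduct.comm ℂ ℂ H t))
      (Coalgebra.sum_counit_tmul_eq (Coalgebra.Repr.arbitrary ℂ h))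
    simp only [map_sum, TensorProduct.map_tmul, TensorProduct.comm_tmul, LinearMap.id_apply,
      LinearMap.mulRight_apply] at e1 e2
    rw [← (Coalgebra.Repr.arbitrary ℂ h).eq]
    simp [e1, e2]
  peiffer_one h a := by
    have key := HopfAlgebra.sum_mul_antipode_eq_smul (Coalgebra.Repr.arbitrary ℂ h)
    have hc : ∀ z : ℂ, Bialgebra.unitBialgHom ℂ H z = algebraMap ℂ H z := fun _ => rfl
    have hz : ∀ (z : ℂ) (x y : H), x * algebraMap ℂ H z * y = algebraMap ℂ H z * (x * y) := by
      intro z x y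
      rw [← Algebra.commutes z x, mul_assoc]
    simp [hc]
    rw [← (Coalgebra.Repr.arbitrary ℂ h).eq]
    simp [hz, ← Finset.mul_sum, key, Algebra.smul_def, ← map_mul, mul_comm]
  peiffer_two a b := by simp [mul_comm]

/-! ### Cell decompositions of closed oriented surfaces -/

/-- A cell decomposition (regular, i.e. every closed plaquette is an embedded disk) of a closed
oriented surface, with oriented edges and based plaquettes, given by its rotation system.

`L0`, `L1`, `L2` are the sets of vertices, edges and plaquettes. A *dart* is an edge together with
a direction: `(e, true)` is `e` traversed along its orientation and `(e, false)` is `e` traversed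
backwards. The surface and the embedded graph are encoded by the cyclic counter-clockwise order of
the darts leaving each vertex. -/
structure CellDecomposition (L0 L1 L2 : Type*) where
  /-- the starting vertex of a dart -/
  src : L1 × Bool → L0
  /-- the plaquette on the left of a dart -/
  left : L1 × Bool → L2
  /-- the next dart, counter-clockwise, leaving the same vertex -/
  rot : Equiv.Perm (L1 × Bool)
  /-- the next dart in the boundary of the plaquette on the left, counter-clockwise -/
  face : Equiv.Perm (L1 × Bool)
  /-- at its end point, the boundary of the plaquette on the left of `d` continues with the dart
  that comes just before (clockwise) the reverse of `d` -/
  rot_face : ∀ d : L1 × Bool, rot (face d) = (d.1, !d.2)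
  /-- the darts leaving a vertex form one cycle of `rot` -/
  src_eq_iff : ∀ d d' : L1 × Bool, src d = src d' ↔ rot.SameCycle d d'
  /-- the boundary of a plaquette is one cycle of `face` -/
  left_eq_iff : ∀ d d' : L1 × Bool, left d = left d' ↔ face.SameCycle d d'
  /-- every vertex is the end of some edge -/
  src_surjective : Function.Surjective src
  /-- every plaquette has some edge in its boundary -/
  left_surjective : Function.Surjective left
  /-- there are no loops -/
  no_loop : ∀ e : L1, src (e, true) ≠ src (e, false)
  /-- there are no univalent vertices -/
  no_univalent : ∀ d : L1 × Bool, rot d ≠ d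
  /-- regularity: the boundary of a plaquette passes at most once through each vertex -/
  regular : ∀ d d' : L1 × Bool, left d = left d' → src d = src d' → d = d'
  /-- the base-point of a plaquette -/
  base : L2 → L0
  /-- the base-point of a plaquette lies in its boundary -/
  base_mem : ∀ p : L2, ∃ d : L1 × Bool, src d = base p ∧ left d = p

namespace CellDecomposition

variable {L0 L1 L2 : Type*} [Fintype L1] [DecidableEq L1] (L : CellDecomposition L0 L1 L2)

/-- `(v, p)` is a site: the vertex `v` lies in the boundary of the plaquette `p`. -/
def IsSite (v : L0) (p : L2) : Prop := ∃ d : L1 × Bool, L.src d = v ∧ L.left d = p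

/-- The (unique) dart that leaves `v` and has `p` on its left. -/
def cornerDart (v : L0) (p : L2) (hs : L.IsSite v p) : L1 × Bool := hs.choose

/-- The darts leaving `v`, in counter-clockwise order, starting right after the plaquette `p`. -/
def star (v : L0) (p : L2) (hs : L.IsSite v p) : List (L1 × Bool) :=
  L.rot.toList (L.rot (L.cornerDart v p hs))

/-- The boundary of `p` in counter-clockwise order, starting at the base-point. The Boolean is
`true` for the edges that are oriented counter-clockwise around `p`. -/
def boundary (p : L2) : List (L1 × Bool) :=
  L.face.toList (L.cornerDart (L.base p) p (L.base_mem p))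

/-- The path from the base-point of the plaquette on the left of `e` to the starting vertex of `e`,
counter-clockwise around this plaquette. -/
def leftPath (e : L1) : List (L1 × Bool) :=
  (L.boundary (L.left (e, true))).takeWhile (fun d => d ≠ (e, true))

/-- The path from the base-point of the plaquette on the right of `e` to the starting vertex of `e`,
clockwise around this plaquette. The Boolean is `true` for the edges that are oriented clockwise
around it. -/
def rightPath (e : L1) : List (L1 × Bool) :=
  ((L.boundary (L.left (e, false))).reverse.takeWhile (fun d => d ≠ (e, false))).map
    (fun d => (d.1, !d.2))

end CellDecomposition

/-! ### Operators acting on single tensor factors -/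

section Slots

variable {ι M N : Type*} [DecidableEq ι] [AddCommGroup M] [Module ℂ M]
  [AddCommGroup N] [Module ℂ N]

/-- The endomorphism of `M^{⊗ ι}` that acts as `f` on the factor `i` and as the identity on the
other factors; linear in `f`. -/
def slotMap [Fintype ι] (i : ι) : Module.End ℂ M →ₗ[ℂ] Module.End ℂ (⨂[ℂ] _ : ι, M) :=
  (PiTensorProduct.mapMultilinear ℂ (fun _ : ι => M) (fun _ : ι => M)).toLinearMap
    (fun _ => LinearMap.id) i

/-- The map `M^{⊗ ι} → M^{⊗ ι} ⊗ N` that applies `c : M → M ⊗ N` to the factor `i`. -/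
def slotRead (i : ι) (c : M →ₗ[ℂ] M ⊗[ℂ] N) :
    (⨂[ℂ] _ : ι, M) →ₗ[ℂ] (⨂[ℂ] _ : ι, M) ⊗[ℂ] N :=
  PiTensorProduct.lift
    (MultilinearMap.mk' (R := ℂ) (M₁ := fun _ : ι => M)
      (fun m => ((PiTensorProduct.tprod ℂ (s := fun _ : ι => M)).toLinearMap m i).rTensor N
        (c (m i)))
      (by
        intro m j x y
        by_cases hj : j = i
        · subst hj
          have hu : ∀ w : M, (PiTensorProduct.tprod ℂ (s := fun _ : ι => M)).toLinearMap
              (Function.update m j w) j =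
              (PiTensorProduct.tprod ℂ (s := fun _ : ι => M)).toLinearMap m j := by
            intro w; ext v; simp
          simp [hu]
        · have hu : (PiTensorProduct.tprod ℂ (s := fun _ : ι => M)).toLinearMap
              (Function.update m j (x + y)) i =
              (PiTensorProduct.tprod ℂ (s := fun _ : ι => M)).toLinearMap
                (Function.update m j x) i +
              (PiTensorProduct.tprod ℂ (s := fun _ : ι => M)).toLinearMap
                (Function.update m j y) i := by
            ext v; simp [Function.update_comm hj]
          simp [hu, Function.update_of_ne (Ne.symm hj), LinearMap.rTensor_add])
      (by
        intro m j z x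
        by_cases hj : j = i
        · subst hj
          have hu : ∀ w : M, (PiTensorProduct.tprod ℂ (s := fun _ : ι => M)).toLinearMap
              (Function.update m j w) j =
              (PiTensorProduct.tprod ℂ (s := fun _ : ι => M)).toLinearMap m j := by
            intro w; ext v; simp
          simp [hu]
        · have hu : (PiTensorProduct.tprod ℂ (s := fun _ : ι => M)).toLinearMap
              (Function.update m j (z • x)) i =
              z • (PiTensorProduct.tprod ℂ (s := fun _ : ι => M)).toLinearMap
                (Function.update m j x) i := by
            ext v; simp [Function.update_comm hj]
          simp [hu, Function.update_of_ne (Ne.symm hj), LinearMap.rTensor_smul]))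

end Slots

/-! ### The state space and the local operators -/

section Model

variable {L0 L1 L2 A H : Type*} [Fintype L1] [DecidableEq L1] [Fintype L2] [DecidableEq L2]
  [DecidableEq L0] [Ring A] [HopfAlgebra ℂ A] [Ring H] [HopfAlgebra ℂ H]

/-- The total state space `H^{⊗ L1} ⊗ A^{⊗ L2}`. -/
abbrev StateSpace (L1 L2 A H : Type*) [Ring A] [HopfAlgebra ℂ A] [Ring H] [HopfAlgebra ℂ H] :
    Type _ :=
  (⨂[ℂ] _ : L1, H) ⊗[ℂ] (⨂[ℂ] _ : L2, A)

/-- `x ↦ x^⟨θ⟩`: the identity if `θ = true` and the antipode if `θ = false`. -/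
def signed (θ : Bool) : H →ₗ[ℂ] H := if θ then LinearMap.id else HopfAlgebra.antipode ℂ

/-- An endomorphism of `H` acting on the tensor factor of the edge `e`. -/
def onEdge (L2 A : Type*) [Ring A] [HopfAlgebra ℂ A] (e : L1) :
    Module.End ℂ H →ₗ[ℂ] Module.End ℂ (StateSpace L1 L2 A H) :=
  LinearMap.rTensorHom (⨂[ℂ] _ : L2, A) ∘ₗ slotMap e

/-- An endomorphism of `A` acting on the tensor factor of the plaquette `p`. -/
def onPlaq (L1 H : Type*) [Ring H] [HopfAlgebra ℂ H] (p : L2) :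
    Module.End ℂ A →ₗ[ℂ] Module.End ℂ (StateSpace L1 L2 A H) :=
  LinearMap.lTensorHom (⨂[ℂ] _ : L1, H) ∘ₗ slotMap p

/-- Apply `c : H → H ⊗ H` to the factor of the edge `e`: the first output stays on the edge and the
second one is collected in the additional factor `H`. -/
def readEdge (L2 A : Type*) [Ring A] [HopfAlgebra ℂ A] (e : L1) (c : H →ₗ[ℂ] H ⊗[ℂ] H) :
    StateSpace L1 L2 A H →ₗ[ℂ] StateSpace L1 L2 A H ⊗[ℂ] H :=
  (TensorProduct.rightComm ℂ (⨂[ℂ] _ : L1, H) H (⨂[ℂ] _ : L2, A)).toLinearMap ∘ₗ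
    (slotRead e c).rTensor (⨂[ℂ] _ : L2, A)

/-- Apply `c : A → A ⊗ H` to the factor of the plaquette `p`. -/
def readPlaq (L1 : Type*) (p : L2) (c : A →ₗ[ℂ] A ⊗[ℂ] H) :
    StateSpace L1 L2 A H →ₗ[ℂ] StateSpace L1 L2 A H ⊗[ℂ] H :=
  (TensorProduct.assoc ℂ (⨂[ℂ] _ : L1, H) (⨂[ℂ] _ : L2, A) H).symm.toLinearMap ∘ₗ
    (slotRead p c).lTensor (⨂[ℂ] _ : L1, H)

/-- Read off several elements `x₁, …, xₙ` of `H` and collect their product `x₁ ⋯ xₙ`. -/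
def readProd {T : Type*} [AddCommGroup T] [Module ℂ T] :
    List (T →ₗ[ℂ] T ⊗[ℂ] H) → (T →ₗ[ℂ] T ⊗[ℂ] H)
  | [] => (TensorProduct.mk ℂ T H).flip 1
  | c :: cs =>
      (LinearMap.mul' ℂ H).lTensor T ∘ₗ (TensorProduct.assoc ℂ T H H).toLinearMap ∘ₗ
        c.rTensor H ∘ₗ readProd cs

namespace HopfCrossedModule

variable (X : HopfCrossedModule A H) (L : CellDecomposition L0 L1 L2)

/-- `h` acts on an edge leaving (`θ = true`) or entering (`θ = false`) a vertex by
`x ↦ (h x^⟨θ⟩)^⟨θ⟩`. -/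
def edgeAct (θ : Bool) : H →ₗ[ℂ] Module.End ℂ H :=
  LinearMap.llcomp ℂ H H H (signed θ) ∘ₗ LinearMap.lcomp ℂ H (signed θ) ∘ₗ LinearMap.mul ℂ H

/-- The vertex operators `V_{v,p}^h`: the elements `h₁, …, hₙ` of the iterated coproduct of `h` act
on the edges around `v` in counter-clockwise order starting right after `p`, and `hₙ₊₁, …, hₙ₊ₖ` act
by `▷` on the plaquettes with base-point `v` (listed in some order). The product of the list is the
convolution product of linear maps from `H` to the endomorphisms of the state space. -/
def vertexOp (v : L0) (p : L2) (hs : L.IsSite v p) :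
    H →ₗ[ℂ] Module.End ℂ (StateSpace L1 L2 A H) :=
  (((L.star v p hs).map fun d => WithConv.toConv (onEdge (H := H) L2 A d.1 ∘ₗ edgeAct d.2)) ++
    ((Finset.univ.filter fun q : L2 => L.base q = v).toList.map fun q =>
      WithConv.toConv (onPlaq L1 H q ∘ₗ X.act.toLinearMap))).prod.ofConv

/-- For an operator-valued `K` and a reading `r : t ↦ t' ⊗ x`, the operators
`t ↦ K (x ▷ a) t'` indexed by `a`. -/
def readAct {T : Type*} [AddCommGroup T] [Module ℂ T] (K : A →ₗ[ℂ] Module.End ℂ T)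
    (r : T →ₗ[ℂ] T ⊗[ℂ] H) : A →ₗ[ℂ] Module.End ℂ T where
  toFun a := TensorProduct.lift (K ∘ₗ X.act.toLinearMap.flip a).flip ∘ₗ r
  map_add' a b := by
    rw [← LinearMap.add_comp]
    congr 1
    ext t x
    simp
  map_smul' z a := by
    rw [RingHom.id_apply, ← LinearMap.smul_comp]
    congr 1
    ext t x
    simp

/-- `v ↦ v₁ ⊗ v₂^⟨θ⟩` -/
def readSecond (θ : Bool) : H →ₗ[ℂ] H ⊗[ℂ] H :=
  (signed θ).lTensor H ∘ₗ Coalgebra.comul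

/-- `v ↦ v₂ ⊗ v₁^⟨θ⟩` -/
def readFirst (θ : Bool) : H →ₗ[ℂ] H ⊗[ℂ] H :=
  (signed θ).lTensor H ∘ₗ (TensorProduct.comm ℂ H H).toLinearMap ∘ₗ Coalgebra.comul

/-- `v ↦ ((v^⟨θ⟩)₁)^⟨θ⟩ ⊗ (v^⟨θ⟩)₂` -/
def readSigned (θ : Bool) : H →ₗ[ℂ] H ⊗[ℂ] H :=
  (signed θ).rTensor H ∘ₗ Coalgebra.comul ∘ₗ signed θ

/-- The part of the edge operator on the plaquette `P` to the left of `e`: the operator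
`X_P ↦ (((v_{e₁})₂^⟨θ₁⟩ ⋯ (v_{eₗ})₂^⟨θₗ⟩) ▷ a) X_P`, leaving `(v_{eᵢ})₁` on the edges. -/
def edgeOpLeft (e : L1) : A →ₗ[ℂ] Module.End ℂ (StateSpace L1 L2 A H) :=
  X.readAct (onPlaq L1 H (L.left (e, true)) ∘ₗ LinearMap.mul ℂ A)
    (readProd ((L.leftPath e).map fun d => readEdge L2 A d.1 (readSecond d.2)))

/-- The part of the edge operator on the plaquette `Q` to the right of `e`: the operator
`X_Q ↦ X_Q (((v_{d₁})₁^⟨σ₁⟩ ⋯ (v_{dᵣ})₁^⟨σᵣ⟩) ▷ S a)`, leaving `(v_{dⱼ})₂` on the edges. -/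
def edgeOpRight (e : L1) : A →ₗ[ℂ] Module.End ℂ (StateSpace L1 L2 A H) :=
  X.readAct (onPlaq L1 H (L.left (e, false)) ∘ₗ (LinearMap.mul ℂ A).flip)
    (readProd ((L.rightPath e).map fun d => readEdge L2 A d.1 (readFirst d.2))) ∘ₗ
    HopfAlgebra.antipode ℂ

/-- The part of the edge operator on the edge `e` itself: `v_e ↦ ∂a v_e`. -/
def edgeOpMid (L2 : Type*) (e : L1) : A →ₗ[ℂ] Module.End ℂ (StateSpace L1 L2 A H) :=
  onEdge L2 A e ∘ₗ LinearMap.mul ℂ H ∘ₗ X.bd.toCoalgHom.toLinearMap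

/-- The edge operators `E_e^a`: the elements `a₁`, `a₂`, `a₃` of the iterated coproduct of `a` are
used on the plaquette to the left, on the plaquette to the right and on the edge `e`. -/
def edgeOp (e : L1) : A →ₗ[ℂ] Module.End ℂ (StateSpace L1 L2 A H) :=
  (WithConv.toConv (X.edgeOpLeft L e) * WithConv.toConv (X.edgeOpRight L e) *
    WithConv.toConv (X.edgeOpMid L2 e)).ofConv

/-- Read off `(v_{e₁}^⟨θ₁⟩)₂ ⋯ (v_{eₙ}^⟨θₙ⟩)₂ S∂(X_P)₁` along the boundary of `p`. -/
def holonomy (p : L2) : StateSpace L1 L2 A H →ₗ[ℂ] StateSpace L1 L2 A H ⊗[ℂ] H :=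
  readProd (((L.boundary p).map fun d => readEdge L2 A d.1 (readSigned d.2)) ++
    [readPlaq L1 p ((HopfAlgebra.antipode ℂ ∘ₗ X.bd.toCoalgHom.toLinearMap).lTensor A ∘ₗ
      (TensorProduct.comm ℂ A A).toLinearMap ∘ₗ Coalgebra.comul)])

/-- The plaquette operators `F_p^φ`: evaluate `φ` on the holonomy. -/
def plaqOp (p : L2) : Module.Dual ℂ H →ₗ[ℂ] Module.End ℂ (StateSpace L1 L2 A H) where
  toFun φ := (TensorProduct.rid ℂ _).toLinearMap ∘ₗ φ.lTensor _ ∘ₗ X.holonomy L p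
  map_add' φ ψ := by
    rw [LinearMap.lTensor_add, LinearMap.add_comp, LinearMap.comp_add]
  map_smul' z φ := by
    rw [LinearMap.lTensor_smul, LinearMap.smul_comp, LinearMap.comp_smul, RingHom.id_apply]

end HopfCrossedModule

end Model

/-! ### The algebra of local operators -/

section LocalAlgebra

variable {A H C : Type*} [Ring A] [HopfAlgebra ℂ A] [Ring H] [HopfAlgebra ℂ H]

/-- The product of the dual Hopf algebra: `(φ ψ)(x) = φ(x₁) ψ(x₂)`. -/
def dualMul (H : Type*) [Ring H] [HopfAlgebra ℂ H] :
    Module.Dual ℂ H ⊗[ℂ] Module.Dual ℂ H →ₗ[ℂ] Module.Dual ℂ H :=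
  (Coalgebra.comul (R := ℂ) (A := H)).dualMap ∘ₗ TensorProduct.dualDistrib ℂ H H

/-- `(x, y) ↦ φ(y · ? · x)`, linear in `φ`, `x`, `y`. -/
def sandwich (H : Type*) [Ring H] [HopfAlgebra ℂ H] :
    Module.Dual ℂ H →ₗ[ℂ] H →ₗ[ℂ] H →ₗ[ℂ] Module.Dual ℂ H :=
  LinearMap.mk₂ ℂ
    (fun φ x => LinearMap.lcomp ℂ ℂ (LinearMap.mulRight ℂ x) ∘ₗ
      LinearMap.llcomp ℂ H H ℂ φ ∘ₗ LinearMap.mul ℂ H)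
    (by intro φ ψ x; ext y z; simp)
    (by intro c φ x; ext y z; simp)
    (by intro φ x x'; ext y z; simp [mul_add])
    (by intro c φ x; ext y z; simp)

@[simp]
theorem sandwich_apply (φ : Module.Dual ℂ H) (x y z : H) : sandwich H φ x y z = φ (y * (z * x)) :=
  rfl

/-- For linear maps `f g : C → H` out of a coalgebra, the linear map
`φ ⊗ c ↦ φ(f c₃ · ? · g c₁) ⊗ c₂`. -/
def twist [AddCommGroup C] [Module ℂ C] [Coalgebra ℂ C] (f g : C →ₗ[ℂ] H) :
    Module.Dual ℂ H ⊗[ℂ] C →ₗ[ℂ] Module.Dual ℂ H ⊗[ℂ] C :=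
  TensorProduct.lift
    (LinearMap.mk₂ ℂ
      (fun φ c => (TensorProduct.lift ((sandwich H φ).compl₁₂ g f)).rTensor C
        ((TensorProduct.rightComm ℂ C C C)
          ((Coalgebra.comul (R := ℂ) (A := C)).rTensor C (Coalgebra.comul (R := ℂ) c))))
      (by
        intro φ ψ c
        rw [← LinearMap.add_apply, ← LinearMap.rTensor_add]
        congr 2
        ext x y z
        simp)
      (by
        intro r φ c
        rw [← LinearMap.smul_apply, ← LinearMap.rTensor_smul]
        congr 2
        ext x y z
        simp)
      (by intro φ c c'; simp only [map_add])
      (by intro r φ c; simp only [map_smul]))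

/-- The bilinear product on `H* ⊗ C`, for linear maps `f g : C → H` and a product `m` on a coalgebra
`C`: `(φ ⊗ x) (ψ ⊗ y) = φ ψ(f x₃ · ? · g x₁) ⊗ x₂ y`. -/
def doubleMul [AddCommGroup C] [Module ℂ C] [Coalgebra ℂ C] (f g : C →ₗ[ℂ] H)
    (m : C ⊗[ℂ] C →ₗ[ℂ] C) :
    (Module.Dual ℂ H ⊗[ℂ] C) ⊗[ℂ] (Module.Dual ℂ H ⊗[ℂ] C) →ₗ[ℂ] Module.Dual ℂ H ⊗[ℂ] C :=
  TensorProduct.map (dualMul H) m ∘ₗ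
    (TensorProduct.assoc ℂ _ _ _).symm.toLinearMap ∘ₗ
    ((TensorProduct.assoc ℂ _ _ _).toLinearMap ∘ₗ
      (twist f g ∘ₗ (TensorProduct.comm ℂ _ _).toLinearMap).rTensor C ∘ₗ
      (TensorProduct.assoc ℂ _ _ _).symm.toLinearMap).lTensor (Module.Dual ℂ H) ∘ₗ
    (TensorProduct.assoc ℂ _ _ _).toLinearMap

/-- The product of the Drinfeld double `D(H)` on the vector space `H* ⊗ H`:
`(φ ⊗ h) (ψ ⊗ k) = φ ψ(S⁻¹ h₃ · ? · h₁) ⊗ h₂ k`. -/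
def drinfeldMul (H : Type*) [Ring H] [HopfAlgebra ℂ H] :
    (Module.Dual ℂ H ⊗[ℂ] H) ⊗[ℂ] (Module.Dual ℂ H ⊗[ℂ] H) →ₗ[ℂ] Module.Dual ℂ H ⊗[ℂ] H :=
  doubleMul (Ring.inverse (HopfAlgebra.antipode ℂ : Module.End ℂ H)) LinearMap.id
    (LinearMap.mul' ℂ H)

namespace HopfCrossedModule

variable (X : HopfCrossedModule A H)

/-- The product of the crossed product algebra `A ⋊ H` on the vector space `A ⊗ H`:
`(a ⊗ h) (b ⊗ k) = a (h₁ ▷ b) ⊗ h₂ k`. -/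
def crossedMul : (A ⊗[ℂ] H) ⊗[ℂ] (A ⊗[ℂ] H) →ₗ[ℂ] A ⊗[ℂ] H :=
  TensorProduct.lift (TensorProduct.lift
    ((LinearMap.mul ℂ (Module.End ℂ (A ⊗[ℂ] H))).compl₁₂
      (LinearMap.rTensorHom H ∘ₗ LinearMap.mul ℂ A)
      (TensorProduct.map₂ X.act.toLinearMap (LinearMap.mul ℂ H) ∘ₗ Coalgebra.comul)))

/-- The linear map `A ⋊ H → H`, `a ⊗ h ↦ ∂a h`. -/
def proj : A ⊗[ℂ] H →ₗ[ℂ] H :=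
  LinearMap.mul' ℂ H ∘ₗ X.bd.toCoalgHom.toLinearMap.rTensor H

/-- The product of the algebra of local operators on `H* ⊗ (A ⋊ H)`:
`(φ ⊗ (a ⊗ h)) (ψ ⊗ (b ⊗ k)) = φ ψ(S(∂a₃ h₃) · ? · ∂a₁ h₁) ⊗ (a₂ ⊗ h₂) (b ⊗ k)`. -/
def localMul : (Module.Dual ℂ H ⊗[ℂ] (A ⊗[ℂ] H)) ⊗[ℂ] (Module.Dual ℂ H ⊗[ℂ] (A ⊗[ℂ] H)) →ₗ[ℂ]
    Module.Dual ℂ H ⊗[ℂ] (A ⊗[ℂ] H) :=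
  doubleMul (HopfAlgebra.antipode ℂ ∘ₗ X.proj) X.proj X.crossedMul

end HopfCrossedModule

end LocalAlgebra

end

/-!
The vertex, edge and plaquette operators all lie in the endomorphism algebra `B` of the state space.
The idea of the proof is to treat a plaquette operator as a *reading*: multiplying the edges along
the boundary of the plaquette, followed by the antipode of `∂` of the plaquette, gives an element
`r` of `B ⊗ H`, the holonomy (`SlotSystem.hol`), and `F^φ = (id ⊗ φ) r` (`evalDual`). A vertex
operator is likewise a product of operators on single tensor factors, and an edge operator a product
of three factors, in the convolution algebra of linear maps from a coalgebra to `B` or to `B ⊗ H`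
(`WithConv`, `convLeft`, `convRight`, `convConst`). All relations then become identities between
products in these algebras, and follow from the relations on a single edge or plaquette together
with commutation relations between different tensor factors.

The relations between the operators come from the places where the paths and stars end. The boundary
of the plaquette starts with `e` and ends with another edge `y` at the base point. A vertex operator
acts on `e` and on `y`, so that it inserts a factor at one end of the holonomy and cancels it at the
other, and it leaves the other edges of the boundary alone; an edge operator inserts `∂a` at `e` and
cancels it at the plaquette. This pattern is `intertwine_of_ends`, and it gives the relation
`Intertwines r g Y`, which says `r (1 ⊗ g c₁) (Y c₂ ⊗ 1) = (Y c₁ ⊗ 1) (1 ⊗ g c₂) r`. Its solution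
for the product in the other order is the straightening relation with the twisted functional
(`Intertwines.twist`). It needs that the antipode of `H` is an involution. The relation between
vertex and edge operators is the equivariance `IsEquivariant`, again checked on single factors.
In the edge operators, the action of a path on `A` (`actLeg`, `transport`) commutes with the
readings of other paths because of the Yetter–Drinfeld condition (`LegsCommute`).

That the antipode of a finite dimensional semisimple Hopf algebra over `ℂ` is an involution is the
theorem of Larson and Radford (`antipode_antipode`). It is proved with the integral
`λ(h) = tr (x ↦ h S²(x))` on `H`. Up to a group-like element `a`, the integral `λ` is two-sided, and
comparing `λ` with `λ(S ?)` gives `a S⁴(y) a⁻¹ = y` (`antipode_pow_four`). As `H` is semisimple, and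
therefore a product of matrix algebras, `λ(1) = tr S²` does not vanish, which forces `a = 1`, and
then `S²` is an involution with non-zero trace. If `S² ≠ 1`, its eigenspaces would have dimensions
`r, s > 0`, and the projection given by the character of the coregular representation would yield
an integer `k` with `(r + s) k = r - s ≠ 0`, which is absurd.

The algebra of local operators is handled by `LocalModel`: a reading and families of edge and vertex
operators in any algebra that satisfy the relations above. Every local model represents the
multiplication `localMul` (`LocalModel.rep_localMul`). There are two of them. In `regularModel`, the
operators act on `H* ⊗ (A ⊗ H)` itself, by left multiplication, so that associativity follows; in
`stateModel` they are the local operators on the state space. For `A = ℂ`, the algebra becomes the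
Drinfeld double since its multiplication is natural in the coalgebra `A ⊗ H` (`lTensor_doubleMul`),
and `S⁻¹ = S`.
-/

set_option linter.unusedSectionVars false

open Coalgebra WithConv

noncomputable section

/-! ### Convolution of linear maps from a coalgebra to an algebra -/

theorem conv_ext {C B : Type*} [AddCommGroup C] [Module ℂ C] [Ring B] [Algebra ℂ B]
    {f g : WithConv (C →ₗ[ℂ] B)} (h : ∀ c, f c = g c) : f = g := by
  ext c
  exact h c

section Convolution

variable {C B B' : Type*} [AddCommGroup C] [Module ℂ C] [Coalgebra ℂ C]
  [Ring B] [Algebra ℂ B] [Ring B'] [Algebra ℂ B']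

/-- The map `c ↦ ε(c) b`. These maps form a copy of the algebra `B` inside the convolution algebra
of linear maps from `C` to `B`. -/
def convConst (C : Type*) [AddCommGroup C] [Module ℂ C] [Coalgebra ℂ C] (b : B) :
    WithConv (C →ₗ[ℂ] B) :=
  toConv ((counit (R := ℂ) (A := C)).smulRight b)

theorem convConst_apply (b : B) (c : C) : convConst C b c = counit (R := ℂ) c • b := rfl

theorem convConst_mul_apply (b : B) (f : WithConv (C →ₗ[ℂ] B)) (c : C) :
    (convConst C b * f) c = b * f c := by
  rw [(ℛ ℂ c).convMul_apply]
  conv_rhs => rw [← sum_counit_smul (ℛ ℂ c)]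
  simp [convConst_apply, Finset.mul_sum]

theorem mul_convConst_apply (b : B) (f : WithConv (C →ₗ[ℂ] B)) (c : C) :
    (f * convConst C b) c = f c * b := by
  have h := congrArg (TensorProduct.rid ℂ C) (sum_tmul_counit_eq (ℛ ℂ c))
  simp only [map_sum, TensorProduct.rid_tmul, one_smul] at h
  rw [(ℛ ℂ c).convMul_apply]
  conv_rhs => rw [← h]
  simp [convConst_apply, Finset.sum_mul]

theorem convConst_mul (a b : B) : convConst C (a * b) = convConst C a * convConst C b := by
  ext c
  change convConst C (a * b) c = (convConst C a * convConst C b) c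
  rw [convConst_mul_apply]
  simp [convConst_apply]

theorem commute_convConst {b : B} {f : WithConv (C →ₗ[ℂ] B)} (h : ∀ c, Commute b (f c)) :
    Commute (convConst C b) f := by
  ext c
  change (convConst C b * f) c = (f * convConst C b) c
  rw [convConst_mul_apply, mul_convConst_apply]
  exact h c

/-- Composition with an algebra morphism is multiplicative for the convolution product. -/
theorem toConv_algHom_comp_mul (g : B →ₐ[ℂ] B') (f f' : WithConv (C →ₗ[ℂ] B)) :
    toConv (g.toLinearMap ∘ₗ (f * f').ofConv) =
      toConv (g.toLinearMap ∘ₗ f.ofConv) * toConv (g.toLinearMap ∘ₗ f'.ofConv) := by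
  rw [LinearMap.algHom_comp_convMul_distrib]

theorem toConv_algHom_comp_one (g : B →ₐ[ℂ] B') :
    toConv (g.toLinearMap ∘ₗ (1 : WithConv (C →ₗ[ℂ] B)).ofConv) = 1 := by
  ext c
  simp

/-- The value of a linear map on `c₁ ⊗ (c₂ ⊗ c₃)` does not depend on the order of expansion. -/
theorem sum_comul_assoc {M : Type*} [AddCommGroup M] [Module ℂ M]
    (F : C →ₗ[ℂ] C →ₗ[ℂ] C →ₗ[ℂ] M) (c : C) :
    ∑ i ∈ (ℛ ℂ c).index, ∑ j ∈ (ℛ ℂ ((ℛ ℂ c).left i)).index,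
      F ((ℛ ℂ ((ℛ ℂ c).left i)).left j) ((ℛ ℂ ((ℛ ℂ c).left i)).right j) ((ℛ ℂ c).right i) =
    ∑ i ∈ (ℛ ℂ c).index, ∑ j ∈ (ℛ ℂ ((ℛ ℂ c).right i)).index,
      F ((ℛ ℂ c).left i) ((ℛ ℂ ((ℛ ℂ c).right i)).left j)
        ((ℛ ℂ ((ℛ ℂ c).right i)).right j) := by
  have h := congrArg (TensorProduct.lift
      (TensorProduct.uncurry (.id ℂ) C C M ∘ₗ F))
    (sum_tmul_tmul_eq (ℛ ℂ c) (fun i => ℛ ℂ ((ℛ ℂ c).left i))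
      (fun i => ℛ ℂ ((ℛ ℂ c).right i)))
  simpa using h

/-- The convolution algebra element `c ↦ f c ⊗ 1`. -/
def convLeft (B' : Type*) [Ring B'] [Algebra ℂ B'] (f : WithConv (C →ₗ[ℂ] B)) :
    WithConv (C →ₗ[ℂ] B ⊗[ℂ] B') :=
  toConv ((Algebra.TensorProduct.includeLeft (R := ℂ) (S := ℂ)).toLinearMap ∘ₗ f.ofConv)

/-- The convolution algebra element `c ↦ 1 ⊗ f c`. -/
def convRight (B : Type*) [Ring B] [Algebra ℂ B] (f : WithConv (C →ₗ[ℂ] B')) :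
    WithConv (C →ₗ[ℂ] B ⊗[ℂ] B') :=
  toConv ((Algebra.TensorProduct.includeRight (R := ℂ)).toLinearMap ∘ₗ f.ofConv)

theorem convLeft_apply (f : WithConv (C →ₗ[ℂ] B)) (c : C) : convLeft B' f c = f c ⊗ₜ 1 := rfl

theorem convRight_apply (f : WithConv (C →ₗ[ℂ] B')) (c : C) : convRight B f c = 1 ⊗ₜ f c := rfl

theorem convLeft_mul (f g : WithConv (C →ₗ[ℂ] B)) :
    convLeft B' (f * g) = convLeft B' f * convLeft B' g :=
  toConv_algHom_comp_mul _ _ _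

theorem convRight_mul (f g : WithConv (C →ₗ[ℂ] B')) :
    convRight B (f * g) = convRight B f * convRight B g :=
  toConv_algHom_comp_mul _ _ _

theorem convLeft_one : convLeft B' (1 : WithConv (C →ₗ[ℂ] B)) = 1 :=
  toConv_algHom_comp_one _

theorem convRight_one : convRight B (1 : WithConv (C →ₗ[ℂ] B')) = 1 :=
  toConv_algHom_comp_one _

theorem convLeft_list_prod (l : List (WithConv (C →ₗ[ℂ] B))) :
    convLeft B' l.prod = (l.map (convLeft B')).prod := by
  induction l with
  | nil => simp [convLeft_one]
  | cons b l ih => simp [convLeft_mul, ih]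

end Convolution

section Hopf

variable {H : Type*} [Ring H] [HopfAlgebra ℂ H]

open HopfAlgebra Algebra.TensorProduct

local notation "i₁" => convLeft H (toConv (LinearMap.id : H →ₗ[ℂ] H))
local notation "i₂" => convRight H (toConv (LinearMap.id : H →ₗ[ℂ] H))
local notation "i₁S" => convLeft H (toConv (antipode ℂ : H →ₗ[ℂ] H))
local notation "i₂S" => convRight H (toConv (antipode ℂ : H →ₗ[ℂ] H))

theorem toConv_comul_eq : (toConv comul : WithConv (H →ₗ[ℂ] H ⊗[ℂ] H)) = i₁ * i₂ := by
  refine conv_ext fun h => ?_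
  rw [(ℛ ℂ h).convMul_apply]
  simp [convLeft_apply, convRight_apply, (ℛ ℂ h).eq]

/-- The antipode reverses the coproduct: `Δ(S h) = S h₂ ⊗ S h₁`. Both sides are convolution inverse
to `Δ`. -/
theorem comul_antipode (h : H) :
    comul (R := ℂ) (antipode ℂ h) = TensorProduct.map (antipode ℂ) (antipode ℂ)
      (TensorProduct.comm ℂ H H (comul (R := ℂ) h)) := by
  have h1 : i₂S * i₁S * toConv comul = 1 := by
    rw [toConv_comul_eq, mul_assoc, ← mul_assoc i₁S, ← convLeft_mul, LinearMap.antipode_mul_id,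
      convLeft_one, one_mul, ← convRight_mul, LinearMap.antipode_mul_id, convRight_one]
  have h2 := left_inv_eq_right_inv h1 (LinearMap.comul_right_inv (R := ℂ) (C := H))
  have h3 := congrArg (fun f => f.ofConv h) h2
  change (i₂S * i₁S) h = comul (R := ℂ) (antipode ℂ h) at h3
  rw [← h3, (ℛ ℂ h).convMul_apply, ← (ℛ ℂ h).eq]
  simp [convLeft_apply, convRight_apply]

/-- `Δ(S h)` as a sum over a representation of `Δ h`. -/
theorem sum_antipode_tmul_antipode (h : H) :
    ∑ i ∈ (ℛ ℂ h).index, antipode ℂ ((ℛ ℂ h).right i) ⊗ₜ[ℂ] antipode ℂ ((ℛ ℂ h).left i) =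
      comul (R := ℂ) (antipode ℂ h) := by
  rw [comul_antipode, ← (ℛ ℂ h).eq]
  simp

/-- The square of the antipode is a morphism of coalgebras. -/
theorem comul_antipode_antipode (h : H) :
    comul (R := ℂ) (antipode ℂ (antipode ℂ h)) =
      TensorProduct.map (antipode ℂ ∘ₗ antipode ℂ) (antipode ℂ ∘ₗ antipode ℂ)
        (comul (R := ℂ) h) := by
  rw [comul_antipode, comul_antipode, ← (ℛ ℂ h).eq]
  simp

/-- For a left integral `t`: `t₁ ⊗ h t₂ = S(h) t₁ ⊗ t₂`. -/
theorem one_tmul_mul_comul_integral {t : H} (ht : ∀ h : H, h * t = counit (R := ℂ) h • t) (h : H) :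
    ((1 : H) ⊗ₜ[ℂ] h) * comul (R := ℂ) t = (antipode ℂ h ⊗ₜ[ℂ] (1 : H)) * comul (R := ℂ) t := by
  have h1 : toConv comul * convConst H (comul (R := ℂ) t) = convConst H (comul (R := ℂ) t) := by
    refine conv_ext fun k => ?_
    rw [mul_convConst_apply, convConst_apply]
    change comul (R := ℂ) k * _ = _
    rw [← Bialgebra.comul_mul, ht, map_smul]
  have h2 : i₂ * convConst H (comul (R := ℂ) t) = i₁S * convConst H (comul (R := ℂ) t) := by
    conv_rhs => rw [← h1, toConv_comul_eq, ← mul_assoc, ← mul_assoc, ← convLeft_mul,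
      LinearMap.antipode_mul_id, convLeft_one, one_mul]
  have h3 := congrArg (fun f => f.ofConv h) h2
  change (i₂ * convConst H (comul (R := ℂ) t)) h = (i₁S * convConst H (comul (R := ℂ) t)) h at h3
  rwa [mul_convConst_apply, mul_convConst_apply] at h3

/-- For a right integral `t`: `t₁ h ⊗ t₂ = t₁ ⊗ t₂ S(h)`. -/
theorem comul_integral_mul_tmul_one {t : H} (ht : ∀ h : H, t * h = counit (R := ℂ) h • t) (h : H) :
    comul (R := ℂ) t * (h ⊗ₜ[ℂ] (1 : H)) = comul (R := ℂ) t * ((1 : H) ⊗ₜ[ℂ] antipode ℂ h) := by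
  have h1 : convConst H (comul (R := ℂ) t) * toConv comul = convConst H (comul (R := ℂ) t) := by
    refine conv_ext fun k => ?_
    rw [convConst_mul_apply, convConst_apply]
    change _ * comul (R := ℂ) k = _
    rw [← Bialgebra.comul_mul, ht, map_smul]
  have h2 : convConst H (comul (R := ℂ) t) * i₁ = convConst H (comul (R := ℂ) t) * i₂S := by
    conv_rhs => rw [← h1, toConv_comul_eq, mul_assoc, mul_assoc, ← convRight_mul,
      LinearMap.id_mul_antipode, convRight_one, mul_one]
  have h3 := congrArg (fun f => f.ofConv h) h2
  change (convConst H (comul (R := ℂ) t) * i₁) h = (convConst H (comul (R := ℂ) t) * i₂S) h at h3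
  rwa [convConst_mul_apply, convConst_mul_apply] at h3

end Hopf

/-! ### Integrals of a semisimple Hopf algebra -/

section Integrals

variable {H : Type*} [Ring H] [HopfAlgebra ℂ H]

open HopfAlgebra

/-- The operator `y ↦ p(y₁) y₂`. -/
def leftHit : Module.Dual ℂ H →ₗ[ℂ] Module.End ℂ H where
  toFun p := (TensorProduct.lid ℂ H).toLinearMap ∘ₗ p.rTensor H ∘ₗ comul
  map_add' p q := by rw [LinearMap.rTensor_add, LinearMap.add_comp, LinearMap.comp_add]
  map_smul' z p := by
    rw [LinearMap.rTensor_smul, LinearMap.smul_comp, LinearMap.comp_smul, RingHom.id_apply]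

/-- The operator `y ↦ p(y₂) y₁`. -/
def rightHit : Module.Dual ℂ H →ₗ[ℂ] Module.End ℂ H where
  toFun p := (TensorProduct.rid ℂ H).toLinearMap ∘ₗ p.lTensor H ∘ₗ comul
  map_add' p q := by rw [LinearMap.lTensor_add, LinearMap.add_comp, LinearMap.comp_add]
  map_smul' z p := by
    rw [LinearMap.lTensor_smul, LinearMap.smul_comp, LinearMap.comp_smul, RingHom.id_apply]

theorem leftHit_eq {ι : Type*} (p : Module.Dual ℂ H) {y : H} (r : Coalgebra.Repr ℂ y ι) :
    leftHit p y = ∑ i ∈ r.index, p (r.left i) • r.right i := by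
  simp [leftHit, ← r.eq]

theorem rightHit_eq {ι : Type*} (p : Module.Dual ℂ H) {y : H} (r : Coalgebra.Repr ℂ y ι) :
    rightHit p y = ∑ i ∈ r.index, p (r.right i) • r.left i := by
  simp [rightHit, ← r.eq]

theorem apply_rightHit (p q : Module.Dual ℂ H) (y : H) :
    p (rightHit q y) = q (leftHit p y) := by
  rw [leftHit_eq p (ℛ ℂ y), rightHit_eq q (ℛ ℂ y)]
  simp [mul_comm]

/-- `F(x₁ S(x₂), x₃) = F(1, x)`. -/
theorem sum_mul_antipode_cancel {M : Type*} [AddCommGroup M] [Module ℂ M]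
    (F : H →ₗ[ℂ] H →ₗ[ℂ] M) (x : H) :
    ∑ i ∈ (ℛ ℂ x).index, ∑ j ∈ (ℛ ℂ ((ℛ ℂ x).right i)).index,
      F ((ℛ ℂ x).left i * antipode ℂ ((ℛ ℂ ((ℛ ℂ x).right i)).left j))
        ((ℛ ℂ ((ℛ ℂ x).right i)).right j) = F 1 x := by
  have h := sum_comul_assoc
    ((LinearMap.llcomp ℂ H H (H →ₗ[ℂ] M) F ∘ₗ LinearMap.mul ℂ H).compl₂ (antipode ℂ)) x
  simp only [LinearMap.compl₂_apply, LinearMap.comp_apply, LinearMap.llcomp_apply,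
    LinearMap.mul_apply'] at h
  rw [← h]
  have h1 : ∀ i ∈ (ℛ ℂ x).index, ∑ j ∈ (ℛ ℂ ((ℛ ℂ x).left i)).index,
      F ((ℛ ℂ ((ℛ ℂ x).left i)).left j * antipode ℂ ((ℛ ℂ ((ℛ ℂ x).left i)).right j))
        ((ℛ ℂ x).right i) = F 1 (counit (R := ℂ) ((ℛ ℂ x).left i) • (ℛ ℂ x).right i) := by
    intro i _
    rw [← LinearMap.sum_apply, ← map_sum, sum_mul_antipode_eq_smul]
    simp
  rw [Finset.sum_congr rfl h1, ← map_sum, sum_counit_smul]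

/-- A semisimple algebra with a character `e` contains a left integral for `e`. -/
theorem exists_integral_of_semisimple {R : Type*} [Ring R] [Algebra ℂ R] [IsSemisimpleRing R]
    (e : R →ₐ[ℂ] ℂ) : ∃ t : R, e t = 1 ∧ ∀ h : R, h * t = e h • t := by
  obtain ⟨N, hN⟩ := exists_isCompl (RingHom.ker e : Submodule R R)
  obtain ⟨k, hk, t, ht, hkt⟩ := Submodule.mem_sup.mp
    (hN.sup_eq_top ▸ Submodule.mem_top : (1 : R) ∈ (RingHom.ker e : Submodule R R) ⊔ N)
  have hk' : e k = 0 := hk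
  have ht1 : e t = 1 := by
    have := congrArg e hkt
    rwa [map_add, hk', zero_add, map_one] at this
  refine ⟨t, ht1, fun h => ?_⟩
  have h1 : h * t - e h • t ∈ (RingHom.ker e : Submodule R R) := by
    change e _ = 0
    simp [ht1]
  have h2 : h * t - e h • t ∈ N := by
    refine N.sub_mem (N.smul_mem h ht) ?_
    rw [Algebra.smul_def]
    exact N.smul_mem _ ht
  exact sub_eq_zero.mp (Submodule.disjoint_def.mp hN.disjoint _ h1 h2)

/-- A semisimple Hopf algebra has a two-sided integral `t` with `ε(t) = 1`. -/
theorem exists_integral [IsSemisimpleRing H] : ∃ t : H, counit (R := ℂ) t = 1 ∧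
    (∀ h : H, h * t = counit (R := ℂ) h • t) ∧ ∀ h : H, t * h = counit (R := ℂ) h • t := by
  obtain ⟨t, ht, hl⟩ := exists_integral_of_semisimple (Bialgebra.counitAlgHom ℂ H)
  obtain ⟨s, hs, hr⟩ := exists_integral_of_semisimple
    (R := Hᵐᵒᵖ) ((Bialgebra.counitAlgHom ℂ H).fromOpposite fun _ _ => mul_comm _ _)
  obtain ⟨s, rfl⟩ := MulOpposite.op_surjective s
  have hr' : ∀ h : H, s * h = counit (R := ℂ) h • s := by
    intro h
    have := hr (MulOpposite.op h)
    exact MulOpposite.op_injective this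
  have hts : s = t := by
    have h1 := hr' t
    have h2 := hl s
    simp only [Bialgebra.counitAlgHom_apply] at ht h2
    have hs' : counit (R := ℂ) s = 1 := hs
    rw [ht, one_smul] at h1
    rw [hs', one_smul] at h2
    rw [← h1, h2]
  subst hts
  exact ⟨s, ht, hl, hr'⟩

variable (H) in
/-- The functional `h ↦ Tr(x ↦ h S²(x))`. -/
def traceIntegral : Module.Dual ℂ H :=
  LinearMap.trace ℂ H ∘ₗ LinearMap.lcomp ℂ H (antipode ℂ ∘ₗ antipode ℂ) ∘ₗ LinearMap.mul ℂ H

theorem traceIntegral_apply (h : H) :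
    traceIntegral H h = LinearMap.trace ℂ H
      (LinearMap.mulLeft ℂ h ∘ₗ (antipode ℂ ∘ₗ antipode ℂ)) := rfl

/-- Up to `S²`, the functional `λ` is a trace. -/
theorem traceIntegral_mul_comm (x y : H) :
    traceIntegral H (x * y) = traceIntegral H (y * antipode ℂ (antipode ℂ x)) := by
  rw [traceIntegral_apply, LinearMap.mulLeft_mul, LinearMap.comp_assoc]
  erw [LinearMap.trace_mul_comm]
  rw [traceIntegral_apply]
  congr 1
  ext z
  simp [antipode_mul_antidistrib]

variable [FiniteDimensional ℂ H]

/-- The coproduct of an element of the dual Hopf algebra, in coordinates. -/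
theorem exists_dual_mul (p : Module.Dual ℂ H) :
    ∃ (n : ℕ) (f g : Fin n → Module.Dual ℂ H), ∀ a b : H, p (a * b) = ∑ k, f k a * g k b := by
  refine ⟨_, fun k => p ∘ₗ LinearMap.mulRight ℂ (Module.finBasis ℂ H k),
    fun k => (Module.finBasis ℂ H).coord k, fun a b => ?_⟩
  have h := congrArg (fun z => p (a * z)) ((Module.finBasis ℂ H).sum_repr b)
  simp only [Finset.mul_sum, map_sum, mul_smul_comm, map_smul, smul_eq_mul] at h
  rw [← h]
  simp [mul_comm]

/-- The functional `λ(h) = Tr(x ↦ h S²(x))` is an integral of the dual Hopf algebra. With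
`p(a b) = ∑ f(a) g(b)`, the operator `x ↦ p(h₁) h₂ S²(x)` is a sum of conjugates
`leftHit f ∘ (x ↦ h S²(x)) ∘ leftHit (g ∘ S)`, and the trace is cyclic. -/
theorem rightHit_traceIntegral (h : H) :
    rightHit (traceIntegral H) h = traceIntegral H h • (1 : H) := by
  refine Module.forall_dual_apply_eq_zero_iff ℂ _ |>.mp (fun p => ?_) |> sub_eq_zero.mp
  rw [map_sub, sub_eq_zero, apply_rightHit, map_smul, smul_eq_mul]
  obtain ⟨n, f, g, hfg⟩ := exists_dual_mul p
  set T : H →ₗ[ℂ] Module.End ℂ H :=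
    LinearMap.lcomp ℂ H (antipode ℂ ∘ₗ antipode ℂ) ∘ₗ LinearMap.mul ℂ H with hT
  have hTa : ∀ h x : H, T h x = h * antipode ℂ (antipode ℂ x) := fun _ _ => rfl
  -- with `p(x y) = Σ f(x) g(y)`: the operators conjugating `T h` below compose to `p(1)`
  have h1 : ∑ k, leftHit (g k ∘ₗ antipode ℂ) * leftHit (f k) = p 1 • (1 : Module.End ℂ H) := by
    ext y
    have key := sum_mul_antipode_cancel (LinearMap.lsmul ℂ H ∘ₗ p) y
    simp only [LinearMap.comp_apply, LinearMap.smul_apply,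
      LinearMap.sum_apply, Module.End.mul_apply, Module.End.one_apply,
      LinearMap.lsmul_apply] at key ⊢
    rw [← key]
    have h2 : ∀ k, leftHit (g k ∘ₗ antipode ℂ) (leftHit (f k) y) =
        ∑ i ∈ (ℛ ℂ y).index, ∑ j ∈ (ℛ ℂ ((ℛ ℂ y).right i)).index,
          (f k ((ℛ ℂ y).left i) * g k (antipode ℂ ((ℛ ℂ ((ℛ ℂ y).right i)).left j))) •
            (ℛ ℂ ((ℛ ℂ y).right i)).right j := by
      intro k
      rw [leftHit_eq (f k) (ℛ ℂ y), map_sum]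
      refine Finset.sum_congr rfl fun i _ => ?_
      rw [map_smul, leftHit_eq _ (ℛ ℂ ((ℛ ℂ y).right i)), Finset.smul_sum]
      simp [smul_smul]
    simp only [h2]
    rw [Finset.sum_comm]
    refine Finset.sum_congr rfl fun i _ => ?_
    rw [Finset.sum_comm]
    refine Finset.sum_congr rfl fun j _ => ?_
    rw [← Finset.sum_smul, ← hfg]
  -- `T(p(h₁) h₂)` is `T(h)` composed with these operators on its two sides, in the order which
  -- the trace reverses
  have h3 : T (leftHit p h) = ∑ k, leftHit (f k) * (T h * leftHit (g k ∘ₗ antipode ℂ)) := by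
    ext x
    simp only [LinearMap.sum_apply, Module.End.mul_apply, hTa]
    have h4 : ∀ k, leftHit (f k) (h * antipode ℂ (antipode ℂ (leftHit (g k ∘ₗ antipode ℂ) x))) =
        ∑ m ∈ (ℛ ℂ h).index, ∑ i ∈ (ℛ ℂ x).index, ∑ j ∈ (ℛ ℂ ((ℛ ℂ x).right i)).index,
          (f k ((ℛ ℂ h).left m * antipode ℂ (antipode ℂ (((ℛ ℂ ((ℛ ℂ x).right i)).left j)))) *
            g k (antipode ℂ ((ℛ ℂ x).left i))) •
          ((ℛ ℂ h).right m * antipode ℂ (antipode ℂ (((ℛ ℂ ((ℛ ℂ x).right i)).right j)))) := by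
      intro k
      rw [leftHit_eq _ (ℛ ℂ x)]
      simp only [map_sum, map_smul, Finset.mul_sum, mul_smul_comm]
      rw [Finset.sum_comm]
      refine Finset.sum_congr rfl fun i _ => ?_
      change _ • (TensorProduct.lid ℂ H).toLinearMap ((f k).rTensor H (comul (R := ℂ) _)) = _
      rw [Bialgebra.comul_mul, comul_antipode_antipode, ← (ℛ ℂ h).eq,
        ← (ℛ ℂ ((ℛ ℂ x).right i)).eq]
      simp only [map_sum, TensorProduct.map_tmul, Finset.sum_mul, Finset.mul_sum, Finset.smul_sum,
        Algebra.TensorProduct.tmul_mul_tmul, LinearMap.rTensor_tmul, LinearEquiv.coe_coe,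
        TensorProduct.lid_tmul, smul_smul, LinearMap.comp_apply]
      simp only [mul_comm (f k _)]
      rw [Finset.sum_comm]
    simp only [h4]
    rw [Finset.sum_comm, leftHit_eq p (ℛ ℂ h), Finset.sum_mul]
    refine Finset.sum_congr rfl fun m _ => ?_
    have key := sum_mul_antipode_cancel (LinearMap.mk₂ ℂ
      (fun u z : H => p ((ℛ ℂ h).left m * antipode ℂ u) •
        ((ℛ ℂ h).right m * antipode ℂ (antipode ℂ z)))
      (by intros; simp [mul_add, add_smul]) (by intros; simp [smul_smul])
      (by intros; simp [mul_add])
      (by intros; simp only [map_smul, mul_smul_comm]; rw [smul_comm])) x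
    simp only [LinearMap.mk₂_apply, antipode_one, mul_one] at key
    rw [smul_mul_assoc, ← key, Finset.sum_comm]
    refine Finset.sum_congr rfl fun i _ => ?_
    rw [Finset.sum_comm]
    refine Finset.sum_congr rfl fun j _ => ?_
    rw [← Finset.sum_smul, antipode_mul_antidistrib, ← mul_assoc, hfg]
  have h5 : ∀ h, traceIntegral H h = LinearMap.trace ℂ H (T h) := fun _ => rfl
  rw [h5, h3, map_sum]
  have h6 : ∀ k, LinearMap.trace ℂ H (leftHit (f k) * (T h * leftHit (g k ∘ₗ antipode ℂ))) =
      LinearMap.trace ℂ H (T h * (leftHit (g k ∘ₗ antipode ℂ) * leftHit (f k))) := by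
    intro k
    rw [LinearMap.trace_mul_comm, mul_assoc]
  simp only [h6]
  rw [← map_sum, ← Finset.mul_sum, h1, h5, mul_smul_comm, mul_one, map_smul, smul_eq_mul, mul_comm]

/-- With the integral `t` the operator `x ↦ t S²(x)` has rank one. -/
theorem traceIntegral_integral {t : H} (ht : ∀ h : H, t * h = counit (R := ℂ) h • t) :
    traceIntegral H t = counit (R := ℂ) t := by
  rw [traceIntegral_apply]
  have : LinearMap.mulLeft ℂ t ∘ₗ (antipode ℂ ∘ₗ antipode ℂ) =
      (counit (R := ℂ) (A := H)).smulRight t := by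
    ext x
    simp [ht]
  rw [this, LinearMap.trace_smulRight]

end Integrals

/-! ### The modular element and the fourth power of the antipode -/

section Integrals

variable {H : Type*} [Ring H] [HopfAlgebra ℂ H]

open HopfAlgebra

/-- The operators `leftHit q` are colinear: `Δ(q(x₁) x₂) = q(x₁) x₂ ⊗ x₃`. -/
theorem comul_leftHit (q : Module.Dual ℂ H) (x : H) :
    comul (R := ℂ) (leftHit q x) = (leftHit q).rTensor H (comul (R := ℂ) x) := by
  have h := sum_comul_assoc ((LinearMap.lsmul ℂ (H →ₗ[ℂ] H →ₗ[ℂ] H ⊗[ℂ] H)).flip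
    (TensorProduct.mk ℂ H H) ∘ₗ q) x
  simp only [LinearMap.comp_apply, LinearMap.flip_apply, LinearMap.lsmul_apply,
    LinearMap.smul_apply, TensorProduct.mk_apply] at h
  have h1 : comul (R := ℂ) (leftHit q x) = ∑ i ∈ (ℛ ℂ x).index,
      q ((ℛ ℂ x).left i) • comul (R := ℂ) ((ℛ ℂ x).right i) := by
    rw [leftHit_eq q (ℛ ℂ x), map_sum]
    simp
  have h2 : (leftHit q).rTensor H (comul (R := ℂ) x) = ∑ i ∈ (ℛ ℂ x).index,
      leftHit q ((ℛ ℂ x).left i) ⊗ₜ[ℂ] (ℛ ℂ x).right i := by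
    conv_lhs => rw [← (ℛ ℂ x).eq]
    simp
  rw [h1, h2]
  simp only [← (ℛ ℂ ((ℛ ℂ x).right _)).eq, leftHit_eq q (ℛ ℂ ((ℛ ℂ x).left _)), Finset.smul_sum,
    TensorProduct.sum_tmul, TensorProduct.smul_tmul']
  simpa only [TensorProduct.smul_tmul'] using h.symm

theorem rightHit_comp (p q : Module.Dual ℂ H) (x : H) :
    rightHit q (rightHit p x) = rightHit (q ∘ₗ rightHit p) x := by
  have h := sum_comul_assoc (LinearMap.mk₂ ℂ
    (fun a b => (p.smulRight (q b • a) : H →ₗ[ℂ] H))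
    (by intros; ext; simp) (by intros; ext; simp [smul_smul, mul_left_comm, mul_comm])
    (by intros; ext; simp [add_smul]) (by intros; ext; simp [smul_smul, mul_left_comm])) x
  simp only [LinearMap.mk₂_apply, LinearMap.smulRight_apply] at h
  rw [rightHit_eq p (ℛ ℂ x), rightHit_eq _ (ℛ ℂ x), map_sum]
  simp only [map_smul, LinearMap.comp_apply, rightHit_eq q (ℛ ℂ ((ℛ ℂ x).left _)),
    rightHit_eq p (ℛ ℂ ((ℛ ℂ x).right _)), map_sum, Finset.smul_sum, Finset.sum_smul]
  rw [h]
  simp [smul_smul]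

/-- `(x₁ h) q(x₂)`, contracted in two ways. -/
theorem rightHit_mul_of_integral {t : H} (ht : ∀ h : H, t * h = counit (R := ℂ) h • t)
    (q : Module.Dual ℂ H) (h : H) :
    rightHit q t * h = rightHit (q ∘ₗ LinearMap.mulRight ℂ (antipode ℂ h)) t := by
  have h1 := congrArg ((TensorProduct.rid ℂ H).toLinearMap ∘ₗ q.lTensor H)
    (comul_integral_mul_tmul_one ht h)
  rw [rightHit_eq _ (ℛ ℂ t), rightHit_eq _ (ℛ ℂ t)]
  rw [← (ℛ ℂ t).eq] at h1
  simpa [Finset.sum_mul] using h1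

theorem mul_rightHit_of_integral {t : H} (ht : ∀ h : H, h * t = counit (R := ℂ) h • t)
    (q : Module.Dual ℂ H) (h : H) :
    antipode ℂ h * rightHit q t = rightHit (q ∘ₗ LinearMap.mulLeft ℂ h) t := by
  have h1 := congrArg ((TensorProduct.rid ℂ H).toLinearMap ∘ₗ q.lTensor H)
    (one_tmul_mul_comul_integral ht h)
  rw [rightHit_eq _ (ℛ ℂ t), rightHit_eq _ (ℛ ℂ t)]
  rw [← (ℛ ℂ t).eq] at h1
  simpa [Finset.mul_sum] using h1.symm

/-- A group-like element has finite order, because group-likes are linearly independent. -/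
theorem IsGroupLikeElem.exists_pow_eq_one [FiniteDimensional ℂ H] {a : H}
    (ha : IsGroupLikeElem ℂ a) :
    ∃ n : ℕ, 0 < n ∧ a ^ n = 1 := by
  have : Finite (GroupLike ℂ H) := (linearIndep_groupLikeVal (R := ℂ) (A := H)).finite
  obtain ⟨n, hn, h⟩ := (isOfFinOrder_of_finite (⟨a, ha⟩ : GroupLike ℂ H)).exists_pow_eq_one
  exact ⟨n, hn, congrArg GroupLike.val h⟩

variable [FiniteDimensional ℂ H] [IsSemisimpleRing H]

variable (H) in
/-- For a two-sided integral `t` one has `h = t₁ λ(t₂ S(h))`, so that `S(h)` determines `h`. -/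
theorem antipode_injective : Function.Injective (antipode ℂ (A := H)) := by
  obtain ⟨t, ht, hl, hr⟩ := exists_integral (H := H)
  refine (injective_iff_map_eq_zero _).mpr fun h hh => ?_
  have h1 := rightHit_mul_of_integral hr (traceIntegral H) h
  rw [rightHit_traceIntegral, traceIntegral_integral hr, ht, one_smul, one_mul, hh] at h1
  rw [h1]
  have : traceIntegral H ∘ₗ LinearMap.mulRight ℂ (0 : H) = 0 := by ext; simp
  rw [this, map_zero, LinearMap.zero_apply]

variable (H) in
theorem antipode_surjective : Function.Surjective (antipode ℂ (A := H)) :=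
  LinearMap.injective_iff_surjective.mp (antipode_injective H)

/-- The integral `λ` is a Frobenius form: `S(h) = t₁ λ(h t₂)` recovers `h` from the
functional `λ(h ?)`. -/
theorem traceIntegral_nondegenerate {h : H} (hh : ∀ y, traceIntegral H (h * y) = 0) : h = 0 := by
  obtain ⟨t, ht, hl, hr⟩ := exists_integral (H := H)
  have h1 := mul_rightHit_of_integral hl (traceIntegral H) h
  have : traceIntegral H ∘ₗ LinearMap.mulLeft ℂ h = 0 := by ext y; simp [hh]
  rw [rightHit_traceIntegral, traceIntegral_integral hr, ht, one_smul, mul_one, this, map_zero,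
    LinearMap.zero_apply] at h1
  exact antipode_injective H (by rw [h1, map_zero])

theorem exists_traceIntegral_eq (ν : Module.Dual ℂ H) :
    ∃ k : H, ν = traceIntegral H ∘ₗ LinearMap.mulLeft ℂ k := by
  have hinj : Function.Injective
      (LinearMap.llcomp ℂ H H ℂ (traceIntegral H) ∘ₗ LinearMap.mul ℂ H) := by
    refine (injective_iff_map_eq_zero _).mpr fun h hh => traceIntegral_nondegenerate fun y => ?_
    exact LinearMap.congr_fun hh y
  have hsurj := (LinearMap.injective_iff_surjective_of_finrank_eq_finrank
    (Subspace.dual_finrank_eq (K := ℂ) (V := H)).symm).mp hinj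
  obtain ⟨k, hk⟩ := hsurj ν
  exact ⟨k, hk.symm⟩

/-- Integrals of the dual Hopf algebra are unique up to a scalar. -/
theorem eq_smul_traceIntegral {t : H} (ht : counit (R := ℂ) t = 1)
    (hl : ∀ h : H, h * t = counit (R := ℂ) h • t) (hr : ∀ h : H, t * h = counit (R := ℂ) h • t)
    {ν : Module.Dual ℂ H} (hν : ∀ x, rightHit ν x = ν x • (1 : H)) :
    ν = ν t • traceIntegral H := by
  obtain ⟨k, hk⟩ := exists_traceIntegral_eq ν
  have h1 := mul_rightHit_of_integral hl (traceIntegral H) k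
  rw [rightHit_traceIntegral, traceIntegral_integral hr, ht, one_smul, mul_one, ← hk, hν] at h1
  have h2 : k = ν t • (1 : H) := antipode_injective H (by rw [h1, map_smul, antipode_one])
  have h3 : ν = traceIntegral H ∘ₗ LinearMap.mulLeft ℂ (ν t • (1 : H)) := by
    rw [← h2]
    exact hk
  conv_lhs => rw [h3]
  ext y
  simp

/-- The modular element: there is a group-like `a` with `λ(x₁) x₂ = λ(x) a`. -/
theorem exists_modular : ∃ a : H, IsGroupLikeElem ℂ a ∧
    ∀ x, leftHit (traceIntegral H) x = traceIntegral H x • a := by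
  obtain ⟨t, ht, hl, hr⟩ := exists_integral (H := H)
  have key : ∀ x, leftHit (traceIntegral H) x =
      traceIntegral H x • leftHit (traceIntegral H) t := by
    intro x
    refine Module.forall_dual_apply_eq_zero_iff ℂ _ |>.mp (fun p => ?_) |> sub_eq_zero.mp
    have h1 := eq_smul_traceIntegral ht hl hr (ν := traceIntegral H ∘ₗ rightHit p) (fun x => by
      rw [← rightHit_comp, rightHit_traceIntegral]
      rfl)
    have h2 := LinearMap.congr_fun h1 x
    rw [LinearMap.smul_apply, LinearMap.comp_apply, LinearMap.comp_apply, apply_rightHit,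
      apply_rightHit] at h2
    rw [map_sub, h2]
    simp [mul_comm]
  refine ⟨leftHit (traceIntegral H) t, ⟨?_, ?_⟩, key⟩
  · rw [← apply_rightHit]
    have : rightHit (counit (R := ℂ)) t = t := by simp [rightHit]
    rw [this, traceIntegral_integral hr, ht]
  · rw [comul_leftHit, ← (ℛ ℂ t).eq]
    simp only [map_sum, LinearMap.rTensor_tmul, key ((ℛ ℂ t).left _), TensorProduct.smul_tmul,
      ← TensorProduct.tmul_sum]
    rw [← leftHit_eq _ (ℛ ℂ t)]

/-- Radford's formula for the fourth power of the antipode, when the Hopf algebra is semisimple. -/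
theorem antipode_pow_four {a : H} (ha : IsGroupLikeElem ℂ a)
    (hm : ∀ x, leftHit (traceIntegral H) x = traceIntegral H x • a) (y : H) :
    a * antipode ℂ (antipode ℂ (antipode ℂ (antipode ℂ y))) * antipode ℂ a = y := by
  obtain ⟨t, ht, hl, hr⟩ := exists_integral (H := H)
  have ha1 : a * antipode ℂ a = 1 := ha.mul_antipode_cancel
  have ha2 : antipode ℂ a * a = 1 := ha.antipode_mul_cancel
  -- `ρ = λ(? a)` satisfies `ρ(x₁) x₂ = ρ(x)`, so that `ρ ∘ S` is a multiple of `λ`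
  set ρ : Module.Dual ℂ H := traceIntegral H ∘ₗ LinearMap.mulRight ℂ a with hρ
  have h1 : ∀ x, leftHit ρ x = ρ x • (1 : H) := by
    intro x
    have h2 : leftHit ρ x * a = leftHit (traceIntegral H) (x * a) := by
      rw [leftHit_eq _ (ℛ ℂ x)]
      simp only [leftHit, LinearMap.coe_mk, AddHom.coe_mk, LinearMap.comp_apply]
      rw [Bialgebra.comul_mul, ha.comul_eq_tmul_self, ← (ℛ ℂ x).eq]
      simp [Finset.sum_mul, hρ]
    rw [hm] at h2
    have h3 := congrArg (· * antipode ℂ a) h2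
    simpa [mul_assoc, ha1, hρ] using h3
  have h2 : ∀ x, rightHit (ρ ∘ₗ antipode ℂ) x = (ρ ∘ₗ antipode ℂ) x • (1 : H) := by
    intro x
    refine antipode_injective H ?_
    rw [map_smul, antipode_one, LinearMap.comp_apply, ← h1, rightHit_eq _ (ℛ ℂ x)]
    simp only [leftHit, LinearMap.coe_mk, AddHom.coe_mk, LinearMap.comp_apply]
    rw [← sum_antipode_tmul_antipode]
    simp
  have h3 := eq_smul_traceIntegral ht hl hr h2
  set c := (ρ ∘ₗ antipode ℂ) t
  have h4 : ∀ x, traceIntegral H (antipode ℂ x * a) = c * traceIntegral H x := fun x =>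
    LinearMap.congr_fun h3 x
  have hc : c ≠ 0 := by
    intro hc
    obtain ⟨x, hx⟩ := antipode_surjective H (t * antipode ℂ a)
    have := h4 x
    rw [hc, zero_mul, hx, mul_assoc, ha2, mul_one, traceIntegral_integral hr, ht] at this
    exact one_ne_zero this
  have hS : antipode ℂ (antipode ℂ a) = a := by
    have := congrArg (antipode ℂ) ha1
    rw [antipode_mul_antidistrib, antipode_one] at this
    calc antipode ℂ (antipode ℂ a) = antipode ℂ (antipode ℂ a) * (antipode ℂ a * a) := by
          rw [ha2, mul_one]
      _ = a := by rw [← mul_assoc, this, one_mul]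
  refine (sub_eq_zero.mp (traceIntegral_nondegenerate fun x => ?_)).symm
  rw [sub_mul, map_sub, sub_eq_zero, traceIntegral_mul_comm y x, traceIntegral_mul_comm _ x]
  -- it remains to compare `λ(x S²(y))` with `λ(x S²(a S⁴(y) a⁻¹))`
  have h5 : ∀ x y, traceIntegral H (x * y) = traceIntegral H (x *
      (a * antipode ℂ (antipode ℂ (antipode ℂ (antipode ℂ y))) * antipode ℂ a)) := by
    intro x y
    refine mul_left_cancel₀ hc ?_
    calc c * traceIntegral H (x * y)
        = traceIntegral H (antipode ℂ y * (antipode ℂ x * a)) := by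
          rw [← h4, antipode_mul_antidistrib, mul_assoc]
      _ = traceIntegral H (antipode ℂ x * a * antipode ℂ (antipode ℂ (antipode ℂ y))) := by
          rw [traceIntegral_mul_comm]
      _ = traceIntegral H (antipode ℂ (a * antipode ℂ (antipode ℂ y) * antipode ℂ a * x) * a) := by
          congr 1
          simp only [antipode_mul_antidistrib, hS, mul_assoc, ha2, mul_one]
      _ = c * traceIntegral H (a * antipode ℂ (antipode ℂ y) * antipode ℂ a * x) := h4 _
      _ = _ := by
          rw [traceIntegral_mul_comm]
          simp only [antipode_mul_antidistrib, hS, mul_assoc]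
  rw [h5 x (antipode ℂ (antipode ℂ y))]
  simp only [antipode_mul_antidistrib, hS, mul_assoc]

end Integrals

/-! ### Matrices of finite order and the trace of the squared antipode -/

section Matrices

open Matrix
open scoped ComplexOrder

/-- A matrix of finite order preserves a positive definite form, so that the trace of its inverse
is the complex conjugate of its trace. -/
theorem trace_eq_star_trace_of_pow_eq_one {d : Type*} [Fintype d] [DecidableEq d]
    {g h : Matrix d d ℂ} {m : ℕ} (hg : g ^ (m + 1) = 1) (hgh : g * h = 1) :
    h.trace = star g.trace := by
  set b : Matrix d d ℂ := ∑ k ∈ Finset.range (m + 1), (g ^ k)ᴴ * g ^ k with hb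
  have hb1 : gᴴ * b * g = b := by
    have h1 : ∑ k ∈ Finset.range (m + 1), (g ^ (k + 1))ᴴ * g ^ (k + 1) = b := by
      have h2 := Finset.sum_range_succ' (fun k => (g ^ k)ᴴ * g ^ k) (m + 1)
      rw [Finset.sum_range_succ] at h2
      simp only [hg, pow_zero] at h2
      exact (add_right_cancel h2).symm
    conv_rhs => rw [← h1]
    rw [hb, Finset.mul_sum, Finset.sum_mul]
    refine Finset.sum_congr rfl fun k _ => ?_
    rw [pow_succ, conjTranspose_mul]
    simp only [Matrix.mul_assoc]
  have hpos : b.PosDef := by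
    rw [hb, Finset.sum_range_succ']
    refine PosDef.posSemidef_add ?_ ?_
    · exact posSemidef_sum _ fun k _ => posSemidef_conjTranspose_mul_self _
    · simpa using PosDef.one
  have hu : IsUnit b.det := (isUnit_iff_isUnit_det _).mp hpos.isUnit
  have h3 : gᴴ * b = b * h := by
    conv_rhs => rw [← hb1, Matrix.mul_assoc _ g h, hgh, Matrix.mul_one]
  have h4 : gᴴ = b * h * b⁻¹ := by
    rw [← h3, Matrix.mul_assoc, mul_nonsing_inv _ hu, Matrix.mul_one]
  rw [← trace_conjTranspose, h4, trace_mul_comm, ← Matrix.mul_assoc, nonsing_inv_mul _ hu,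
    Matrix.one_mul]

/-- If a power of an invertible matrix is scalar, the trace of its inverse is a positive multiple of
the complex conjugate of its trace. -/
theorem exists_trace_inverse_eq {d : Type*} [Fintype d] [DecidableEq d] [Nonempty d]
    {g h : Matrix d d ℂ} {m : ℕ} (hg : ∀ x, Commute (g ^ (m + 1)) x) (hgh : g * h = 1) :
    ∃ κ : ℝ, 0 < κ ∧ h.trace = (κ : ℂ) * star g.trace := by
  obtain ⟨c, hc⟩ : ∃ c : ℂ, g ^ (m + 1) = scalar d c := by
    obtain ⟨c, hc⟩ := mem_range_scalar_of_commute_single (M := g ^ (m + 1))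
      fun i j _ => (hg _).symm
    exact ⟨c, hc.symm⟩
  obtain ⟨s, hs⟩ := IsAlgClosed.exists_pow_nat_eq c (Nat.succ_pos m)
  have hhg : h * g = 1 := mul_eq_one_comm.mp hgh
  have hs0 : s ≠ 0 := by
    rintro rfl
    rw [zero_pow (Nat.succ_ne_zero m)] at hs
    rw [← hs, map_zero] at hc
    have : (1 : Matrix d d ℂ) = 0 := by
      calc (1 : Matrix d d ℂ) = (g * h) ^ (m + 1) := by rw [hgh, one_pow]
        _ = g ^ (m + 1) * h ^ (m + 1) :=
          (show Commute g h from hgh.trans hhg.symm).mul_pow _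
        _ = 0 := by rw [hc, Matrix.zero_mul]
    exact one_ne_zero this
  have h1 : (s⁻¹ • g) ^ (m + 1) = 1 := by
    rw [smul_pow, hc, ← hs]
    ext i j
    rcases eq_or_ne i j with rfl | hij
    · simp [hs0]
    · simp [hij]
  have h2 := trace_eq_star_trace_of_pow_eq_one (h := s • h) h1 (by
    rw [smul_mul_smul_comm, inv_mul_cancel₀ hs0, hgh, one_smul])
  refine ⟨(Complex.normSq s)⁻¹, inv_pos.mpr (Complex.normSq_pos.mpr hs0), ?_⟩
  rw [trace_smul, trace_smul, smul_eq_mul, smul_eq_mul, star_mul'] at h2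
  have h3 : (Complex.normSq s : ℂ) = s * star s := (Complex.mul_conj s).symm
  rw [Complex.ofReal_inv, h3]
  have hs1 : star s ≠ 0 := star_ne_zero.mpr hs0
  rw [star_inv₀] at h2
  field_simp at h2 ⊢
  linear_combination h2

/-- The operator `x ↦ a x b` on a product of matrix algebras has trace `∑ᵢ tr(aᵢ) tr(bᵢ)`. -/
theorem trace_mulLeft_mulRight_pi {n : ℕ} {d : Fin n → ℕ}
    (a b : Π i, Matrix (Fin (d i)) (Fin (d i)) ℂ) :
    LinearMap.trace ℂ (Π i, Matrix (Fin (d i)) (Fin (d i)) ℂ)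
      (LinearMap.mulLeft ℂ a ∘ₗ LinearMap.mulRight ℂ b) =
      ∑ i, (a i).trace * (b i).trace := by
  rw [LinearMap.trace_eq_matrix_trace ℂ
    (Pi.basis fun i => Matrix.stdBasis ℂ (Fin (d i)) (Fin (d i)))]
  simp only [Matrix.trace, Matrix.diag, LinearMap.toMatrix_apply, Fintype.sum_sigma]
  refine Finset.sum_congr rfl fun i _ => ?_
  rw [Finset.sum_mul_sum, Fintype.sum_prod_type]
  refine Finset.sum_congr rfl fun j _ => Finset.sum_congr rfl fun k _ => ?_
  simp [Pi.basis_apply, Pi.basis_repr, Matrix.stdBasis_eq_single]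
  change (a i * ((single j k 1 : Matrix (Fin (d i)) (Fin (d i)) ℂ) * b i) :
    Matrix (Fin (d i)) (Fin (d i)) ℂ) j k = _
  simp [Matrix.mul_apply, Matrix.single_apply, ite_and]

end Matrices

section LarsonRadford

variable {H : Type*} [Ring H] [HopfAlgebra ℂ H] [FiniteDimensional ℂ H] [IsSemisimpleRing H]

open HopfAlgebra

/-- Every functional on a product of matrix algebras is given by the trace. -/
theorem exists_eq_sum_trace_mul {n : ℕ} {d : Fin n → ℕ}
    (f : Module.Dual ℂ (Π i, Matrix (Fin (d i)) (Fin (d i)) ℂ)) :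
    ∃ w : Π i, Matrix (Fin (d i)) (Fin (d i)) ℂ, ∀ x, f x = ∑ i, (w i * x i).trace := by
  refine ⟨fun i => Matrix.of fun j k => f (Pi.single i (Matrix.single k j 1)), fun x => ?_⟩
  have hx : ∀ i, Pi.single i (x i) =
      ∑ j, ∑ k, x i j k • (Pi.single i (Matrix.single j k (1 : ℂ)) :
        Π i, Matrix (Fin (d i)) (Fin (d i)) ℂ) := by
    intro i
    have h := congrArg (LinearMap.single ℂ (fun i => Matrix (Fin (d i)) (Fin (d i)) ℂ) i)
      (Matrix.matrix_eq_sum_single (x i))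
    simp only [map_sum, LinearMap.single_apply] at h
    rw [h]
    refine Finset.sum_congr rfl fun j _ => Finset.sum_congr rfl fun k _ => ?_
    rw [← Pi.single_smul, Matrix.smul_single, smul_eq_mul, mul_one]
  conv_lhs => rw [← Finset.univ_sum_single x]
  simp only [hx]
  simp only [map_sum, map_smul, smul_eq_mul, Matrix.trace, Matrix.diag, Matrix.mul_apply,
    Matrix.of_apply]
  refine Finset.sum_congr rfl fun i _ => ?_
  rw [Finset.sum_comm]
  exact Finset.sum_congr rfl fun j _ => Finset.sum_congr rfl fun k _ => mul_comm _ _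

theorem sum_trace_mul_nondegenerate {n : ℕ} {d : Fin n → ℕ}
    {w : Π i, Matrix (Fin (d i)) (Fin (d i)) ℂ} 
    (h : ∀ x : Π i, Matrix (Fin (d i)) (Fin (d i)) ℂ, ∑ i, (w i * x i).trace = 0) : w = 0 := by
  ext i j k
  have h1 := h (Pi.single i (Matrix.single k j 1))
  rw [Finset.sum_eq_single i] at h1
  · simpa [Matrix.trace, Matrix.mul_apply, Matrix.single_apply, ite_and] using h1
  · intro l _ hl
    simp [hl]
  · simp

/-- The trace of the squared antipode of a semisimple Hopf algebra does not vanish. Writing the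
integral as `λ(h) = ∑ᵢ tr(wᵢ hᵢ)` in terms of the matrix blocks, `S²` is conjugation by `w` and some
power of `w` is central, so that `λ(1) = ∑ᵢ tr(wᵢ) tr(wᵢ⁻¹)` is a sum of non-negative numbers. -/
theorem traceIntegral_one_ne_zero : traceIntegral H 1 ≠ 0 := by
  obtain ⟨n, d, hd, ⟨e⟩⟩ := IsSemisimpleRing.exists_algEquiv_pi_matrix_of_isAlgClosed ℂ H
  obtain ⟨w', hw'⟩ := exists_eq_sum_trace_mul (traceIntegral H ∘ₗ e.symm.toLinearMap)
  obtain ⟨w, rfl⟩ := e.surjective w'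
  replace hw' : ∀ x : H, traceIntegral H x = ∑ i, (e (w * x) i).trace := by
    intro x
    simpa using hw' (e x)
  have hw : ∀ x, w * x = antipode ℂ (antipode ℂ x) * w := by
    intro x
    refine sub_eq_zero.mp (e.injective ?_)
    rw [map_zero]
    refine sum_trace_mul_nondegenerate fun y => ?_
    obtain ⟨y, rfl⟩ := e.surjective y
    have h1 := traceIntegral_mul_comm x y
    rw [hw', hw'] at h1
    simp only [map_sub, map_mul, Pi.sub_apply, Pi.mul_apply, sub_mul, Matrix.trace_sub,
      Finset.sum_sub_distrib] at h1 ⊢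
    rw [sub_eq_zero]
    simp only [Matrix.mul_assoc]
    rw [h1]
    refine Finset.sum_congr rfl fun i _ => ?_
    rw [← Matrix.mul_assoc, Matrix.trace_mul_comm]
  obtain ⟨u, hu⟩ : ∃ u, w * u = 1 := by
    have hinj : Function.Injective (LinearMap.mulLeft ℂ w) := by
      refine (injective_iff_map_eq_zero _).mpr fun z hz => traceIntegral_nondegenerate fun y => ?_
      have hz' : w * z = 0 := hz
      rw [hw', ← mul_assoc, hz', zero_mul, map_zero]
      simp
    exact LinearMap.injective_iff_surjective.mp hinj 1
  have hu' : u * w = 1 := by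
    have : IsDedekindFiniteMonoid H := inferInstance
    exact mul_eq_one_symm hu
  obtain ⟨a, ha, hm⟩ := exists_modular (H := H)
  obtain ⟨m, hm0, ham⟩ := IsGroupLikeElem.exists_pow_eq_one ha
  have ha2 : antipode ℂ a * a = 1 := ha.antipode_mul_cancel
  -- some power of `w` is central
  have hcomm : ∀ x, Commute (w ^ (2 * m)) x := by
    have h2 : ∀ x, a * w ^ 2 * x = x * (a * w ^ 2) := by
      intro x
      have h3 : a * antipode ℂ (antipode ℂ (antipode ℂ (antipode ℂ x))) = x * a := by
        conv_rhs => rw [← antipode_pow_four ha hm x, mul_assoc, ha2, mul_one]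
      rw [pow_two, mul_assoc, mul_assoc, hw x, ← mul_assoc w, hw, mul_assoc, ← mul_assoc a, h3,
        mul_assoc]
    have h3 : Commute a (w ^ 2) := by
      have := congrArg (antipode ℂ a * ·) (h2 a)
      simp only [← mul_assoc, ha2, one_mul] at this
      exact this.symm
    intro x
    have h4 : Commute ((a * w ^ 2) ^ m) x := Commute.pow_left (h2 x) m
    rwa [h3.mul_pow, ham, one_mul, ← pow_mul] at h4
  have hκ : ∀ i, ∃ κ : ℝ, 0 < κ ∧ (e u i).trace = (κ : ℂ) * star (e w i).trace := by
    intro i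
    have := hd i
    obtain ⟨m', hm'⟩ : ∃ m', 2 * m = m' + 1 := ⟨2 * m - 1, by omega⟩
    refine exists_trace_inverse_eq (m := m') (fun x => ?_) ?_
    · obtain ⟨y, hy⟩ := e.surjective (Pi.single i x)
      have h1 := congrArg (fun z => e z i) (hcomm y).eq
      simp only [map_mul, map_pow, hy, Pi.mul_apply, Pi.pow_apply, Pi.single_eq_same, hm'] at h1
      exact h1
    · have := congrArg (fun z => e z i) hu
      simpa using this
  choose κ hκ0 hκ1 using hκ
  have htr : ∀ h, traceIntegral H h = ∑ i, (e (h * w) i).trace * (e u i).trace := by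
    intro h
    rw [← trace_mulLeft_mulRight_pi (e (h * w)) (e u), traceIntegral_apply,
      ← LinearMap.trace_conj' _ e.toLinearEquiv]
    congr 1
    refine LinearMap.ext fun x => ?_
    obtain ⟨x, rfl⟩ := e.surjective x
    have : antipode ℂ (antipode ℂ x) = w * x * u := by
      rw [hw, mul_assoc, hu, mul_one]
    simp [LinearEquiv.conj_apply, this, mul_assoc]
  intro h0
  rw [htr, one_mul] at h0
  have h1 : ∑ i, κ i * Complex.normSq (e w i).trace = 0 := by
    rw [← Complex.ofReal_inj, Complex.ofReal_zero, ← h0]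
    push_cast
    refine Finset.sum_congr rfl fun i _ => ?_
    rw [hκ1, Complex.normSq_eq_conj_mul_self]
    simp only [starRingEnd_apply]
    ring
  have h2 := (Finset.sum_eq_zero_iff_of_nonneg fun i _ =>
    mul_nonneg (hκ0 i).le (Complex.normSq_nonneg _)).mp h1
  have h3 : ∀ i, (e u i).trace = 0 := by
    intro i
    have := (mul_eq_zero.mp (h2 i (Finset.mem_univ i))).resolve_left (hκ0 i).ne'
    rw [hκ1, Complex.normSq_eq_zero.mp this, star_zero, mul_zero]
  obtain ⟨t, ht, hl, hr⟩ := exists_integral (H := H)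
  have h4 := htr t
  rw [traceIntegral_integral hr, ht] at h4
  simp [h3] at h4

end LarsonRadford

/-! ### The theorem of Larson and Radford -/

section LarsonRadford

variable {H : Type*} [Ring H] [HopfAlgebra ℂ H]

open HopfAlgebra

theorem rightHit_comp_antipode_antipode (p : Module.Dual ℂ H) (x : H) :
    antipode ℂ (antipode ℂ (rightHit (p ∘ₗ antipode ℂ ∘ₗ antipode ℂ) x)) =
      rightHit p (antipode ℂ (antipode ℂ x)) := by
  rw [rightHit_eq _ (ℛ ℂ x)]
  simp only [rightHit, LinearMap.coe_mk, AddHom.coe_mk, LinearMap.comp_apply]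
  rw [comul_antipode_antipode, ← (ℛ ℂ x).eq]
  simp

variable [FiniteDimensional ℂ H]

/-- The bijection `y ⊗ z ↦ y₁ ⊗ y₂ z`, which intertwines the diagonal coaction on `H ⊗ H` with the
coaction on the second factor. -/
theorem bijective_comul_mul :
    ∃ e : H ⊗[ℂ] H ≃ₗ[ℂ] H ⊗[ℂ] H, ∀ y z, e (y ⊗ₜ z) = comul (R := ℂ) y * (1 ⊗ₜ z) := by
  set f : H ⊗[ℂ] H →ₗ[ℂ] H ⊗[ℂ] H := TensorProduct.lift ((LinearMap.mul ℂ (H ⊗[ℂ] H)).compl₁₂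
    comul (Algebra.TensorProduct.includeRight (R := ℂ)).toLinearMap) with hf
  have hfa : ∀ y z, f (y ⊗ₜ z) = comul (R := ℂ) y * (1 ⊗ₜ z) := fun y z => rfl
  have hsurj : Function.Surjective f := by
    rw [← LinearMap.range_eq_top, eq_top_iff, ← TensorProduct.span_tmul_eq_top, Submodule.span_le]
    rintro _ ⟨y, z, rfl⟩
    have h1 : toConv comul * convRight H (toConv (antipode ℂ)) =
        convLeft H (toConv (LinearMap.id : H →ₗ[ℂ] H)) := by
      rw [toConv_comul_eq, mul_assoc, ← convRight_mul, LinearMap.id_mul_antipode, convRight_one,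
        mul_one]
    have h2 := congrArg (fun k => k.ofConv y) h1
    change (toConv comul * convRight H (toConv (antipode ℂ)) : WithConv (H →ₗ[ℂ] H ⊗[ℂ] H)) y =
      y ⊗ₜ 1 at h2
    rw [(ℛ ℂ y).convMul_apply] at h2
    refine ⟨∑ i ∈ (ℛ ℂ y).index, (ℛ ℂ y).left i ⊗ₜ (antipode ℂ ((ℛ ℂ y).right i) * z), ?_⟩
    have h3 := congrArg (· * ((1 : H) ⊗ₜ[ℂ] z)) h2
    simp only [Finset.sum_mul, Algebra.TensorProduct.tmul_mul_tmul, mul_one, one_mul] at h3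
    rw [map_sum, ← h3]
    refine Finset.sum_congr rfl fun i _ => ?_
    rw [hfa, mul_assoc]
    change _ = _ * ((1 ⊗ₜ _) * _)
    rw [Algebra.TensorProduct.tmul_mul_tmul, one_mul]
  exact ⟨LinearEquiv.ofBijective f ⟨LinearMap.injective_iff_surjective.mpr hsurj, hsurj⟩, hfa⟩

/-- The character of the coregular representation as an element of `H`. -/
theorem exists_regular_character :
    ∃ x : H, (∀ p : Module.Dual ℂ H, p x = LinearMap.trace ℂ H (rightHit p)) := by
  obtain ⟨x, hx⟩ := (Module.evalEquiv ℂ H).surjective (LinearMap.trace ℂ H ∘ₗ rightHit)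
  exact ⟨x, fun p => LinearMap.congr_fun hx p⟩

/-- Tensoring with the regular representation gives a sum of `dim H` copies of it, by
`bijective_comul_mul`; hence its character satisfies `x² = (dim H) x`. -/
theorem mul_self_of_regular_character {x : H}
    (hx : ∀ p : Module.Dual ℂ H, p x = LinearMap.trace ℂ H (rightHit p)) :
    x * x = (Module.finrank ℂ H : ℂ) • x := by
  refine Module.forall_dual_apply_eq_zero_iff ℂ _ |>.mp (fun p => ?_) |> sub_eq_zero.mp
  rw [map_sub, sub_eq_zero, map_smul, smul_eq_mul, hx]
  obtain ⟨n, f, g, hfg⟩ := exists_dual_mul p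
  obtain ⟨e, he⟩ := bijective_comul_mul (H := H)
  rw [hfg]
  simp only [hx, ← LinearMap.trace_tensorProduct']
  rw [← map_sum, ← LinearMap.trace_conj' _ e]
  have key : e.conj (∑ k, TensorProduct.map (rightHit (f k)) (rightHit (g k))) =
      TensorProduct.map LinearMap.id (rightHit p) := by
    rw [LinearEquiv.conj_apply, LinearEquiv.comp_toLinearMap_symm_eq]
    refine TensorProduct.ext' fun y z => ?_
    have h1 : ∀ y z, (∑ k, TensorProduct.map (rightHit (f k)) (rightHit (g k))) (y ⊗ₜ[ℂ] z) =
        ∑ j ∈ (ℛ ℂ z).index, ∑ i ∈ (ℛ ℂ y).index,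
          p ((ℛ ℂ y).right i * (ℛ ℂ z).right j) • ((ℛ ℂ y).left i ⊗ₜ[ℂ] (ℛ ℂ z).left j) := by
      intro y z
      simp only [LinearMap.sum_apply, TensorProduct.map_tmul, rightHit_eq _ (ℛ ℂ y),
        rightHit_eq _ (ℛ ℂ z), TensorProduct.sum_tmul, TensorProduct.tmul_sum,
        TensorProduct.smul_tmul_smul, hfg, Finset.sum_smul]
      rw [Finset.sum_comm]
      conv_lhs => enter [2, i]; rw [Finset.sum_comm]
    rw [LinearMap.comp_apply, LinearMap.comp_apply, h1, LinearEquiv.coe_coe, he]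
    simp only [map_sum, map_smul, he]
    have h2 : comul (R := ℂ) y * (1 ⊗ₜ z) =
        ∑ i ∈ (ℛ ℂ y).index, (ℛ ℂ y).left i ⊗ₜ[ℂ] ((ℛ ℂ y).right i * z) := by
      conv_lhs => rw [← (ℛ ℂ y).eq]
      simp [Finset.sum_mul]
    have h3 : ∀ b : H, rightHit p (b * z) = ∑ j ∈ (ℛ ℂ z).index, ∑ i ∈ (ℛ ℂ b).index,
          p ((ℛ ℂ b).right i * (ℛ ℂ z).right j) • ((ℛ ℂ b).left i * (ℛ ℂ z).left j) := by
      intro b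
      simp only [rightHit, LinearMap.coe_mk, AddHom.coe_mk, LinearMap.comp_apply]
      rw [Bialgebra.comul_mul, ← (ℛ ℂ b).eq, ← (ℛ ℂ z).eq]
      simp [Finset.sum_mul, Finset.mul_sum]
    rw [h2, map_sum]
    simp only [TensorProduct.map_tmul, LinearMap.id_apply, h3, TensorProduct.tmul_sum]
    rw [Finset.sum_comm (s := (ℛ ℂ y).index)]
    refine Finset.sum_congr rfl fun j _ => ?_
    have key := sum_comul_assoc (LinearMap.mk₂ ℂ
      (fun a b => ((p ∘ₗ LinearMap.mulRight ℂ ((ℛ ℂ z).right j)).smulRight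
        (a ⊗ₜ[ℂ] (b * (ℛ ℂ z).left j)) : H →ₗ[ℂ] H ⊗[ℂ] H))
      (by intros; ext; simp [TensorProduct.add_tmul])
      (by intros; ext; simp only [LinearMap.smulRight_apply, LinearMap.smul_apply,
            ← TensorProduct.smul_tmul']; rw [smul_comm])
      (by intros; ext; simp [add_mul, TensorProduct.tmul_add])
      (by intros; ext; simp only [LinearMap.smulRight_apply, LinearMap.smul_apply, smul_mul_assoc,
            TensorProduct.tmul_smul]; rw [smul_comm])) y
    simp only [LinearMap.mk₂_apply, LinearMap.smulRight_apply, LinearMap.comp_apply,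
      LinearMap.mulRight_apply] at key
    simp only [TensorProduct.tmul_smul]
    rw [← key]
    refine Finset.sum_congr rfl fun i _ => ?_
    rw [← (ℛ ℂ ((ℛ ℂ y).left i)).eq]
    simp [Finset.sum_mul, Finset.smul_sum]
  rw [key, LinearMap.trace_tensorProduct', LinearMap.trace_id]

theorem trace_isIdempotentElem {V : Type*} [AddCommGroup V] [Module ℂ V] [FiniteDimensional ℂ V]
    {f : Module.End ℂ V} (hf : IsIdempotentElem f) :
    LinearMap.trace ℂ V f = (Module.finrank ℂ (LinearMap.range f) : ℂ) :=
  (LinearMap.IsIdempotentElem.isProj_range f hf).trace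

variable (H) in
/-- The theorem of Larson and Radford: the antipode of a finite-dimensional semisimple complex Hopf
algebra is an involution. The character `x` of the coregular representation satisfies `x² = n x`
with `n = dim H`, and `n Tr(S² ∘ x/n) = Tr(S²)`. As `S⁴ = 1`, both traces are integers, and
`0 ≠ |Tr(S²)| ≤ n`; hence `|Tr(S²)| = n`. -/
theorem antipode_antipode [IsSemisimpleRing H] (y : H) : antipode ℂ (antipode ℂ y) = y := by
  obtain ⟨a, ha, hm⟩ := exists_modular (H := H)
  have h1 : traceIntegral H 1 ≠ 0 := traceIntegral_one_ne_zero
  have ha1 : a = 1 := by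
    have := hm 1
    have h2 : leftHit (traceIntegral H) 1 = traceIntegral H 1 • (1 : H) := by
      simp [leftHit, Algebra.TensorProduct.one_def]
    rw [h2] at this
    exact (smul_right_injective H h1 this).symm
  subst ha1
  set T : Module.End ℂ H := antipode ℂ ∘ₗ antipode ℂ with hT
  have hTT : T * T = 1 := by
    ext y
    have := antipode_pow_four ha hm y
    rwa [antipode_one, one_mul, mul_one] at this
  obtain ⟨x, hx⟩ := exists_regular_character (H := H)
  have hxx := mul_self_of_regular_character hx
  -- `S²` preserves the character of the coregular representation, and therefore commutes with the
  -- projection `e` that is the left multiplication by `x / n`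
  have hTx : T x = x := by
    refine Module.forall_dual_apply_eq_zero_iff ℂ _ |>.mp (fun p => ?_) |> sub_eq_zero.mp
    rw [map_sub, sub_eq_zero]
    change (p ∘ₗ T) x = p x
    rw [hx, hx]
    have h2 : T * rightHit (p ∘ₗ T) = rightHit p * T :=
      LinearMap.ext fun z => rightHit_comp_antipode_antipode p z
    calc LinearMap.trace ℂ H (rightHit (p ∘ₗ T))
        = LinearMap.trace ℂ H (T * (T * rightHit (p ∘ₗ T))) := by rw [← mul_assoc, hTT, one_mul]
      _ = _ := by rw [h2, LinearMap.trace_mul_comm, mul_assoc, hTT, mul_one]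
  set n : ℂ := (Module.finrank ℂ H : ℂ) with hn
  have hn0 : n ≠ 0 := by
    have : Nontrivial H := ⟨0, 1, fun h => h1 (by rw [← h, map_zero])⟩
    exact Nat.cast_ne_zero.mpr Module.finrank_pos.ne'
  set e : Module.End ℂ H := n⁻¹ • LinearMap.mulLeft ℂ x with he
  have hee : e * e = e := by
    ext z
    simp [he, ← mul_assoc, hxx, smul_smul, hn0]
  have heT : e * T = T * e := by
    ext z
    simp only [he, hT, Module.End.mul_apply, LinearMap.smul_apply, LinearMap.mulLeft_apply,
      LinearMap.comp_apply, map_smul, antipode_mul_antidistrib]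
    congr 2
    exact hTx.symm
  have h4 : traceIntegral H 1 = LinearMap.trace ℂ H T := by
    rw [traceIntegral_apply, LinearMap.mulLeft_one]
    rfl
  have htr : n * LinearMap.trace ℂ H (e * T) = LinearMap.trace ℂ H T := by
    have h2 : n • (e * T) = LinearMap.mulLeft ℂ x ∘ₗ T := by
      rw [he, smul_mul_assoc, smul_smul, mul_inv_cancel₀ hn0, one_smul]
      rfl
    have h3 : rightHit (traceIntegral H) = (traceIntegral H).smulRight (1 : H) :=
      LinearMap.ext fun z => rightHit_traceIntegral z
    rw [← smul_eq_mul, ← map_smul, h2, ← traceIntegral_apply, hx, h3, LinearMap.trace_smulRight, h4]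
  -- `T = q - q'` and `e * T` are differences of idempotents, whose traces are integers
  set q : Module.End ℂ H := (2 : ℂ)⁻¹ • (1 + T) with hq
  set q' : Module.End ℂ H := (2 : ℂ)⁻¹ • (1 - T) with hq'
  have hqq : IsIdempotentElem q := by
    rw [IsIdempotentElem, hq, smul_mul_smul_comm, add_mul, mul_add, mul_add, hTT]
    simp only [one_mul, mul_one]
    module
  have hqq' : IsIdempotentElem q' := by
    rw [IsIdempotentElem, hq', smul_mul_smul_comm, sub_mul, mul_sub, mul_sub, hTT]
    simp only [one_mul, mul_one]
    module
  have hsum : q + q' = 1 := by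
    rw [hq, hq']
    module
  have hdiff : q - q' = T := by
    rw [hq, hq']
    module
  have heq : IsIdempotentElem (e * q) := by
    refine IsIdempotentElem.mul_of_commute ?_ hee hqq
    exact ((Commute.one_right e).add_right heT).smul_right _
  have heq' : IsIdempotentElem (e * q') := by
    refine IsIdempotentElem.mul_of_commute ?_ hee hqq'
    exact ((Commute.one_right e).sub_right heT).smul_right _
  have t1 := trace_isIdempotentElem hqq
  have t2 := trace_isIdempotentElem hqq'
  have t3 := trace_isIdempotentElem heq
  have t4 := trace_isIdempotentElem heq'
  have t5 := congrArg (LinearMap.trace ℂ H) hsum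
  rw [map_add, t1, t2, LinearMap.trace_one] at t5
  have t6 : LinearMap.trace ℂ H T ≠ 0 := h4 ▸ h1
  rw [← hdiff, mul_sub, map_sub, map_sub, t1, t2, t3, t4] at htr
  rw [← hdiff, map_sub, t1, t2] at t6
  set r := Module.finrank ℂ (LinearMap.range q) with hr
  set s := Module.finrank ℂ (LinearMap.range q') with hs
  set c := Module.finrank ℂ (LinearMap.range (e * q))
  set d := Module.finrank ℂ (LinearMap.range (e * q'))
  rw [hn, ← t5] at htr
  have i1 : ((r : ℤ) + s) * (c - d) = r - s := by exact_mod_cast htr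
  have i2 : (r : ℤ) - s ≠ 0 := by exact_mod_cast t6
  have hzero : ∀ f : Module.End ℂ H, Module.finrank ℂ (LinearMap.range f) = 0 → f = 0 :=
    fun f hf => LinearMap.range_eq_bot.mp (Submodule.finrank_eq_zero.mp hf)
  rcases Nat.eq_zero_or_pos r with h0 | hr0
  · have hq0 := hzero q h0
    have h5 : q 1 = 1 := by
      simp only [hq, LinearMap.smul_apply, LinearMap.add_apply, Module.End.one_apply, hT,
        LinearMap.comp_apply, antipode_one]
      module
    rw [hq0, LinearMap.zero_apply] at h5
    exact absurd h5.symm (fun h => h1 (by rw [h, map_zero]))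
  rcases Nat.eq_zero_or_pos s with h0 | hs0
  · have hq0 := hzero q' h0
    rw [hq0, add_zero] at hsum
    rw [hq0, sub_zero, hsum] at hdiff
    exact (LinearMap.congr_fun hdiff y).symm
  · -- a non-zero multiple of `r + s` is not smaller than `r + s`
    exfalso
    have i3 : (c : ℤ) - d ≠ 0 := by
      intro h
      rw [h, mul_zero] at i1
      exact i2 i1.symm
    rcases lt_or_gt_of_ne i3 with h | h
    · have : ((r : ℤ) + s) * (c - d) ≤ ((r : ℤ) + s) * (-1) :=
        mul_le_mul_of_nonneg_left (by omega) (by omega)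
      omega
    · have : ((r : ℤ) + s) * 1 ≤ ((r : ℤ) + s) * (c - d) :=
        mul_le_mul_of_nonneg_left (by omega) (by omega)
      omega

end LarsonRadford

/-! ### Representations, readings and intertwining relations -/

section Abstract

variable {A H C B : Type*} [Ring A] [HopfAlgebra ℂ A] [Ring H] [HopfAlgebra ℂ H]
  [AddCommGroup C] [Module ℂ C] [Coalgebra ℂ C] [Ring B] [Algebra ℂ B]

/-- The linear map `Y` is unital and multiplicative. -/
def IsRep {R : Type*} [Ring R] [Algebra ℂ R] (Y : R →ₗ[ℂ] B) : Prop :=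
  Y 1 = 1 ∧ ∀ x y, Y (x * y) = Y x * Y y

/-- The convolution product of two representations with commuting images is a representation. -/
theorem IsRep.convMul {Y Z : H →ₗ[ℂ] B} (hY : IsRep Y) (hZ : IsRep Z)
    (h : ∀ x y, Commute (Y x) (Z y)) : IsRep (toConv Y * toConv Z).ofConv := by
  refine ⟨?_, fun x y => ?_⟩
  · change (toConv Y * toConv Z) 1 = 1
    rw [LinearMap.convMul_apply, Bialgebra.comul_one, Algebra.TensorProduct.one_def]
    simp [hY.1, hZ.1]
  · change (toConv Y * toConv Z) (x * y) = (toConv Y * toConv Z) x * (toConv Y * toConv Z) y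
    rw [(ℛ ℂ x).convMul_apply, (ℛ ℂ y).convMul_apply, LinearMap.convMul_apply,
      Bialgebra.comul_mul, ← (ℛ ℂ x).eq, ← (ℛ ℂ y).eq, Finset.sum_mul_sum, Finset.sum_mul_sum]
    simp only [map_sum, Algebra.TensorProduct.tmul_mul_tmul, TensorProduct.map_tmul,
      LinearMap.mul'_apply, hY.2, hZ.2]
    refine Finset.sum_congr rfl fun i _ => Finset.sum_congr rfl fun j _ => ?_
    rw [mul_assoc, ← mul_assoc (Y _) (Z _), (h _ _).eq]
    simp only [mul_assoc]

theorem convMul_commute {Y Z : C →ₗ[ℂ] B} {b : B} (hY : ∀ c, Commute b (Y c))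
    (hZ : ∀ c, Commute b (Z c)) (c : C) : Commute b ((toConv Y * toConv Z) c) := by
  rw [(ℛ ℂ c).convMul_apply]
  exact Commute.sum_right _ _ _ fun i _ => (hY _).mul_right (hZ _)

theorem conv_list_prod_commute {l : List (WithConv (C →ₗ[ℂ] B))} {b : B}
    (h : ∀ Y ∈ l, ∀ c, Commute b (Y c)) (c : C) : Commute b (l.prod c) := by
  induction l generalizing c with
  | nil =>
    rw [List.prod_nil, LinearMap.convOne_apply]
    exact (Algebra.commutes _ _).symm
  | cons Y l ih =>
    rw [List.prod_cons]
    exact convMul_commute (h Y (by simp)) (fun c => ih (fun Z hZ => h Z (by simp [hZ])) c) c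

theorem isRep_list_prod {l : List (WithConv (H →ₗ[ℂ] B))} (h : ∀ Y ∈ l, IsRep Y.ofConv)
    (hc : l.Pairwise fun Y Z => ∀ x y, Commute (Y x) (Z y)) : IsRep l.prod.ofConv := by
  induction l with
  | nil =>
    rw [List.prod_nil]
    exact ⟨by simp, fun x y => by simp⟩
  | cons Y l ih =>
    rw [List.prod_cons]
    rw [List.pairwise_cons] at hc
    refine IsRep.convMul (h Y (by simp)) (ih (fun Z hZ => h Z (by simp [hZ])) hc.2) fun x y => ?_
    exact conv_list_prod_commute (fun Z hZ c => hc.1 Z hZ x c) y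

/-- The map `b ⊗ x ↦ φ(x) b`, linear in `φ`. -/
def evalDual (B H : Type*) [Ring B] [Algebra ℂ B] [Ring H] [HopfAlgebra ℂ H] :
    Module.Dual ℂ H →ₗ[ℂ] B ⊗[ℂ] H →ₗ[ℂ] B where
  toFun φ := (TensorProduct.rid ℂ B).toLinearMap ∘ₗ φ.lTensor B
  map_add' φ ψ := by rw [LinearMap.lTensor_add, LinearMap.comp_add]
  map_smul' z φ := by rw [LinearMap.lTensor_smul, LinearMap.comp_smul, RingHom.id_apply]

@[simp]
theorem evalDual_tmul (φ : Module.Dual ℂ H) (b : B) (x : H) :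
    evalDual B H φ (b ⊗ₜ x) = φ x • b := rfl

theorem evalDual_mul_tmul_one (φ : Module.Dual ℂ H) (z : B ⊗[ℂ] H) (b : B) :
    evalDual B H φ (z * (b ⊗ₜ 1)) = evalDual B H φ z * b := by
  induction z with
  | zero => simp
  | tmul c x => simp
  | add z w hz hw => rw [add_mul, map_add, map_add, add_mul, hz, hw]

theorem evalDual_tmul_one_mul (φ : Module.Dual ℂ H) (z : B ⊗[ℂ] H) (b : B) :
    evalDual B H φ ((b ⊗ₜ 1) * z) = b * evalDual B H φ z := by
  induction z with
  | zero => simp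
  | tmul c x => simp
  | add z w hz hw => rw [mul_add, map_add, map_add, mul_add, hz, hw]

theorem evalDual_sandwich (φ : Module.Dual ℂ H) (z : B ⊗[ℂ] H) (x y : H) :
    evalDual B H (sandwich H φ x y) z = evalDual B H φ ((1 ⊗ₜ y) * (z * (1 ⊗ₜ x))) := by
  induction z with
  | zero => simp
  | tmul c x => simp
  | add z w hz hw => rw [add_mul, mul_add, map_add, map_add, hz, hw]

/-- The relation `r (1 ⊗ g c₁) (Y c₂ ⊗ 1) = (Y c₁ ⊗ 1) (1 ⊗ g c₂) r`, as an identity in a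
convolution algebra. It says how the reading `r` changes under the operators `Y c`. -/
def Intertwines (r : B ⊗[ℂ] H) (g : C →ₗ[ℂ] H) (Y : C →ₗ[ℂ] B) : Prop :=
  convConst C r * (convRight B (toConv g) * convLeft H (toConv Y)) =
    convLeft H (toConv Y) * convRight B (toConv g) * convConst C r

/-- `S(x₂) x₁ = ε(x)` when the antipode is an involution. -/
theorem sum_antipode_right_mul_left (hS : ∀ h : H, HopfAlgebra.antipode ℂ
    (HopfAlgebra.antipode ℂ h) = h) (x : H) :
    ∑ i ∈ (ℛ ℂ x).index, HopfAlgebra.antipode ℂ ((ℛ ℂ x).right i) * (ℛ ℂ x).left i =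
      counit (R := ℂ) x • (1 : H) := by
  have h := congrArg (HopfAlgebra.antipode ℂ) (HopfAlgebra.sum_antipode_mul_eq_smul (ℛ ℂ x))
  simpa [HopfAlgebra.antipode_mul_antidistrib, hS] using h

/-- `S(g c₂) g(c₁) = ε(c)` for a morphism of coalgebras `g`. -/
theorem sum_antipode_comp_right_mul_left (hS : ∀ h : H, HopfAlgebra.antipode ℂ
    (HopfAlgebra.antipode ℂ h) = h) {g : C →ₗ[ℂ] H}
    (hg : ∀ c, comul (R := ℂ) (g c) = TensorProduct.map g g (comul (R := ℂ) c))
    (hg' : ∀ c, counit (R := ℂ) (g c) = counit (R := ℂ) c) (c : C) :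
    ∑ i ∈ (ℛ ℂ c).index, HopfAlgebra.antipode ℂ (g ((ℛ ℂ c).right i)) * g ((ℛ ℂ c).left i) =
      counit (R := ℂ) c • (1 : H) := by
  have h := hg c
  rw [← (ℛ ℂ c).eq, ← (ℛ ℂ (g c)).eq] at h
  have h1 := congrArg (TensorProduct.lift ((LinearMap.mul ℂ H).flip.compl₂
    (HopfAlgebra.antipode ℂ))) h
  simp only [map_sum, TensorProduct.lift.tmul, LinearMap.compl₂_apply, LinearMap.flip_apply,
    LinearMap.mul_apply', TensorProduct.map_tmul] at h1
  rw [← h1, sum_antipode_right_mul_left hS, hg']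

/-- `φ(f c₃ ? g c₁) ⊗ c₂` as a sum over iterated coproducts. -/
theorem twist_tmul (f g : C →ₗ[ℂ] H) (φ : Module.Dual ℂ H) (c : C) :
    twist f g (φ ⊗ₜ c) = ∑ i ∈ (ℛ ℂ c).index, ∑ j ∈ (ℛ ℂ ((ℛ ℂ c).left i)).index,
      sandwich H φ (g ((ℛ ℂ ((ℛ ℂ c).left i)).left j)) (f ((ℛ ℂ c).right i)) ⊗ₜ[ℂ]
        (ℛ ℂ ((ℛ ℂ c).left i)).right j := by
  have h : (comul (R := ℂ)).rTensor C (comul (R := ℂ) c) =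
      ∑ i ∈ (ℛ ℂ c).index, ∑ j ∈ (ℛ ℂ ((ℛ ℂ c).left i)).index,
        ((ℛ ℂ ((ℛ ℂ c).left i)).left j ⊗ₜ[ℂ] (ℛ ℂ ((ℛ ℂ c).left i)).right j) ⊗ₜ[ℂ]
          (ℛ ℂ c).right i := by
    conv_lhs => rw [← (ℛ ℂ c).eq]
    rw [map_sum]
    refine Finset.sum_congr rfl fun i _ => ?_
    rw [LinearMap.rTensor_tmul, ← (ℛ ℂ ((ℛ ℂ c).left i)).eq, TensorProduct.sum_tmul]
  simp only [twist, TensorProduct.lift.tmul, LinearMap.mk₂_apply, h, map_sum]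
  rfl

/-- The intertwining relation, solved for the product in the opposite order. -/
theorem Intertwines.twist (hS : ∀ h : H, HopfAlgebra.antipode ℂ (HopfAlgebra.antipode ℂ h) = h)
    {r : B ⊗[ℂ] H} {g : C →ₗ[ℂ] H} {Y : C →ₗ[ℂ] B} (h : Intertwines r g Y)
    (hg : ∀ c, comul (R := ℂ) (g c) = TensorProduct.map g g (comul (R := ℂ) c))
    (hg' : ∀ c, counit (R := ℂ) (g c) = counit (R := ℂ) c) (φ : Module.Dual ℂ H) (c : C) :
    LinearMap.mul' ℂ B (TensorProduct.map ((evalDual B H).flip r) Y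
      (twist (HopfAlgebra.antipode ℂ ∘ₗ g) g (φ ⊗ₜ c))) = Y c * evalDual B H φ r := by
  have h1 : ∀ l : C, r * ∑ j ∈ (ℛ ℂ l).index,
      ((1 : B) ⊗ₜ[ℂ] g ((ℛ ℂ l).left j)) * (Y ((ℛ ℂ l).right j) ⊗ₜ[ℂ] (1 : H)) =
      (∑ j ∈ (ℛ ℂ l).index, Y ((ℛ ℂ l).left j) ⊗ₜ[ℂ] g ((ℛ ℂ l).right j)) * r := by
    intro l
    have h2 := congrArg (fun f => f.ofConv l) h
    change (convConst C r * _) l = (_ * convConst C r) l at h2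
    rw [convConst_mul_apply, mul_convConst_apply, (ℛ ℂ l).convMul_apply,
      (ℛ ℂ l).convMul_apply] at h2
    simpa [convLeft_apply, convRight_apply] using h2
  calc _ = ∑ i ∈ (ℛ ℂ c).index, evalDual B H φ ((1 ⊗ₜ HopfAlgebra.antipode ℂ
          (g ((ℛ ℂ c).right i))) * (r * ∑ j ∈ (ℛ ℂ ((ℛ ℂ c).left i)).index,
            ((1 : B) ⊗ₜ[ℂ] g ((ℛ ℂ ((ℛ ℂ c).left i)).left j)) *
              (Y ((ℛ ℂ ((ℛ ℂ c).left i)).right j) ⊗ₜ[ℂ] (1 : H)))) := by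
        rw [twist_tmul]
        simp only [map_sum, TensorProduct.map_tmul, LinearMap.mul'_apply, LinearMap.flip_apply,
          evalDual_sandwich, Finset.mul_sum, LinearMap.comp_apply]
        refine Finset.sum_congr rfl fun i _ => Finset.sum_congr rfl fun j _ => ?_
        rw [← evalDual_mul_tmul_one]
        simp only [mul_assoc]
    _ = evalDual B H φ ((∑ i ∈ (ℛ ℂ c).index, ∑ j ∈ (ℛ ℂ ((ℛ ℂ c).left i)).index,
          Y ((ℛ ℂ ((ℛ ℂ c).left i)).left j) ⊗ₜ[ℂ] (HopfAlgebra.antipode ℂ (g ((ℛ ℂ c).right i)) *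
            g ((ℛ ℂ ((ℛ ℂ c).left i)).right j))) * r) := by
        rw [Finset.sum_mul, map_sum]
        refine Finset.sum_congr rfl fun i _ => ?_
        rw [h1, ← mul_assoc, Finset.mul_sum]
        simp
    _ = evalDual B H φ ((Y c ⊗ₜ 1) * r) := by
        congr 2
        have key := sum_comul_assoc (LinearMap.mk₂ ℂ
          (fun a b => TensorProduct.mk ℂ B H (Y a) ∘ₗ LinearMap.mulRight ℂ (g b) ∘ₗ
            HopfAlgebra.antipode ℂ ∘ₗ g)
          (by intros; ext; simp)
          (by intros; ext; simp [TensorProduct.smul_tmul'])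
          (by intros; ext; simp [mul_add, TensorProduct.tmul_add])
          (by intros; ext; simp)) c
        simp only [LinearMap.mk₂_apply, LinearMap.comp_apply, LinearMap.mulRight_apply,
          TensorProduct.mk_apply] at key
        rw [key]
        simp only [← TensorProduct.tmul_sum, sum_antipode_comp_right_mul_left hS hg hg',
          TensorProduct.tmul_smul]
        have h3 := congrArg (fun z => Y (TensorProduct.rid ℂ C z)) (sum_tmul_counit_eq (ℛ ℂ c))
        simp only [map_sum, TensorProduct.rid_tmul, map_smul, one_smul] at h3
        rw [← h3, TensorProduct.sum_tmul]
        rfl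
    _ = _ := evalDual_tmul_one_mul φ r (Y c)

/-- The pattern behind all intertwining relations, in a monoid: `g` is absorbed by `y₁` at the right
end `r₃` of the reading, and produced again by `y₃` at its left end `r₁`. -/
theorem intertwine_of_ends {M : Type*} [Monoid M] {r₁ r₂ r₃ g y₁ y₂ y₃ : M}
    (h₁ : r₃ * (g * y₁) = y₁ * r₃) (h₃ : r₁ * y₃ = y₃ * g * r₁)
    (c₁ : Commute (r₁ * r₂) y₁) (c₂ : Commute (r₁ * r₂ * r₃) y₂) (c₃ : Commute (r₂ * r₃) y₃) :
    r₁ * r₂ * r₃ * (g * (y₁ * y₂ * y₃)) = y₁ * y₂ * y₃ * g * (r₁ * r₂ * r₃) := by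
  calc r₁ * r₂ * r₃ * (g * (y₁ * y₂ * y₃)) = r₁ * r₂ * (r₃ * (g * y₁)) * y₂ * y₃ := by
        simp only [mul_assoc]
    _ = (r₁ * r₂ * y₁) * r₃ * y₂ * y₃ := by rw [h₁]; simp only [mul_assoc]
    _ = y₁ * (r₁ * r₂ * r₃ * y₂) * y₃ := by rw [c₁.eq]; simp only [mul_assoc]
    _ = y₁ * y₂ * r₁ * (r₂ * r₃ * y₃) := by rw [c₂.eq]; simp only [mul_assoc]
    _ = y₁ * y₂ * (r₁ * y₃) * (r₂ * r₃) := by rw [c₃.eq]; simp only [mul_assoc]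
    _ = _ := by rw [h₃]; simp only [mul_assoc]

end Abstract

/-! ### Readings as elements of tensor products of algebras -/

section Legs

variable {B B' N N₁ N₂ N₁' N₂' : Type*} [Ring B] [Algebra ℂ B] [Ring B'] [Algebra ℂ B']
  [Ring N₁] [Algebra ℂ N₁] [Ring N₂] [Algebra ℂ N₂]
  [Ring N₁'] [Algebra ℂ N₁'] [Ring N₂'] [Algebra ℂ N₂']

/-- The embedding `β ⊗ x ↦ β ⊗ (x ⊗ 1)`. -/
def legFst (B N₁ N₂ : Type*) [Ring B] [Algebra ℂ B] [Ring N₁] [Algebra ℂ N₁] [Ring N₂]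
    [Algebra ℂ N₂] : B ⊗[ℂ] N₁ →ₐ[ℂ] B ⊗[ℂ] (N₁ ⊗[ℂ] N₂) :=
  Algebra.TensorProduct.map (AlgHom.id ℂ B) Algebra.TensorProduct.includeLeft

/-- The embedding `β ⊗ x ↦ β ⊗ (1 ⊗ x)`. -/
def legSnd (B N₁ N₂ : Type*) [Ring B] [Algebra ℂ B] [Ring N₁] [Algebra ℂ N₁] [Ring N₂]
    [Algebra ℂ N₂] : B ⊗[ℂ] N₂ →ₐ[ℂ] B ⊗[ℂ] (N₁ ⊗[ℂ] N₂) :=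
  Algebra.TensorProduct.map (AlgHom.id ℂ B) Algebra.TensorProduct.includeRight

@[simp]
theorem legFst_tmul (b : B) (x : N₁) : legFst B N₁ N₂ (b ⊗ₜ x) = b ⊗ₜ (x ⊗ₜ 1) := rfl

@[simp]
theorem legSnd_tmul (b : B) (x : N₂) : legSnd B N₁ N₂ (b ⊗ₜ x) = b ⊗ₜ (1 ⊗ₜ x) := rfl

/-- The readings `r` and `s` can be carried out in either order: `r₁₂ s₁₃ = s₁₃ r₁₂`. -/
def LegsCommute (r : B ⊗[ℂ] N₁) (s : B ⊗[ℂ] N₂) : Prop :=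
  Commute (legFst B N₁ N₂ r) (legSnd B N₁ N₂ s)

theorem LegsCommute.map {r : B ⊗[ℂ] N₁} {s : B ⊗[ℂ] N₂} (h : LegsCommute r s) (f : B →ₐ[ℂ] B')
    (g₁ : N₁ →ₐ[ℂ] N₁') (g₂ : N₂ →ₐ[ℂ] N₂') :
    LegsCommute (Algebra.TensorProduct.map f g₁ r) (Algebra.TensorProduct.map f g₂ s) := by
  have h1 : ∀ r : B ⊗[ℂ] N₁, legFst B' N₁' N₂' (Algebra.TensorProduct.map f g₁ r) =
      Algebra.TensorProduct.map f (Algebra.TensorProduct.map g₁ g₂) (legFst B N₁ N₂ r) := by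
    intro r
    induction r with
    | zero => simp
    | tmul b x => simp
    | add x y hx hy => simp only [map_add, hx, hy]
  have h2 : ∀ s : B ⊗[ℂ] N₂, legSnd B' N₁' N₂' (Algebra.TensorProduct.map f g₂ s) =
      Algebra.TensorProduct.map f (Algebra.TensorProduct.map g₁ g₂) (legSnd B N₁ N₂ s) := by
    intro r
    induction r with
    | zero => simp
    | tmul b x => simp
    | add x y hx hy => simp only [map_add, hx, hy]
  unfold LegsCommute
  rw [h1, h2]
  exact Commute.map h _

theorem legsCommute_of_commute {D D' : Type*} [Ring D] [Algebra ℂ D] [Ring D'] [Algebra ℂ D']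
    (f : D →ₐ[ℂ] B) (g : D' →ₐ[ℂ] B) (h : ∀ x y, Commute (f x) (g y)) (r : D ⊗[ℂ] N₁)
    (s : D' ⊗[ℂ] N₂) :
    LegsCommute (Algebra.TensorProduct.map f (AlgHom.id ℂ N₁) r)
      (Algebra.TensorProduct.map g (AlgHom.id ℂ N₂) s) := by
  unfold LegsCommute
  induction r with
  | zero => simp
  | add x y hx hy => simp only [map_add]; exact hx.add_left hy
  | tmul b x =>
    induction s with
    | zero => simp
    | add x y hx hy => simp only [map_add]; exact hx.add_right hy
    | tmul c y => simp [commute_iff_eq, (h b c).eq]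

theorem LegsCommute.list_prod_right {r : B ⊗[ℂ] N₁} {l : List (B ⊗[ℂ] N₂)}
    (h : ∀ s ∈ l, LegsCommute r s) : LegsCommute r l.prod := by
  unfold LegsCommute
  rw [map_list_prod]
  refine Commute.list_prod_right _ _ fun x hx => ?_
  obtain ⟨s, hs, rfl⟩ := List.mem_map.1 hx
  exact h s hs

theorem LegsCommute.list_prod_left {s : B ⊗[ℂ] N₂} {l : List (B ⊗[ℂ] N₁)}
    (h : ∀ r ∈ l, LegsCommute r s) : LegsCommute l.prod s := by
  unfold LegsCommute
  rw [map_list_prod]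
  refine Commute.list_prod_left _ _ fun x hx => ?_
  obtain ⟨s, hs, rfl⟩ := List.mem_map.1 hx
  exact h s hs

/-- A reading on a slot commutes with everything that commutes with the slot. -/
theorem commute_map_tmul_one {D : Type*} [Ring D] [Algebra ℂ D] (f : D →ₐ[ℂ] B) (r : D ⊗[ℂ] N₁)
    {b : B} (h : ∀ x, Commute (f x) b) :
    Commute (Algebra.TensorProduct.map f (AlgHom.id ℂ N₁) r) (b ⊗ₜ 1) := by
  induction r with
  | zero => simp
  | add x y hx hy => simp only [map_add]; exact hx.add_left hy
  | tmul c x =>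
    rw [Algebra.TensorProduct.map_tmul, commute_iff_eq, Algebra.TensorProduct.tmul_mul_tmul,
      Algebra.TensorProduct.tmul_mul_tmul, (h c).eq, mul_one, one_mul]

end Legs

section Coaction

variable {B B' H : Type*} [Ring B] [Algebra ℂ B] [Ring B'] [Algebra ℂ B'] [Ring H]
  [HopfAlgebra ℂ H]

/-- The reading `r = Σ β ⊗ x` is a coaction: `Σ ε(x) β = 1` and `(id ⊗ Δ) r = r₁₂ r₁₃`. -/
structure IsCoaction (r : B ⊗[ℂ] H) : Prop where
  evalDual_counit : evalDual B H counit r = 1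
  map_comul : Algebra.TensorProduct.map (AlgHom.id ℂ B) (Bialgebra.comulAlgHom ℂ H) r =
    legFst B H H r * legSnd B H H r

theorem evalDual_counit_mul (r s : B ⊗[ℂ] H) :
    evalDual B H counit (r * s) = evalDual B H counit r * evalDual B H counit s := by
  induction r with
  | zero => simp
  | add x y hx hy => rw [add_mul, map_add, map_add, add_mul, hx, hy]
  | tmul b x =>
    induction s with
    | zero => simp
    | add x y hx hy => rw [mul_add, map_add, map_add, mul_add, hx, hy]
    | tmul c y =>
      rw [Algebra.TensorProduct.tmul_mul_tmul, evalDual_tmul, evalDual_tmul, evalDual_tmul,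
        Bialgebra.counit_mul, smul_mul_smul_comm]

theorem isCoaction_one : IsCoaction (1 : B ⊗[ℂ] H) := by
  refine ⟨?_, by simp⟩
  rw [Algebra.TensorProduct.one_def, evalDual_tmul]
  simp

theorem IsCoaction.mul {r s : B ⊗[ℂ] H} (hr : IsCoaction r) (hs : IsCoaction s)
    (h : LegsCommute s r) : IsCoaction (r * s) := by
  refine ⟨by rw [evalDual_counit_mul, hr.1, hs.1, one_mul], ?_⟩
  rw [map_mul, map_mul, map_mul, hr.2, hs.2, mul_assoc, ← mul_assoc (legSnd B H H r),
    ← h.eq]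
  simp only [mul_assoc]

theorem isCoaction_list_prod {l : List (B ⊗[ℂ] H)} (h : ∀ r ∈ l, IsCoaction r)
    (hc : l.Pairwise fun r s => LegsCommute s r) : IsCoaction l.prod := by
  induction l with
  | nil => exact isCoaction_one
  | cons r l ih =>
    rw [List.pairwise_cons] at hc
    rw [List.prod_cons]
    exact (h r (by simp)).mul (ih (fun s hs => h s (by simp [hs])) hc.2)
      (LegsCommute.list_prod_left hc.1)

theorem IsCoaction.map {r : B ⊗[ℂ] H} (h : IsCoaction r) (f : B →ₐ[ℂ] B') :
    IsCoaction (Algebra.TensorProduct.map f (AlgHom.id ℂ H) r) := by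
  have h0 : ∀ r : B ⊗[ℂ] H, evalDual B' H counit (Algebra.TensorProduct.map f (AlgHom.id ℂ H) r) =
      f (evalDual B H counit r) := by
    intro r
    induction r with
    | zero => simp
    | tmul b x => simp
    | add x y hx hy => simp only [map_add, hx, hy]
  have h1 : ∀ r : B ⊗[ℂ] H, legFst B' H H (Algebra.TensorProduct.map f (AlgHom.id ℂ H) r) =
      Algebra.TensorProduct.map f (AlgHom.id ℂ (H ⊗[ℂ] H)) (legFst B H H r) := by
    intro r
    induction r with
    | zero => simp
    | tmul b x => simp
    | add x y hx hy => simp only [map_add, hx, hy]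
  have h2 : ∀ r : B ⊗[ℂ] H, legSnd B' H H (Algebra.TensorProduct.map f (AlgHom.id ℂ H) r) =
      Algebra.TensorProduct.map f (AlgHom.id ℂ (H ⊗[ℂ] H)) (legSnd B H H r) := by
    intro r
    induction r with
    | zero => simp
    | tmul b x => simp
    | add x y hx hy => simp only [map_add, hx, hy]
  have h3 : ∀ r : B ⊗[ℂ] H, Algebra.TensorProduct.map (AlgHom.id ℂ B') (Bialgebra.comulAlgHom ℂ H)
      (Algebra.TensorProduct.map f (AlgHom.id ℂ H) r) =
      Algebra.TensorProduct.map f (AlgHom.id ℂ (H ⊗[ℂ] H))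
        (Algebra.TensorProduct.map (AlgHom.id ℂ B) (Bialgebra.comulAlgHom ℂ H) r) := by
    intro r
    induction r with
    | zero => simp
    | tmul b x => simp
    | add x y hx hy => simp only [map_add, hx, hy]
  exact ⟨by rw [h0, h.1, map_one], by rw [h3, h.2, map_mul, h1, h2]⟩

/-- The map `β ⊗ (x ⊗ y) ↦ φ(x) ψ(y) β`. -/
def evalDualTwo (B : Type*) [Ring B] [Algebra ℂ B] (φ ψ : Module.Dual ℂ H) :
    B ⊗[ℂ] (H ⊗[ℂ] H) →ₗ[ℂ] B :=
  (TensorProduct.rid ℂ B).toLinearMap ∘ₗ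
    (TensorProduct.dualDistrib ℂ H H (φ ⊗ₜ ψ)).lTensor B

/-- Evaluating elements of the dual Hopf algebra on a coaction is multiplicative. -/
theorem IsCoaction.evalDual_dualMul {r : B ⊗[ℂ] H} (h : IsCoaction r) (φ ψ : Module.Dual ℂ H) :
    evalDual B H (dualMul H (φ ⊗ₜ ψ)) r = evalDual B H φ r * evalDual B H ψ r := by
  have h1 : ∀ s : B ⊗[ℂ] H, evalDual B H (dualMul H (φ ⊗ₜ ψ)) s = evalDualTwo B φ ψ
      (Algebra.TensorProduct.map (AlgHom.id ℂ B) (Bialgebra.comulAlgHom ℂ H) s) := by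
    intro s
    induction s with
    | zero => simp
    | tmul b x => simp [evalDualTwo, dualMul]
    | add x y hx hy => simp only [map_add, hx, hy]
  have h2 : ∀ s t : B ⊗[ℂ] H, evalDualTwo B φ ψ (legFst B H H s * legSnd B H H t) =
      evalDual B H φ s * evalDual B H ψ t := by
    intro s t
    induction s with
    | zero => simp
    | add x y hx hy => simp only [map_add, add_mul, hx, hy]
    | tmul b x =>
      induction t with
      | zero => simp
      | add x y hx hy => simp only [map_add, mul_add, hx, hy]
      | tmul c y => simp [evalDualTwo, smul_smul, mul_comm]
  rw [h1, h.2, h2]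

end Coaction

section Transport

variable {A B H N : Type*} [Ring A] [Algebra ℂ A] [Ring B] [Algebra ℂ B] [Ring N] [Algebra ℂ N]
  [Ring H] [HopfAlgebra ℂ H]

/-- The right action of the algebra `B ⊗ End A` on linear maps `K : A → B`, given by
`(K · (β ⊗ f))(a) = K (f a) β`. -/
def transport (K : A →ₗ[ℂ] B) : B ⊗[ℂ] Module.End ℂ A →ₗ[ℂ] A →ₗ[ℂ] B :=
  TensorProduct.lift (LinearMap.mk₂ ℂ (fun β f => LinearMap.mulRight ℂ β ∘ₗ K ∘ₗ f)
    (by intros; ext; simp [mul_add]) (by intros; ext; simp)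
    (by intros; ext; simp [add_mul]) (by intros; ext; simp))

@[simp]
theorem transport_tmul (K : A →ₗ[ℂ] B) (β : B) (f : Module.End ℂ A) (a : A) :
    transport K (β ⊗ₜ f) a = K (f a) * β := rfl

theorem transport_one (K : A →ₗ[ℂ] B) : transport K 1 = K := by
  ext a
  simp [Algebra.TensorProduct.one_def]

theorem transport_mul (K : A →ₗ[ℂ] B) (z w : B ⊗[ℂ] Module.End ℂ A) :
    transport K (z * w) = transport (transport K z) w := by
  induction w with
  | zero => simp
  | add x y hx hy => rw [mul_add, map_add, map_add, hx, hy]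
  | tmul c g =>
    induction z with
    | zero => ext; simp
    | add x y hx hy =>
      ext a
      have hx' := LinearMap.congr_fun hx a
      have hy' := LinearMap.congr_fun hy a
      simp only [transport_tmul] at hx' hy'
      simp [add_mul, hx', hy']
    | tmul b f => ext a; simp [mul_assoc]

theorem transport_mul_tmul_one (K : A →ₗ[ℂ] B) (z : B ⊗[ℂ] Module.End ℂ A) (b : B) (a : A) :
    transport K (z * (b ⊗ₜ 1)) a = transport K z a * b := by
  rw [transport_mul]
  simp

theorem transport_tmul_one_mul (K : A →ₗ[ℂ] B) (z : B ⊗[ℂ] Module.End ℂ A) {b : B}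
    (h : ∀ a, Commute b (K a)) (a : A) :
    transport K ((b ⊗ₜ 1) * z) a = b * transport K z a := by
  induction z with
  | zero => simp
  | add x y hx hy => simp only [mul_add, map_add, LinearMap.add_apply, hx, hy]
  | tmul c f => simp [← mul_assoc, (h _).eq]

theorem commute_transport {K : A →ₗ[ℂ] B} {z : B ⊗[ℂ] Module.End ℂ A} {b : B}
    (h : ∀ a, Commute b (K a)) (hz : Commute z (b ⊗ₜ 1)) (a : A) :
    Commute b (transport K z a) := by
  rw [commute_iff_eq, ← transport_tmul_one_mul K z h, ← hz.eq, transport_mul_tmul_one]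

/-- A reading `r` that commutes with `K` and with `z` commutes with `K · z`. -/
theorem commute_transport_tmul_one {K : A →ₗ[ℂ] B} {z : B ⊗[ℂ] Module.End ℂ A} {r : B ⊗[ℂ] N}
    (h : ∀ a, Commute r (K a ⊗ₜ 1)) (hz : LegsCommute r z) (a : A) :
    Commute r (transport K z a ⊗ₜ 1) := by
  -- `Ψ (b ⊗ x ⊗ f) = K(f a) b ⊗ x` turns the commutation of the two legs into the assertion
  let Ψ : B ⊗[ℂ] (N ⊗[ℂ] Module.End ℂ A) →ₗ[ℂ] B ⊗[ℂ] N :=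
    (TensorProduct.comm ℂ N B).toLinearMap ∘ₗ ((LinearMap.applyₗ a ∘ₗ transport K).lTensor N) ∘ₗ
      (TensorProduct.leftComm ℂ B N (Module.End ℂ A)).toLinearMap
  have hΨ : ∀ b x f, Ψ (b ⊗ₜ (x ⊗ₜ f)) = (K (f a) * b) ⊗ₜ x := fun b x f => rfl
  have h1 : ∀ (w : B ⊗[ℂ] Module.End ℂ A) (s : B ⊗[ℂ] N),
      Ψ (legSnd B N _ w * legFst B N _ s) = (transport K w a ⊗ₜ 1) * s := by
    intro w s
    induction s with
    | zero => simp
    | add x y hx hy => simp only [map_add, mul_add, hx, hy]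
    | tmul b x =>
      induction w with
      | zero => simp
      | add x y hx hy => simp only [map_add, add_mul, LinearMap.add_apply, hx, hy,
          TensorProduct.add_tmul]
      | tmul c f => simp [hΨ, mul_assoc]
  have h2 : ∀ (w : B ⊗[ℂ] Module.End ℂ A), Ψ (legFst B N _ r * legSnd B N _ w) =
      r * (transport K w a ⊗ₜ 1) := by
    intro w
    induction w with
    | zero => simp
    | add x y hx hy => simp only [map_add, mul_add, LinearMap.add_apply, hx, hy,
        TensorProduct.add_tmul]
    | tmul c f =>
      have h3 : ∀ s : B ⊗[ℂ] N, Ψ (legFst B N _ s * legSnd B N _ (c ⊗ₜ f)) =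
          (K (f a) ⊗ₜ 1) * s * (c ⊗ₜ 1) := by
        intro s
        induction s with
        | zero => simp
        | add x y hx hy => simp only [map_add, add_mul, mul_add, hx, hy]
        | tmul b x => simp [hΨ, mul_assoc]
      rw [h3, ← (h (f a)).eq, mul_assoc]
      simp
  rw [commute_iff_eq, ← h2, hz.eq, h1]

/-- If `H` acts on `A` by maps `α x` with `α x (a b) = (α x₁ a) (α x₂ b)` then transporting a
representation of `A` along a coaction yields a representation. -/
theorem isRep_transport {K : A →ₗ[ℂ] B} (hK : IsRep K) (α : H →ₐ[ℂ] Module.End ℂ A)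
    (hα : ∀ (h : H) (a b : A), α h (a * b) = LinearMap.mul' ℂ A
      (TensorProduct.map (α.toLinearMap.flip a) (α.toLinearMap.flip b) (comul (R := ℂ) h)))
    (hα₁ : ∀ h : H, α h 1 = counit (R := ℂ) h • (1 : A)) {z : B ⊗[ℂ] H} (hz : IsCoaction z)
    (hc : ∀ a, Commute z (K a ⊗ₜ 1)) :
    IsRep (transport K (Algebra.TensorProduct.map (AlgHom.id ℂ B) α z)) := by
  constructor
  · have h1 : ∀ w : B ⊗[ℂ] H, transport K (Algebra.TensorProduct.map (AlgHom.id ℂ B) α w) 1 =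
        evalDual B H counit w := by
      intro w
      induction w with
      | zero => simp
      | tmul b x => simp [hα₁, hK.1]
      | add x y hx hy => simp only [map_add, LinearMap.add_apply, hx, hy]
    rw [h1, hz.1]
  · intro a b
    let Ψ : B ⊗[ℂ] (H ⊗[ℂ] H) →ₗ[ℂ] B :=
      LinearMap.mul' ℂ B ∘ₗ (TensorProduct.comm ℂ B B).toLinearMap ∘ₗ
        (K ∘ₗ LinearMap.mul' ℂ A ∘ₗ
          TensorProduct.map (α.toLinearMap.flip a) (α.toLinearMap.flip b)).lTensor B
    have hΨ : ∀ β x y, Ψ (β ⊗ₜ (x ⊗ₜ y)) = K (α x a) * K (α y b) * β := by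
      intro β x y
      simp [Ψ, hK.2]
    have h1 : ∀ w : B ⊗[ℂ] H, transport K (Algebra.TensorProduct.map (AlgHom.id ℂ B) α w) (a * b) =
        Ψ (Algebra.TensorProduct.map (AlgHom.id ℂ B) (Bialgebra.comulAlgHom ℂ H) w) := by
      intro w
      induction w with
      | zero => simp
      | tmul β x => simp [Ψ, hα]
      | add x y hx hy => simp only [map_add, LinearMap.add_apply, hx, hy]
    have h2 : ∀ w : B ⊗[ℂ] H, Ψ (legFst B H H z * legSnd B H H w) =
        transport K (Algebra.TensorProduct.map (AlgHom.id ℂ B) α z) a *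
          transport K (Algebra.TensorProduct.map (AlgHom.id ℂ B) α w) b := by
      intro w
      induction w with
      | zero => simp
      | add x y hx hy => simp only [map_add, mul_add, LinearMap.add_apply, hx, hy]
      | tmul β y =>
        have h3 : ∀ s : B ⊗[ℂ] H, Ψ (legFst B H H s * legSnd B H H (β ⊗ₜ y)) =
            transport K (Algebra.TensorProduct.map (AlgHom.id ℂ B) α ((K (α y b) ⊗ₜ 1) * s)) a *
              β := by
          intro s
          induction s with
          | zero => simp
          | add x y hx hy => simp only [map_add, add_mul, mul_add, LinearMap.add_apply, hx, hy]
          | tmul c x => simp [hΨ, mul_assoc]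
        have h4 : Algebra.TensorProduct.map (AlgHom.id ℂ B) α (K (α y b) ⊗ₜ[ℂ] 1) =
            K (α y b) ⊗ₜ[ℂ] (1 : Module.End ℂ A) := by simp
        rw [h3, ← (hc _).eq, map_mul, h4, transport_mul_tmul_one]
        simp [mul_assoc]
    rw [h1, hz.2, h2]

end Transport

/-! ### Readings on a finite dimensional space -/

section Reading

variable {T N N₁ N₂ : Type*} [AddCommGroup T] [Module ℂ T] [Ring N] [Algebra ℂ N]
  [Ring N₁] [Algebra ℂ N₁] [Ring N₂] [Algebra ℂ N₂]

/-- The map `t ↦ Σ β t ⊗ x` given by an element `Σ β ⊗ x` of `End T ⊗ N`. -/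
def readMap (T N : Type*) [AddCommGroup T] [Module ℂ T] [AddCommGroup N] [Module ℂ N] :
    Module.End ℂ T ⊗[ℂ] N →ₗ[ℂ] T →ₗ[ℂ] T ⊗[ℂ] N :=
  TensorProduct.rTensorHomToHomRTensor (RingHom.id ℂ) T T N

@[simp]
theorem readMap_tmul {N : Type*} [AddCommGroup N] [Module ℂ N] (β : Module.End ℂ T) (x : N)
    (t : T) : readMap T N (β ⊗ₜ x) t = β t ⊗ₜ x := rfl

theorem readMap_mul_tmul (z : Module.End ℂ T ⊗[ℂ] N) (β : Module.End ℂ T) (x : N) (t : T) :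
    readMap T N (z * (β ⊗ₜ x)) t = (LinearMap.mulRight ℂ x).lTensor T (readMap T N z (β t)) := by
  induction z with
  | zero => simp
  | tmul b y => simp
  | add x y hx hy => simp only [add_mul, map_add, LinearMap.add_apply, hx, hy]

theorem readMap_tmul_mul (z : Module.End ℂ T ⊗[ℂ] N) (β : Module.End ℂ T) (x : N) (t : T) :
    readMap T N ((β ⊗ₜ x) * z) t =
      TensorProduct.map β (LinearMap.mulLeft ℂ x) (readMap T N z t) := by
  induction z with
  | zero => simp
  | tmul b y => simp
  | add x y hx hy => simp only [mul_add, map_add, LinearMap.add_apply, hx, hy]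

theorem readMap_map (f : N₁ →ₐ[ℂ] N₂) (z : Module.End ℂ T ⊗[ℂ] N₁) (t : T) :
    readMap T N₂ (Algebra.TensorProduct.map (AlgHom.id ℂ _) f z) t =
      f.toLinearMap.lTensor T (readMap T N₁ z t) := by
  induction z with
  | zero => simp
  | tmul b y => simp
  | add x y hx hy => simp only [map_add, LinearMap.add_apply, hx, hy]

theorem readMap_legFst_mul_legSnd (z : Module.End ℂ T ⊗[ℂ] N₁) (w : Module.End ℂ T ⊗[ℂ] N₂)
    (t : T) :
    readMap T (N₁ ⊗[ℂ] N₂) (legFst _ N₁ N₂ z * legSnd _ N₁ N₂ w) t =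
      TensorProduct.assoc ℂ T N₁ N₂ ((readMap T N₁ z).rTensor N₂ (readMap T N₂ w t)) := by
  induction z with
  | zero => simp
  | add x y hx hy => simp only [map_add, add_mul, LinearMap.add_apply, hx, hy,
      LinearMap.rTensor_add]
  | tmul b y =>
    induction w with
    | zero => simp
    | add x y hx hy => simp only [map_add, mul_add, LinearMap.add_apply, hx, hy]
    | tmul c x => simp

theorem readMap_legSnd_mul_legFst (z : Module.End ℂ T ⊗[ℂ] N₁) (w : Module.End ℂ T ⊗[ℂ] N₂)
    (t : T) :
    readMap T (N₁ ⊗[ℂ] N₂) (legSnd _ N₁ N₂ w * legFst _ N₁ N₂ z) t =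
      TensorProduct.assoc ℂ T N₁ N₂ (TensorProduct.rightComm ℂ T N₂ N₁
        ((readMap T N₂ w).rTensor N₁ (readMap T N₁ z t))) := by
  induction z with
  | zero => simp
  | add x y hx hy => simp only [map_add, mul_add, LinearMap.add_apply, hx, hy]
  | tmul b y =>
    induction w with
    | zero => simp
    | add x y hx hy => simp only [map_add, add_mul, LinearMap.add_apply, hx, hy,
        LinearMap.rTensor_add]
    | tmul c x => simp

variable [FiniteDimensional ℂ T]

theorem readMap_injective {N : Type*} [AddCommGroup N] [Module ℂ N] :
    Function.Injective (readMap T N) := by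
  intro z w h
  apply (rTensorHomEquivHomRTensor ℂ T T N).injective
  rw [rTensorHomEquivHomRTensor_apply, rTensorHomEquivHomRTensor_apply]
  exact h

/-- The element of `End T ⊗ N` that represents the map `c : T → T ⊗ N`. -/
def reading {N : Type*} [AddCommGroup N] [Module ℂ N] (c : T →ₗ[ℂ] T ⊗[ℂ] N) :
    Module.End ℂ T ⊗[ℂ] N :=
  (rTensorHomEquivHomRTensor ℂ T T N).symm c

@[simp]
theorem readMap_reading {N : Type*} [AddCommGroup N] [Module ℂ N] (c : T →ₗ[ℂ] T ⊗[ℂ] N) :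
    readMap T N (reading c) = c := by
  change TensorProduct.rTensorHomToHomRTensor (RingHom.id ℂ) T T N _ = c
  rw [← rTensorHomEquivHomRTensor_apply]
  exact LinearEquiv.apply_symm_apply _ _

theorem map_reading (f : N₁ →ₐ[ℂ] N₂) (c : T →ₗ[ℂ] T ⊗[ℂ] N₁) :
    Algebra.TensorProduct.map (AlgHom.id ℂ _) f (reading c) =
      reading (f.toLinearMap.lTensor T ∘ₗ c) := by
  apply readMap_injective
  ext t
  rw [readMap_map, readMap_reading, readMap_reading]
  rfl

theorem legsCommute_reading {c : T →ₗ[ℂ] T ⊗[ℂ] N₁} {d : T →ₗ[ℂ] T ⊗[ℂ] N₂}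
    (h : ∀ t, c.rTensor N₂ (d t) = TensorProduct.rightComm ℂ T N₂ N₁ (d.rTensor N₁ (c t))) :
    LegsCommute (reading c) (reading d) := by
  apply readMap_injective
  ext t
  rw [readMap_legFst_mul_legSnd, readMap_legSnd_mul_legFst, readMap_reading, readMap_reading, h]

/-- The reading that belongs to a counital and coassociative coaction. -/
theorem isCoaction_reading {H : Type*} [Ring H] [HopfAlgebra ℂ H] {c : T →ₗ[ℂ] T ⊗[ℂ] H}
    (h₀ : ∀ t, TensorProduct.rid ℂ T (counit.lTensor T (c t)) = t)
    (h₁ : ∀ t, comul.lTensor T (c t) = TensorProduct.assoc ℂ T H H (c.rTensor H (c t))) :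
    IsCoaction (reading c) := by
  constructor
  · have h2 : ∀ (z : Module.End ℂ T ⊗[ℂ] H) (t : T), evalDual _ H counit z t =
        TensorProduct.rid ℂ T (counit.lTensor T (readMap T H z t)) := by
      intro z t
      induction z with
      | zero => simp
      | tmul b y => simp
      | add x y hx hy => simp only [map_add, LinearMap.add_apply, hx, hy]
    ext t
    rw [h2, readMap_reading, h₀]
    rfl
  · apply readMap_injective
    ext t
    rw [readMap_legFst_mul_legSnd, readMap_map, readMap_reading, ← h₁]
    rfl

variable {H C : Type*} [Ring H] [HopfAlgebra ℂ H] [AddCommGroup C] [Module ℂ C] [Coalgebra ℂ C]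

/-- A reading that detects `Y`: `c (Y x t) = Y x₁ t₀ ⊗ g(x₂) t₁`, where `c t = t₀ ⊗ t₁`. -/
theorem convConst_reading_mul_convLeft {c : T →ₗ[ℂ] T ⊗[ℂ] H} {Y : C →ₗ[ℂ] Module.End ℂ T}
    {g : C →ₗ[ℂ] H}
    (h : ∀ x t, c (Y x t) = ∑ i ∈ (ℛ ℂ x).index, TensorProduct.map (Y ((ℛ ℂ x).left i))
      (LinearMap.mulLeft ℂ (g ((ℛ ℂ x).right i))) (c t)) :
    convConst C (reading c) * convLeft H (toConv Y) =
      convLeft H (toConv Y) * convRight _ (toConv g) * convConst C (reading c) := by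
  refine conv_ext fun x => readMap_injective ?_
  ext t
  rw [convConst_mul_apply, mul_convConst_apply, convLeft_apply, readMap_mul_tmul, readMap_reading,
    (ℛ ℂ x).convMul_apply, Finset.sum_mul, map_sum, LinearMap.sum_apply]
  simp only [convLeft_apply, convRight_apply, Algebra.TensorProduct.tmul_mul_tmul, mul_one,
    one_mul, readMap_tmul_mul, readMap_reading, LinearMap.mulRight_one, LinearMap.lTensor_id,
    LinearMap.id_apply]
  exact h x t

/-- A reading from which right multiplication by `g` removes `Y`. -/
theorem convConst_reading_mul_convRight_mul {c : T →ₗ[ℂ] T ⊗[ℂ] H} {Y : C →ₗ[ℂ] Module.End ℂ T}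
    {g : C →ₗ[ℂ] H}
    (h : ∀ x t, ∑ i ∈ (ℛ ℂ x).index, (LinearMap.mulRight ℂ (g ((ℛ ℂ x).left i))).lTensor T
      (c (Y ((ℛ ℂ x).right i) t)) = (Y x).rTensor H (c t)) :
    convConst C (reading c) * (convRight _ (toConv g) * convLeft H (toConv Y)) =
      convLeft H (toConv Y) * convConst C (reading c) := by
  refine conv_ext fun x => readMap_injective ?_
  ext t
  rw [convConst_mul_apply, mul_convConst_apply, convLeft_apply, readMap_tmul_mul, readMap_reading,
    (ℛ ℂ x).convMul_apply, Finset.mul_sum, map_sum, LinearMap.sum_apply]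
  simp only [convLeft_apply, convRight_apply, Algebra.TensorProduct.tmul_mul_tmul, mul_one,
    one_mul, readMap_mul_tmul, readMap_reading, LinearMap.mulLeft_one]
  exact h x t

/-- A reading that commutes with `x ↦ g x₁ ⊗ Y x₂`. -/
theorem commute_convConst_reading {c : T →ₗ[ℂ] T ⊗[ℂ] H} {Y : C →ₗ[ℂ] Module.End ℂ T}
    {g : C →ₗ[ℂ] H}
    (h : ∀ x t, ∑ i ∈ (ℛ ℂ x).index, (LinearMap.mulRight ℂ (g ((ℛ ℂ x).left i))).lTensor T
      (c (Y ((ℛ ℂ x).right i) t)) = ∑ i ∈ (ℛ ℂ x).index, TensorProduct.map (Y ((ℛ ℂ x).right i))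
      (LinearMap.mulLeft ℂ (g ((ℛ ℂ x).left i))) (c t)) :
    Commute (convConst C (reading c)) (convRight _ (toConv g) * convLeft H (toConv Y)) := by
  refine conv_ext fun x => readMap_injective ?_
  ext t
  rw [convConst_mul_apply, mul_convConst_apply,
    (ℛ ℂ x).convMul_apply, Finset.mul_sum, Finset.sum_mul, map_sum, map_sum, LinearMap.sum_apply,
    LinearMap.sum_apply]
  simp only [convLeft_apply, convRight_apply, Algebra.TensorProduct.tmul_mul_tmul, mul_one,
    one_mul, readMap_mul_tmul, readMap_tmul_mul, readMap_reading]
  exact h x t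

end Reading

section ConvMap

variable {B B' H C C' : Type*} [Ring B] [Algebra ℂ B] [Ring B'] [Algebra ℂ B']
  [Ring H] [Algebra ℂ H] [AddCommGroup C] [Module ℂ C] [Coalgebra ℂ C]
  [AddCommGroup C'] [Module ℂ C'] [Coalgebra ℂ C']

/-- Composition with an algebra morphism, as a morphism of convolution monoids. -/
def convMap (C : Type*) [AddCommGroup C] [Module ℂ C] [Coalgebra ℂ C] (f : B →ₐ[ℂ] B') :
    WithConv (C →ₗ[ℂ] B) →* WithConv (C →ₗ[ℂ] B') where
  toFun Y := toConv (f.toLinearMap ∘ₗ Y.ofConv)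
  map_one' := toConv_algHom_comp_one f
  map_mul' := toConv_algHom_comp_mul f

/-- Composition with a coalgebra morphism, as a morphism of convolution monoids. -/
def convComp (B : Type*) [Ring B] [Algebra ℂ B] (g : C' →ₗc[ℂ] C) :
    WithConv (C →ₗ[ℂ] B) →* WithConv (C' →ₗ[ℂ] B) where
  toFun Y := toConv (Y.ofConv ∘ₗ g.toLinearMap)
  map_one' := by
    refine conv_ext fun c => ?_
    change (1 : WithConv (C →ₗ[ℂ] B)) (g c) = _
    simp
  map_mul' Y Z := by rw [LinearMap.convMul_comp_coalgHom_distrib]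

theorem convMap_convConst (f : B →ₐ[ℂ] B') (b : B) :
    convMap C f (convConst C b) = convConst C (f b) := by
  refine conv_ext fun c => ?_
  change f (convConst C b c) = _
  rw [convConst_apply, map_smul, convConst_apply]

theorem convMap_map_convLeft (f : B →ₐ[ℂ] B') (Y : C →ₗ[ℂ] B) :
    convMap C (Algebra.TensorProduct.map f (AlgHom.id ℂ H)) (convLeft H (toConv Y)) =
      convLeft H (toConv (f.toLinearMap ∘ₗ Y)) := by
  refine conv_ext fun c => ?_
  change Algebra.TensorProduct.map f (AlgHom.id ℂ H) (Y c ⊗ₜ 1) = _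
  simp [convLeft_apply]

theorem convMap_map_convRight (f : B →ₐ[ℂ] B') (g : C →ₗ[ℂ] H) :
    convMap C (Algebra.TensorProduct.map f (AlgHom.id ℂ H)) (convRight B (toConv g)) =
      convRight B' (toConv g) := by
  refine conv_ext fun c => ?_
  change Algebra.TensorProduct.map f (AlgHom.id ℂ H) (1 ⊗ₜ g c) = _
  simp [convRight_apply]

theorem convComp_convConst (g : C' →ₗc[ℂ] C) (b : B) :
    convComp B g (convConst C b) = convConst C' b := by
  refine conv_ext fun c => ?_
  change convConst C b (g c) = _
  simp [convConst_apply]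

end ConvMap

/-! ### Identities in a crossed module -/

section Sums

variable {C D E H : Type*} [AddCommGroup C] [Module ℂ C] [Coalgebra ℂ C] [AddCommGroup D]
  [Module ℂ D] [AddCommGroup E] [Module ℂ E] [Ring H] [HopfAlgebra ℂ H]

theorem sum_comul_tmul_assoc (Φ : C →ₗ[ℂ] C →ₗ[ℂ] D) (Ψ : C →ₗ[ℂ] E) (c : C) :
    ∑ i ∈ (ℛ ℂ c).index, ∑ j ∈ (ℛ ℂ ((ℛ ℂ c).right i)).index,
      Ψ ((ℛ ℂ ((ℛ ℂ c).right i)).right j) ⊗ₜ[ℂ]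
        Φ ((ℛ ℂ c).left i) ((ℛ ℂ ((ℛ ℂ c).right i)).left j) =
    ∑ i ∈ (ℛ ℂ c).index, Ψ ((ℛ ℂ c).right i) ⊗ₜ[ℂ] ∑ j ∈ (ℛ ℂ ((ℛ ℂ c).left i)).index,
      Φ ((ℛ ℂ ((ℛ ℂ c).left i)).left j) ((ℛ ℂ ((ℛ ℂ c).left i)).right j) := by
  have h := sum_comul_assoc (LinearMap.mk₂ ℂ
    (fun p q => (TensorProduct.mk ℂ E D).flip (Φ p q) ∘ₗ Ψ)
    (by intros; ext; simp) (by intros; ext; simp) (by intros; ext; simp)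
    (by intros; ext; simp)) c
  simp only [LinearMap.mk₂_apply, LinearMap.comp_apply, LinearMap.flip_apply,
    TensorProduct.mk_apply] at h
  rw [← h]
  simp only [TensorProduct.tmul_sum]

/-- `c₃ ⊗ S(g c₂) (g c₁) = c ⊗ 1` for a morphism of coalgebras `g`, if `S² = 1`. -/
theorem sum_tmul_antipode_mul (hS : ∀ h : H, HopfAlgebra.antipode ℂ
    (HopfAlgebra.antipode ℂ h) = h) {g : C →ₗ[ℂ] H}
    (hg : ∀ c, comul (R := ℂ) (g c) = TensorProduct.map g g (comul (R := ℂ) c))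
    (hg' : ∀ c, counit (R := ℂ) (g c) = counit (R := ℂ) c) (c : C) :
    ∑ i ∈ (ℛ ℂ c).index, ∑ j ∈ (ℛ ℂ ((ℛ ℂ c).right i)).index,
      (ℛ ℂ ((ℛ ℂ c).right i)).right j ⊗ₜ[ℂ]
        (HopfAlgebra.antipode ℂ (g ((ℛ ℂ ((ℛ ℂ c).right i)).left j)) * g ((ℛ ℂ c).left i)) =
    c ⊗ₜ[ℂ] 1 := by
  have h := sum_comul_tmul_assoc ((LinearMap.mul ℂ H).flip.compl₁₂ g
    (HopfAlgebra.antipode ℂ ∘ₗ g)) LinearMap.id c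
  simp only [LinearMap.compl₁₂_apply, LinearMap.flip_apply, LinearMap.mul_apply',
    LinearMap.comp_apply, LinearMap.id_apply] at h
  rw [h]
  simp only [sum_antipode_comp_right_mul_left hS hg hg', TensorProduct.tmul_smul,
    TensorProduct.smul_tmul', ← TensorProduct.sum_tmul, sum_counit_smul]

end Sums

section TensorCoalgebra

variable {C D B : Type*} [AddCommGroup C] [Module ℂ C] [Coalgebra ℂ C] [AddCommGroup D]
  [Module ℂ D] [Coalgebra ℂ D] [Ring B] [Algebra ℂ B]

theorem comul_tmul_eq_sum (c : C) (d : D) :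
    comul (R := ℂ) (c ⊗ₜ[ℂ] d) = ∑ i ∈ (ℛ ℂ c).index, ∑ j ∈ (ℛ ℂ d).index,
      ((ℛ ℂ c).left i ⊗ₜ[ℂ] (ℛ ℂ d).left j) ⊗ₜ[ℂ] ((ℛ ℂ c).right i ⊗ₜ[ℂ] (ℛ ℂ d).right j) := by
  rw [TensorProduct.comul_tmul, ← (ℛ ℂ c).eq, ← (ℛ ℂ d).eq, TensorProduct.sum_tmul]
  simp only [TensorProduct.tmul_sum, map_sum]
  rfl

theorem convMul_tmul_apply (f g : WithConv (C ⊗[ℂ] D →ₗ[ℂ] B)) (c : C) (d : D) :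
    (f * g) (c ⊗ₜ d) = ∑ i ∈ (ℛ ℂ c).index, ∑ j ∈ (ℛ ℂ d).index,
      f ((ℛ ℂ c).left i ⊗ₜ[ℂ] (ℛ ℂ d).left j) * g ((ℛ ℂ c).right i ⊗ₜ[ℂ] (ℛ ℂ d).right j) := by
  rw [LinearMap.convMul_apply, comul_tmul_eq_sum]
  simp only [map_sum, TensorProduct.map_tmul, LinearMap.mul'_apply]

end TensorCoalgebra

namespace HopfCrossedModule

variable {A H : Type*} [Ring A] [HopfAlgebra ℂ A] [Ring H] [HopfAlgebra ℂ H]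
  (X : HopfCrossedModule A H)

open HopfAlgebra

theorem toCoalgHom_bd_apply (a : A) : X.bd.toCoalgHom a = X.bd a := rfl

theorem comul_bd (a : A) : comul (R := ℂ) (X.bd.toCoalgHom.toLinearMap a) =
    TensorProduct.map X.bd.toCoalgHom.toLinearMap X.bd.toCoalgHom.toLinearMap
      (comul (R := ℂ) a) :=
  (CoalgHomClass.map_comp_comul_apply X.bd.toCoalgHom a).symm

theorem counit_bd (a : A) :
    counit (R := ℂ) (X.bd.toCoalgHom.toLinearMap a) = counit (R := ℂ) a :=
  CoalgHomClass.counit_comp_apply X.bd.toCoalgHom a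

theorem bd_mul (a b : A) : X.bd.toCoalgHom.toLinearMap (a * b) =
    X.bd.toCoalgHom.toLinearMap a * X.bd.toCoalgHom.toLinearMap b :=
  map_mul X.bd a b

theorem bd_one : X.bd.toCoalgHom.toLinearMap 1 = 1 :=
  map_one X.bd

/-- `∂ S = S ∂`: both sides are convolution inverse to `∂`. -/
theorem bd_antipode (a : A) : X.bd.toCoalgHom.toLinearMap (antipode ℂ a) =
    antipode ℂ (X.bd.toCoalgHom.toLinearMap a) := by
  have h1 : convComp H X.bd.toCoalgHom (toConv (antipode ℂ)) *
      convComp H X.bd.toCoalgHom (toConv LinearMap.id) = 1 := by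
    rw [← map_mul, LinearMap.antipode_mul_id, map_one]
  have h2 : convMap A (X.bd : A →ₐ[ℂ] H) (toConv LinearMap.id) *
      convMap A (X.bd : A →ₐ[ℂ] H) (toConv (antipode ℂ)) = 1 := by
    rw [← map_mul, LinearMap.id_mul_antipode, map_one]
  exact (congrArg (fun f => f.ofConv a) (left_inv_eq_right_inv h1 h2)).symm

theorem act_mul_eq_sum (h : H) (a b : A) : X.act h (a * b) =
    ∑ i ∈ (ℛ ℂ h).index, X.act ((ℛ ℂ h).left i) a * X.act ((ℛ ℂ h).right i) b := by
  rw [X.act_mul, ← (ℛ ℂ h).eq]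
  simp

theorem comul_act_eq_sum (h : H) (a : A) : comul (R := ℂ) (X.act h a) =
    ∑ i ∈ (ℛ ℂ h).index, ∑ j ∈ (ℛ ℂ a).index, X.act ((ℛ ℂ h).left i) ((ℛ ℂ a).left j) ⊗ₜ[ℂ]
      X.act ((ℛ ℂ h).right i) ((ℛ ℂ a).right j) := by
  rw [X.comul_act, ← (ℛ ℂ h).eq, ← (ℛ ℂ a).eq]
  simp only [map_sum, LinearMap.sum_apply, TensorProduct.map₂_apply_tmul]
  rw [Finset.sum_comm]
  rfl

/-- `S(h ▷ a) = h ▷ S a`: both sides are convolution inverse to the action. -/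
theorem antipode_act (h : H) (a : A) : antipode ℂ (X.act h a) = X.act h (antipode ℂ a) := by
  let m : H ⊗[ℂ] A →ₗ[ℂ] A := TensorProduct.lift X.act.toLinearMap
  have h1 : toConv (antipode ℂ ∘ₗ m) * toConv m = 1 := by
    ext h a
    change (toConv (antipode ℂ ∘ₗ m) * toConv m) (h ⊗ₜ a) =
      (1 : WithConv (H ⊗[ℂ] A →ₗ[ℂ] A)) (h ⊗ₜ a)
    rw [convMul_tmul_apply, LinearMap.convOne_apply, TensorProduct.counit_tmul, smul_eq_mul,
      mul_comm, ← X.counit_act, ← LinearMap.convOne_apply, ← LinearMap.antipode_mul_id,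
      LinearMap.convMul_apply, comul_act_eq_sum]
    simp [m]
  have h2 : toConv m * toConv (m ∘ₗ (antipode ℂ).lTensor H) = 1 := by
    ext h a
    change (toConv m * toConv (m ∘ₗ (antipode ℂ).lTensor H)) (h ⊗ₜ a) =
      (1 : WithConv (H ⊗[ℂ] A →ₗ[ℂ] A)) (h ⊗ₜ a)
    rw [convMul_tmul_apply, LinearMap.convOne_apply, TensorProduct.counit_tmul, smul_eq_mul,
      Finset.sum_comm]
    simp only [m, TensorProduct.lift.tmul, LinearMap.coe_comp, Function.comp_apply,
      LinearMap.lTensor_tmul, AlgHom.toLinearMap_apply, ← X.act_mul_eq_sum]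
    rw [← map_sum, sum_mul_antipode_eq_smul, map_smul, X.act_one, smul_smul,
      Algebra.algebraMap_eq_smul_one]
  exact congrArg (fun f => f.ofConv (h ⊗ₜ a)) (left_inv_eq_right_inv h1 h2)

theorem toConv_bd_act (a : A) :
    toConv (X.bd.toCoalgHom.toLinearMap ∘ₗ X.act.toLinearMap.flip a) =
      toConv LinearMap.id * convConst H (X.bd a) * toConv (antipode ℂ : H →ₗ[ℂ] H) := by
  refine conv_ext fun h => ?_
  have h1 := X.peiffer_one h a
  rw [← (ℛ ℂ h).eq] at h1
  rw [(ℛ ℂ h).convMul_apply]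
  simp only [mul_convConst_apply]
  simp only [map_sum, TensorProduct.map_tmul, LinearMap.mul'_apply, LinearMap.mulRight_apply]
    at h1
  exact h1

/-- `∂(h₁ ▷ a) h₂ = h ∂a`. -/
theorem sum_bd_act_mul (h : H) (a : A) :
    ∑ i ∈ (ℛ ℂ h).index, X.bd (X.act ((ℛ ℂ h).left i) a) * (ℛ ℂ h).right i = h * X.bd a := by
  have h1 : toConv (X.bd.toCoalgHom.toLinearMap ∘ₗ X.act.toLinearMap.flip a) *
      toConv LinearMap.id = toConv LinearMap.id * convConst H (X.bd a) := by
    rw [toConv_bd_act, mul_assoc, LinearMap.antipode_mul_id, mul_one]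
  have h2 := congrArg (fun f => f.ofConv h) h1
  change (toConv (X.bd.toCoalgHom.toLinearMap ∘ₗ X.act.toLinearMap.flip a) *
    toConv LinearMap.id : WithConv (H →ₗ[ℂ] H)) h =
    ((toConv LinearMap.id : WithConv (H →ₗ[ℂ] H)) * convConst H (X.bd a)) h at h2
  rw [(ℛ ℂ h).convMul_apply, mul_convConst_apply] at h2
  exact h2

/-- `S∂(h₂ ▷ a) h₁ = h S∂a` -/
theorem sum_antipode_bd_act_mul [FiniteDimensional ℂ H] [IsSemisimpleRing H] (h : H) (a : A) :
    ∑ i ∈ (ℛ ℂ h).index, antipode ℂ (X.bd (X.act ((ℛ ℂ h).right i) a)) * (ℛ ℂ h).left i =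
      h * antipode ℂ (X.bd a) := by
  have h1 : toConv (antipode ℂ : H →ₗ[ℂ] H) *
      toConv (X.bd.toCoalgHom.toLinearMap ∘ₗ X.act.toLinearMap.flip a) =
      convConst H (X.bd a) * toConv (antipode ℂ) := by
    rw [toConv_bd_act, ← mul_assoc, ← mul_assoc, LinearMap.antipode_mul_id, one_mul]
  have h2 := congrArg (fun f => antipode ℂ (f.ofConv h)) h1
  change antipode ℂ ((toConv (antipode ℂ : H →ₗ[ℂ] H) * _) h) =
    antipode ℂ ((convConst H (X.bd a) * toConv (antipode ℂ : H →ₗ[ℂ] H)) h) at h2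
  rw [(ℛ ℂ h).convMul_apply, convConst_mul_apply] at h2
  simpa [antipode_mul_antidistrib, antipode_antipode, toCoalgHom_bd_apply] using h2

/-- `h₁ ⊗ (h₂ ▷ a) = h₂ ⊗ (h₁ ▷ a)` -/
theorem sum_tmul_act (h : H) (a : A) :
    ∑ i ∈ (ℛ ℂ h).index, (ℛ ℂ h).left i ⊗ₜ[ℂ] X.act ((ℛ ℂ h).right i) a =
      ∑ i ∈ (ℛ ℂ h).index, (ℛ ℂ h).right i ⊗ₜ[ℂ] X.act ((ℛ ℂ h).left i) a := by
  have h1 := X.yetterDrinfeld h a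
  rw [← (ℛ ℂ h).eq] at h1
  simpa using h1

/-- By the Yetter–Drinfeld condition, in a convolution product a factor depending on `h ▷ a` can be
moved past a factor whose values commute with it. -/
theorem commute_conv_comp_act {B : Type*} [Ring B] [Algebra ℂ B] (K : A →ₗ[ℂ] B) (a : A)
    (Y : H →ₗ[ℂ] B) (h : ∀ x y, Commute (Y x) (K y)) :
    Commute (toConv Y) (toConv (K ∘ₗ X.act.toLinearMap.flip a)) := by
  refine conv_ext fun x => ?_
  rw [(ℛ ℂ x).convMul_apply, (ℛ ℂ x).convMul_apply]
  have h1 := congrArg (LinearMap.mul' ℂ B ∘ₗ TensorProduct.map Y K) (X.sum_tmul_act x a)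
  simp only [map_sum, LinearMap.comp_apply, TensorProduct.map_tmul, LinearMap.mul'_apply] at h1
  simp only [LinearMap.comp_apply, LinearMap.flip_apply, AlgHom.toLinearMap_apply]
  rw [h1]
  exact Finset.sum_congr rfl fun i _ => (h _ _).eq

/-- The same for a factor that acts by `▷`. -/
theorem commute_conv_act {B : Type*} [Ring B] [Algebra ℂ B] [FiniteDimensional ℂ A]
    (f : Module.End ℂ A →ₗ[ℂ] B)
    (Y : H →ₗ[ℂ] B) (h : ∀ x y, Commute (Y x) (f (X.act y))) :
    Commute (toConv Y) (toConv (f ∘ₗ X.act.toLinearMap)) := by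
  refine conv_ext fun x => ?_
  rw [(ℛ ℂ x).convMul_apply, (ℛ ℂ x).convMul_apply]
  have h0 : ∑ i ∈ (ℛ ℂ x).index, (ℛ ℂ x).left i ⊗ₜ[ℂ] X.act ((ℛ ℂ x).right i) =
      ∑ i ∈ (ℛ ℂ x).index, (ℛ ℂ x).right i ⊗ₜ[ℂ] X.act ((ℛ ℂ x).left i) := by
    apply (lTensorHomEquivHomLTensor ℂ A H A).injective
    ext a
    simpa [lTensorHomEquivHomLTensor_apply] using X.sum_tmul_act x a
  have h1 := congrArg (LinearMap.mul' ℂ B ∘ₗ TensorProduct.map Y f) h0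
  simp only [map_sum, LinearMap.comp_apply, TensorProduct.map_tmul, LinearMap.mul'_apply] at h1
  simp only [LinearMap.comp_apply, AlgHom.toLinearMap_apply]
  rw [h1]
  exact Finset.sum_congr rfl fun i _ => (h _ _).eq

end HopfCrossedModule

/-! ### Relations on a single tensor factor -/

section Coactions

variable {C N N₁ N₂ : Type*} [AddCommGroup C] [Module ℂ C] [Coalgebra ℂ C]

/-- `c ↦ c₁ ⊗ f c₂` -/
def coactRight [AddCommGroup N] [Module ℂ N] (f : C →ₗ[ℂ] N) : C →ₗ[ℂ] C ⊗[ℂ] N :=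
  f.lTensor C ∘ₗ comul

/-- `c ↦ c₂ ⊗ f c₁` -/
def coactLeft [AddCommGroup N] [Module ℂ N] (f : C →ₗ[ℂ] N) : C →ₗ[ℂ] C ⊗[ℂ] N :=
  f.lTensor C ∘ₗ (TensorProduct.comm ℂ C C).toLinearMap ∘ₗ comul

theorem coactRight_eq_sum [AddCommGroup N] [Module ℂ N] (f : C →ₗ[ℂ] N) (c : C) :
    coactRight f c = ∑ i ∈ (ℛ ℂ c).index, (ℛ ℂ c).left i ⊗ₜ[ℂ] f ((ℛ ℂ c).right i) := by
  rw [coactRight, LinearMap.comp_apply, ← (ℛ ℂ c).eq]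
  simp

theorem coactLeft_eq_sum [AddCommGroup N] [Module ℂ N] (f : C →ₗ[ℂ] N) (c : C) :
    coactLeft f c = ∑ i ∈ (ℛ ℂ c).index, (ℛ ℂ c).right i ⊗ₜ[ℂ] f ((ℛ ℂ c).left i) := by
  rw [coactLeft, LinearMap.comp_apply, LinearMap.comp_apply, ← (ℛ ℂ c).eq]
  simp

variable [FiniteDimensional ℂ C]

/-- Left and right coactions commute. -/
theorem legsCommute_coactRight_coactLeft [Ring N₁] [Algebra ℂ N₁] [Ring N₂] [Algebra ℂ N₂]
    (f : C →ₗ[ℂ] N₁) (g : C →ₗ[ℂ] N₂) :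
    LegsCommute (reading (coactRight f)) (reading (coactLeft g)) := by
  refine legsCommute_reading fun t => ?_
  have h := sum_comul_assoc (LinearMap.mk₂ ℂ
    (fun p q => (TensorProduct.mk ℂ (C ⊗[ℂ] N₁) N₂).flip (g p) ∘ₗ TensorProduct.mk ℂ C N₁ q ∘ₗ f)
    (by intros; ext; simp) (by intros; ext; simp) (by intros; ext; simp)
    (by intros; ext; simp)) t
  simp only [LinearMap.mk₂_apply, LinearMap.comp_apply, LinearMap.flip_apply,
    TensorProduct.mk_apply] at h
  simp only [coactLeft_eq_sum g t, coactRight_eq_sum f t, map_sum, LinearMap.rTensor_tmul]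
  simp only [coactLeft_eq_sum, coactRight_eq_sum, TensorProduct.sum_tmul, map_sum]
  exact h.symm

theorem legsCommute_coactLeft_coactRight [Ring N₁] [Algebra ℂ N₁] [Ring N₂] [Algebra ℂ N₂]
    (f : C →ₗ[ℂ] N₁) (g : C →ₗ[ℂ] N₂) :
    LegsCommute (reading (coactLeft f)) (reading (coactRight g)) := by
  refine legsCommute_reading fun t => ?_
  have h := sum_comul_assoc (LinearMap.mk₂ ℂ
    (fun p q => TensorProduct.mk ℂ (C ⊗[ℂ] N₁) N₂ (q ⊗ₜ f p) ∘ₗ g)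
    (by intros; ext; simp [TensorProduct.tmul_add])
    (by intros; ext; simp)
    (by intros; ext; simp [TensorProduct.add_tmul])
    (by intros; ext; simp [← TensorProduct.smul_tmul'])) t
  simp only [LinearMap.mk₂_apply, LinearMap.comp_apply, TensorProduct.mk_apply] at h
  simp only [coactLeft_eq_sum f t, coactRight_eq_sum g t, map_sum, LinearMap.rTensor_tmul]
  simp only [coactLeft_eq_sum, coactRight_eq_sum, TensorProduct.sum_tmul, map_sum]
  exact h

variable {H : Type*} [Ring H] [HopfAlgebra ℂ H]

theorem isCoaction_coactRight {f : C →ₗ[ℂ] H}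
    (hf : ∀ c, comul (R := ℂ) (f c) = TensorProduct.map f f (comul (R := ℂ) c))
    (hf' : ∀ c, counit (R := ℂ) (f c) = counit (R := ℂ) c) :
    IsCoaction (reading (coactRight f)) := by
  refine isCoaction_reading (fun t => ?_) fun t => ?_
  · rw [coactRight_eq_sum]
    simp [hf']
  · have h := sum_comul_assoc (LinearMap.mk₂ ℂ
      (fun p q => TensorProduct.mk ℂ C (H ⊗[ℂ] H) p ∘ₗ TensorProduct.mk ℂ H H (f q) ∘ₗ f)
      (by intros; ext; simp)
      (by intros; ext; simp)
      (by intros; ext; simp [TensorProduct.tmul_add])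
      (by intros; ext; simp)) t
    simp only [LinearMap.mk₂_apply, LinearMap.comp_apply, TensorProduct.mk_apply] at h
    simp only [coactRight_eq_sum f t, map_sum, LinearMap.rTensor_tmul, LinearMap.lTensor_tmul, hf]
    simp only [coactRight_eq_sum, TensorProduct.sum_tmul, map_sum, TensorProduct.assoc_tmul]
    rw [h]
    refine Finset.sum_congr rfl fun i _ => ?_
    rw [← (ℛ ℂ ((ℛ ℂ t).right i)).eq]
    simp [TensorProduct.tmul_sum]

theorem isCoaction_coactLeft {f : C →ₗ[ℂ] H}
    (hf : ∀ c, comul (R := ℂ) (f c) =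
      TensorProduct.map f f (TensorProduct.comm ℂ C C (comul (R := ℂ) c)))
    (hf' : ∀ c, counit (R := ℂ) (f c) = counit (R := ℂ) c) :
    IsCoaction (reading (coactLeft f)) := by
  refine isCoaction_reading (fun t => ?_) fun t => ?_
  · rw [coactLeft_eq_sum]
    simpa [hf'] using sum_counit_smul (ℛ ℂ t)
  · have h := sum_comul_assoc (LinearMap.mk₂ ℂ
      (fun p q => (TensorProduct.mk ℂ C (H ⊗[ℂ] H)).flip (f q ⊗ₜ f p))
      (by intros; ext; simp [TensorProduct.tmul_add])
      (by intros; ext; simp)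
      (by intros; ext; simp [TensorProduct.add_tmul])
      (by intros; ext; simp [← TensorProduct.smul_tmul'])) t
    simp only [LinearMap.mk₂_apply, LinearMap.flip_apply, TensorProduct.mk_apply] at h
    simp only [coactLeft_eq_sum f t, map_sum, LinearMap.rTensor_tmul, LinearMap.lTensor_tmul, hf]
    simp only [coactLeft_eq_sum, TensorProduct.sum_tmul, map_sum, TensorProduct.assoc_tmul]
    rw [← h]
    refine Finset.sum_congr rfl fun i _ => ?_
    rw [← (ℛ ℂ ((ℛ ℂ t).left i)).eq]
    simp [TensorProduct.tmul_sum]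

end Coactions

theorem comul_mul_eq_sum {R : Type*} [Ring R] [Bialgebra ℂ R] (x y : R) :
    comul (R := ℂ) (x * y) = ∑ i ∈ (ℛ ℂ x).index, ∑ j ∈ (ℛ ℂ y).index,
      ((ℛ ℂ x).left i * (ℛ ℂ y).left j) ⊗ₜ[ℂ] ((ℛ ℂ x).right i * (ℛ ℂ y).right j) := by
  rw [Bialgebra.comul_mul, ← (ℛ ℂ x).eq, ← (ℛ ℂ y).eq, Finset.sum_mul_sum]
  simp

theorem isRep_algHom {R B : Type*} [Ring R] [Algebra ℂ R] [Ring B] [Algebra ℂ B]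
    (f : R →ₐ[ℂ] B) : IsRep f.toLinearMap :=
  ⟨map_one f, map_mul f⟩

theorem IsRep.comp {R B B' : Type*} [Ring R] [Algebra ℂ R] [Ring B] [Algebra ℂ B] [Ring B']
    [Algebra ℂ B'] {Y : R →ₗ[ℂ] B} (hY : IsRep Y) (f : B →ₐ[ℂ] B') :
    IsRep (f.toLinearMap ∘ₗ Y) :=
  ⟨by simp [hY.1], fun x y => by simp [hY.2]⟩

theorem isRep_mul (R : Type*) [Ring R] [Algebra ℂ R] : IsRep (LinearMap.mul ℂ R) :=
  isRep_algHom (Algebra.lmul ℂ R)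

theorem isRep_mul_flip_antipode (R : Type*) [Ring R] [HopfAlgebra ℂ R] :
    IsRep ((LinearMap.mul ℂ R).flip ∘ₗ HopfAlgebra.antipode ℂ) :=
  ⟨by ext; simp, fun x y => by ext; simp [HopfAlgebra.antipode_mul_antidistrib, mul_assoc]⟩

namespace HopfCrossedModule

open HopfAlgebra

variable {H : Type*} [Ring H] [HopfAlgebra ℂ H]

theorem edgeAct_true (h x : H) : edgeAct true h x = h * x := rfl

theorem readSigned_true : readSigned (H := H) true = coactRight LinearMap.id := by
  ext x
  simp [readSigned, coactRight, signed]

/-- The reading `v ↦ ((v^⟨θ⟩)₁)^⟨θ⟩ ⊗ (v^⟨θ⟩)₂` as an element of `End H ⊗ H`. -/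
def edgeReading (H : Type*) [Ring H] [HopfAlgebra ℂ H] [FiniteDimensional ℂ H] (θ : Bool) :
    Module.End ℂ H ⊗[ℂ] H :=
  reading (readSigned θ)

/-- The action `v ↦ h v` multiplies the reading `v₁ ⊗ v₂` from the left by `h`. -/
theorem edgeReading_mul_edgeAct [FiniteDimensional ℂ H] :
    convConst H (edgeReading H true) * convLeft H (toConv (edgeAct true)) =
      convLeft H (toConv (edgeAct true)) * convRight _ (toConv LinearMap.id) *
        convConst H (edgeReading H true) := by
  rw [edgeReading, readSigned_true]
  refine convConst_reading_mul_convLeft fun x t => ?_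
  simp only [coactRight, LinearMap.lTensor_id, LinearMap.id_comp, edgeAct_true, comul_mul_eq_sum,
    LinearMap.id_apply]
  refine Finset.sum_congr rfl fun i _ => ?_
  rw [← (ℛ ℂ t).eq]
  simp [edgeAct_true]

variable [FiniteDimensional ℂ H] [IsSemisimpleRing H]

theorem edgeAct_false (h x : H) : edgeAct false h x = x * antipode ℂ h := by
  change antipode ℂ (h * antipode ℂ x) = _
  rw [antipode_mul_antidistrib, antipode_antipode]

theorem isRep_edgeAct (θ : Bool) : IsRep (edgeAct (H := H) θ) := by
  cases θ
  · exact ⟨by ext; simp [edgeAct_false],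
      fun x y => by ext; simp [edgeAct_false, antipode_mul_antidistrib, mul_assoc]⟩
  · exact ⟨by ext; simp [edgeAct_true], fun x y => by ext; simp [edgeAct_true, mul_assoc]⟩

theorem readSigned_false : readSigned (H := H) false = coactLeft (antipode ℂ) := by
  ext x
  rw [coactLeft_eq_sum]
  simp only [readSigned, LinearMap.comp_apply]
  change (antipode ℂ).rTensor H (comul (R := ℂ) (antipode ℂ x)) = _
  rw [← sum_antipode_tmul_antipode]
  simp [antipode_antipode]

theorem isCoaction_edgeReading (θ : Bool) : IsCoaction (edgeReading H θ) := by
  cases θ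
  · rw [edgeReading, readSigned_false]
    exact isCoaction_coactLeft comul_antipode counit_antipode
  · rw [edgeReading, readSigned_true]
    exact isCoaction_coactRight (fun c => by simp) fun c => rfl

/-- The action at the end of an edge multiplies its reading from the right by `S h`, which is
cancelled by right multiplication with `h`. -/
theorem edgeReading_mul_edgeAct_not (θ : Bool) :
    convConst H (edgeReading H θ) *
        (convRight _ (toConv LinearMap.id) * convLeft H (toConv (edgeAct !θ))) =
      convLeft H (toConv (edgeAct !θ)) * convConst H (edgeReading H θ) := by
  have key := sum_tmul_antipode_mul (H := H) (antipode_antipode H) (g := LinearMap.id)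
    (fun c => by simp) (fun c => rfl)
  cases θ
  · rw [edgeReading, readSigned_false]
    refine convConst_reading_mul_convRight_mul fun x t => ?_
    have h1 : ∀ k, _ := fun k => congrArg (TensorProduct.map
      (LinearMap.mulRight ℂ ((ℛ ℂ t).right k))
      (LinearMap.mulLeft ℂ (antipode ℂ ((ℛ ℂ t).left k)))) (key x)
    simp only [map_sum, TensorProduct.map_tmul, LinearMap.mulRight_apply, LinearMap.mulLeft_apply,
      LinearMap.id_apply, mul_one] at h1
    rw [coactLeft_eq_sum _ t]
    simp only [coactLeft, LinearMap.comp_apply, Bool.not_false, edgeAct_true, comul_mul_eq_sum,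
      map_sum, LinearMap.id_apply, LinearEquiv.coe_coe, TensorProduct.comm_tmul,
      LinearMap.lTensor_tmul, LinearMap.rTensor_tmul, ← h1, LinearMap.mulRight_apply,
      antipode_mul_antidistrib, mul_assoc]
    rw [Finset.sum_comm (s := (ℛ ℂ t).index)]
    exact Finset.sum_congr rfl fun i _ => Finset.sum_comm
  · rw [edgeReading, readSigned_true]
    refine convConst_reading_mul_convRight_mul fun x t => ?_
    have h1 : ∀ k, _ := fun k => congrArg (TensorProduct.map
      (LinearMap.mulLeft ℂ ((ℛ ℂ t).left k) ∘ₗ antipode ℂ)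
      (LinearMap.mulLeft ℂ ((ℛ ℂ t).right k))) (key x)
    simp only [map_sum, TensorProduct.map_tmul, LinearMap.comp_apply, LinearMap.mulLeft_apply,
      LinearMap.id_apply, mul_one] at h1
    rw [coactRight_eq_sum _ t]
    simp only [coactRight, LinearMap.comp_apply, Bool.not_true, edgeAct_false, Bialgebra.comul_mul,
      map_sum, LinearMap.id_apply, LinearMap.lTensor_id,
      LinearMap.rTensor_tmul, ← h1]
    rw [Finset.sum_comm (s := (ℛ ℂ t).index)]
    refine Finset.sum_congr rfl fun i _ => ?_
    rw [← (ℛ ℂ t).eq, ← sum_antipode_tmul_antipode, Finset.sum_mul_sum]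
    simp [mul_assoc]

end HopfCrossedModule

namespace HopfCrossedModule

open HopfAlgebra

variable {A H : Type*} [Ring A] [HopfAlgebra ℂ A] [Ring H] [HopfAlgebra ℂ H]
  (X : HopfCrossedModule A H)

section EdgeReading

/-- The algebra morphism `β ⊗ x ↦ β ⊗ (x ▷ ·)`. -/
def actLeg (B : Type*) [Ring B] [Algebra ℂ B] : B ⊗[ℂ] H →ₐ[ℂ] B ⊗[ℂ] Module.End ℂ A :=
  Algebra.TensorProduct.map (AlgHom.id ℂ B) X.act

/-- By the Yetter–Drinfeld condition `v₁ ⊗ (v₂^⟨θ⟩ ▷ a) = v₂ ⊗ (v₁^⟨θ⟩ ▷ a)`. -/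
theorem lTensor_act_readSecond [FiniteDimensional ℂ H] [IsSemisimpleRing H] (θ : Bool) (a : A)
    (v : H) :
    (X.act.toLinearMap.flip a).lTensor H (readSecond θ v) =
      (X.act.toLinearMap.flip a).lTensor H (readFirst θ v) := by
  change (X.act.toLinearMap.flip a).lTensor H (coactRight (signed θ) v) =
    (X.act.toLinearMap.flip a).lTensor H (coactLeft (signed θ) v)
  rw [coactRight_eq_sum, coactLeft_eq_sum]
  simp only [map_sum, LinearMap.lTensor_tmul]
  cases θ
  · have h1 := X.yetterDrinfeld (antipode ℂ v) a
    rw [← sum_antipode_tmul_antipode] at h1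
    have h2 := congrArg ((antipode ℂ).rTensor A) h1
    simp only [map_sum, TensorProduct.map_tmul, TensorProduct.comm_tmul, LinearMap.rTensor_tmul,
      LinearMap.id_apply, antipode_antipode] at h2
    exact h2.symm
  · exact X.sum_tmul_act v a

variable [FiniteDimensional ℂ A] [FiniteDimensional ℂ H] [IsSemisimpleRing H]

/-- Once it is used to act on `A`, the first and the second part of the coproduct of `v` need not be
distinguished. -/
theorem map_act_reading_readSecond (θ : Bool) :
    X.actLeg (Module.End ℂ H) (reading (readSecond θ)) =
      X.actLeg (Module.End ℂ H) (reading (readFirst θ)) := by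
  rw [actLeg, map_reading, map_reading]
  congr 1
  ext v
  apply (lTensorHomEquivHomLTensor ℂ A H A).injective
  ext a
  have h1 : ∀ z : H ⊗[ℂ] H, lTensorHomEquivHomLTensor ℂ A H A (X.act.toLinearMap.lTensor H z) a =
      (X.act.toLinearMap.flip a).lTensor H z := by
    intro z
    rw [lTensorHomEquivHomLTensor_apply]
    induction z with
    | zero => simp
    | tmul x y => simp
    | add x y hx hy => simp only [map_add, LinearMap.add_apply, hx, hy]
  rw [LinearMap.comp_apply, LinearMap.comp_apply, h1, h1, lTensor_act_readSecond]

theorem map_act_reading_readFirst (θ : Bool) :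
    X.actLeg (Module.End ℂ H) (reading (readFirst θ)) =
      X.actLeg (Module.End ℂ H) (edgeReading H θ) := by
  cases θ
  · rw [edgeReading, readSigned_false]
    rfl
  · rw [← map_act_reading_readSecond, edgeReading, readSigned_true]
    rfl

/-- A reading on an edge commutes with every reading on this edge that is used to act on `A`. -/
theorem legsCommute_edgeReading_map_act (θ θ' : Bool) :
    LegsCommute (edgeReading H θ)
      (X.actLeg (Module.End ℂ H) (edgeReading H θ')) := by
  have h1 : X.act.toLinearMap.lTensor H ∘ₗ readSecond θ' =
      coactRight (X.act.toLinearMap ∘ₗ signed θ') := by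
    rw [coactRight, LinearMap.lTensor_comp]
    rfl
  have h2 : X.act.toLinearMap.lTensor H ∘ₗ readFirst θ' =
      coactLeft (X.act.toLinearMap ∘ₗ signed θ') := by
    rw [coactLeft, LinearMap.lTensor_comp]
    rfl
  cases θ
  · rw [← map_act_reading_readFirst, ← map_act_reading_readSecond, actLeg, map_reading,
      edgeReading, readSigned_false, h1]
    exact legsCommute_coactLeft_coactRight _ _
  · rw [← map_act_reading_readFirst, actLeg, map_reading, edgeReading, readSigned_true, h2]
    exact legsCommute_coactRight_coactLeft _ _

end EdgeReading

section Plaquette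

variable [FiniteDimensional ℂ A]

/-- The reading `x ↦ x₂ ⊗ S∂(x₁)` as an element of `End A ⊗ H`. -/
def plaqReading : Module.End ℂ A ⊗[ℂ] H :=
  reading (coactLeft (antipode ℂ ∘ₗ X.bd.toCoalgHom.toLinearMap))

theorem isCoaction_plaqReading : IsCoaction X.plaqReading := by
  refine isCoaction_coactLeft (fun c => ?_) fun c => ?_
  · rw [LinearMap.comp_apply, comul_antipode, comul_bd, ← (ℛ ℂ c).eq]
    simp
  · rw [LinearMap.comp_apply, counit_antipode, counit_bd]

/-- The element `S∂` read off a plaquette is conjugated by the action `x ↦ h ▷ x`. -/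
theorem commute_plaqReading_act [FiniteDimensional ℂ H] [IsSemisimpleRing H] :
    Commute (convConst H X.plaqReading)
      (convRight _ (toConv LinearMap.id) * convLeft H (toConv X.act.toLinearMap)) := by
  refine commute_convConst_reading fun x t => ?_
  have h1 : ∀ k, _ := fun k => sum_comul_tmul_assoc
    ((LinearMap.mul ℂ H).flip.compl₂ (antipode ℂ ∘ₗ X.bd.toCoalgHom.toLinearMap ∘ₗ
      X.act.toLinearMap.flip ((ℛ ℂ t).left k)))
    (X.act.toLinearMap.flip ((ℛ ℂ t).right k)) x
  have h2 : ∀ a, X.bd.toCoalgHom.toLinearMap a = X.bd a := fun _ => rfl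
  simp only [LinearMap.compl₂_apply, LinearMap.flip_apply, LinearMap.mul_apply',
    LinearMap.comp_apply, AlgHom.toLinearMap_apply, h2, sum_antipode_bd_act_mul] at h1
  rw [coactLeft_eq_sum _ t]
  simp only [coactLeft, LinearMap.comp_apply, comul_act_eq_sum, AlgHom.toLinearMap_apply,
    map_sum, LinearMap.id_apply, LinearEquiv.coe_coe, TensorProduct.comm_tmul,
    LinearMap.lTensor_tmul, TensorProduct.map_tmul, LinearMap.mulRight_apply,
    LinearMap.mulLeft_apply, h2]
  trans ∑ k ∈ (ℛ ℂ t).index, ∑ i ∈ (ℛ ℂ x).index,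
    X.act ((ℛ ℂ x).right i) ((ℛ ℂ t).right k) ⊗ₜ[ℂ]
      ((ℛ ℂ x).left i * antipode ℂ (X.bd ((ℛ ℂ t).left k)))
  · rw [Finset.sum_congr rfl fun k _ => (h1 k).symm, Finset.sum_comm (s := (ℛ ℂ t).index)]
    exact Finset.sum_congr rfl fun i _ => Finset.sum_comm
  · exact Finset.sum_comm

/-- Left multiplication by `a` on a plaquette multiplies its reading from the right by `S∂a`, which
is cancelled by right multiplication with `∂a`. -/
theorem plaqReading_mul_mul [FiniteDimensional ℂ H] [IsSemisimpleRing H] :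
    convConst A X.plaqReading * (convRight _ (toConv X.bd.toCoalgHom.toLinearMap) *
        convLeft H (toConv (LinearMap.mul ℂ A))) =
      convLeft H (toConv (LinearMap.mul ℂ A)) * convConst A X.plaqReading := by
  have key := sum_tmul_antipode_mul (antipode_antipode H) X.comul_bd X.counit_bd
  refine convConst_reading_mul_convRight_mul fun x t => ?_
  have h1 : ∀ k, _ := fun k => congrArg (TensorProduct.map
    (LinearMap.mulRight ℂ ((ℛ ℂ t).right k))
    (LinearMap.mulLeft ℂ (antipode ℂ (X.bd.toCoalgHom.toLinearMap ((ℛ ℂ t).left k))))) (key x)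
  simp only [map_sum, TensorProduct.map_tmul, LinearMap.mulRight_apply, LinearMap.mulLeft_apply,
    mul_one] at h1
  rw [coactLeft_eq_sum _ t]
  simp only [coactLeft, LinearMap.comp_apply, comul_mul_eq_sum, LinearMap.mul_apply',
    map_sum, LinearEquiv.coe_coe, TensorProduct.comm_tmul, bd_mul,
    LinearMap.lTensor_tmul, LinearMap.rTensor_tmul, ← h1, LinearMap.mulRight_apply,
    antipode_mul_antidistrib, mul_assoc]
  rw [Finset.sum_comm (s := (ℛ ℂ t).index)]
  exact Finset.sum_congr rfl fun i _ => Finset.sum_comm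

/-- Right multiplication by `S a` on a plaquette multiplies its reading from the left by `∂a`. -/
theorem plaqReading_mul_mul_flip [FiniteDimensional ℂ H] [IsSemisimpleRing H] :
    convConst A X.plaqReading *
        convLeft H (toConv ((LinearMap.mul ℂ A).flip ∘ₗ antipode ℂ)) =
      convLeft H (toConv ((LinearMap.mul ℂ A).flip ∘ₗ antipode ℂ)) *
        convRight _ (toConv X.bd.toCoalgHom.toLinearMap) * convConst A X.plaqReading := by
  refine convConst_reading_mul_convLeft fun x t => ?_
  rw [coactLeft_eq_sum _ t]
  simp only [coactLeft, LinearMap.comp_apply, LinearMap.flip_apply, LinearMap.mul_apply',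
    Bialgebra.comul_mul]
  rw [← sum_antipode_tmul_antipode, ← (ℛ ℂ t).eq, Finset.sum_mul_sum]
  simp only [Algebra.TensorProduct.tmul_mul_tmul, map_sum, LinearEquiv.coe_coe,
    TensorProduct.comm_tmul, LinearMap.lTensor_tmul, TensorProduct.map_tmul, LinearMap.comp_apply,
    LinearMap.flip_apply, LinearMap.mul_apply', LinearMap.mulLeft_apply, bd_mul, bd_antipode,
    antipode_mul_antidistrib, antipode_antipode]
  exact Finset.sum_comm

end Plaquette

/-- `h ▷ (a x) = (h₁ ▷ a) (h₂ ▷ x)` -/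
theorem act_mul_convConst_mul (a : A) :
    toConv X.act.toLinearMap * convConst H (LinearMap.mul ℂ A a) =
      toConv (LinearMap.mul ℂ A ∘ₗ X.act.toLinearMap.flip a) * toConv X.act.toLinearMap := by
  refine conv_ext fun h => LinearMap.ext fun x => ?_
  rw [mul_convConst_apply, (ℛ ℂ h).convMul_apply, LinearMap.sum_apply]
  exact X.act_mul_eq_sum h a x

/-- `h ▷ (x S a) = (h₂ ▷ x) S(h₁ ▷ a)`, by the Yetter–Drinfeld condition. -/
theorem act_mul_convConst_mul_flip (a : A) :
    toConv X.act.toLinearMap *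
        convConst H (((LinearMap.mul ℂ A).flip ∘ₗ antipode ℂ) a) =
      toConv (((LinearMap.mul ℂ A).flip ∘ₗ antipode ℂ) ∘ₗ X.act.toLinearMap.flip a) *
        toConv X.act.toLinearMap := by
  refine conv_ext fun h => LinearMap.ext fun x => ?_
  have h1 := congrArg (TensorProduct.lift (LinearMap.mul ℂ A ∘ₗ X.act.toLinearMap.flip x))
    (X.sum_tmul_act h (antipode ℂ a))
  simp only [map_sum, TensorProduct.lift.tmul, LinearMap.comp_apply, LinearMap.flip_apply,
    LinearMap.mul_apply', AlgHom.toLinearMap_apply] at h1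
  rw [mul_convConst_apply, (ℛ ℂ h).convMul_apply, LinearMap.sum_apply]
  simp only [LinearMap.comp_apply, LinearMap.flip_apply, Module.End.mul_apply,
    AlgHom.toLinearMap_apply, LinearMap.mul_apply', antipode_act, ← h1]
  exact X.act_mul_eq_sum h x (antipode ℂ a)

/-- `h ∂a v = ∂(h₁ ▷ a) h₂ v` -/
theorem edgeAct_mul_convConst (a : A) :
    toConv (edgeAct (H := H) true) * convConst H ((LinearMap.mul ℂ H ∘ₗ
        X.bd.toCoalgHom.toLinearMap) a) =
      toConv ((LinearMap.mul ℂ H ∘ₗ X.bd.toCoalgHom.toLinearMap) ∘ₗ X.act.toLinearMap.flip a) *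
        toConv (edgeAct true) := by
  refine conv_ext fun h => LinearMap.ext fun x => ?_
  have h1 := congrArg (· * x) (X.sum_bd_act_mul h a)
  rw [mul_convConst_apply, (ℛ ℂ h).convMul_apply, LinearMap.sum_apply]
  simp only [Finset.sum_mul, mul_assoc] at h1
  exact h1.symm

end HopfCrossedModule

/-! ### Operators and readings on the state space -/

section SlotAlgebra

variable {ι M N : Type*} [DecidableEq ι] [AddCommGroup M] [Module ℂ M]
  [AddCommGroup N] [Module ℂ N]

theorem slotRead_tprod (i : ι) (c : M →ₗ[ℂ] M ⊗[ℂ] N) (m : ι → M) :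
    slotRead i c (PiTensorProduct.tprod ℂ m) =
      ((PiTensorProduct.tprod ℂ (s := fun _ : ι => M)).toLinearMap m i).rTensor N (c (m i)) := by
  rw [slotRead, PiTensorProduct.lift.tprod]
  rfl

variable [Fintype ι]

theorem slotMap_eq_map (i : ι) (f : Module.End ℂ M) :
    slotMap i f = PiTensorProduct.map (Function.update (fun _ => LinearMap.id) i f) := rfl

theorem slotMap_one (i : ι) : slotMap i (1 : Module.End ℂ M) = 1 := by
  rw [slotMap_eq_map]
  convert PiTensorProduct.map_one (R := ℂ) (s := fun _ : ι => M) using 2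
  exact Function.update_eq_self i (fun _ => (LinearMap.id : M →ₗ[ℂ] M))

theorem slotMap_mul (i : ι) (f g : Module.End ℂ M) :
    slotMap i (f * g) = slotMap i f * slotMap i g := by
  rw [slotMap_eq_map, slotMap_eq_map, slotMap_eq_map, ← PiTensorProduct.map_mul]
  congr 1
  funext j
  by_cases h : j = i
  · subst h
    simp
  · simp only [Function.update_of_ne h]
    rfl

theorem slotMap_commute {i j : ι} (h : i ≠ j) (f g : Module.End ℂ M) :
    Commute (slotMap i f) (slotMap j g) := by
  rw [commute_iff_eq, slotMap_eq_map, slotMap_eq_map, ← PiTensorProduct.map_mul,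
    ← PiTensorProduct.map_mul]
  congr 1
  funext k
  by_cases hi : k = i
  · subst hi
    rw [Function.update_self, Function.update_of_ne h]
    rfl
  · rw [Function.update_of_ne hi]
    rfl

theorem slotMap_tprod (i : ι) (f : Module.End ℂ M) (m : ι → M) :
    slotMap i f (PiTensorProduct.tprod ℂ m) =
      PiTensorProduct.tprod ℂ (Function.update m i (f (m i))) := by
  rw [slotMap_eq_map, PiTensorProduct.map_tprod]
  congr 1
  funext j
  by_cases h : j = i
  · subst h
    simp
  · simp [Function.update_of_ne h]

theorem slotRead_readMap (i : ι) (z : Module.End ℂ M ⊗[ℂ] N) :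
    slotRead i (readMap M N z) = readMap _ N ((slotMap i).rTensor N z) := by
  ext m
  simp only [LinearMap.compMultilinearMap_apply, slotRead_tprod]
  induction z with
  | zero => simp
  | tmul β x => simp [slotMap_tprod]
  | add x y hx hy => simp only [map_add, LinearMap.add_apply, hx, hy]

end SlotAlgebra

section StateSpace

variable {L1 L2 A H : Type*} [Fintype L1] [DecidableEq L1] [Fintype L2] [DecidableEq L2]
  [Ring A] [HopfAlgebra ℂ A] [Ring H] [HopfAlgebra ℂ H]

/-- `onEdge` as a morphism of algebras. -/
def onEdgeHom (L2 A : Type*) [Ring A] [HopfAlgebra ℂ A] (e : L1) :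
    Module.End ℂ H →ₐ[ℂ] Module.End ℂ (StateSpace L1 L2 A H) :=
  AlgHom.ofLinearMap (onEdge L2 A e)
    (by
      change (slotMap e (1 : Module.End ℂ H)).rTensor _ = _
      rw [slotMap_one]
      exact LinearMap.rTensor_id _ _)
    (fun f g => by
      change (slotMap e (f * g)).rTensor _ = _
      rw [slotMap_mul]
      exact LinearMap.rTensor_mul _ _ _)

/-- `onPlaq` as a morphism of algebras. -/
def onPlaqHom (L1 H : Type*) [Ring H] [HopfAlgebra ℂ H] (p : L2) :
    Module.End ℂ A →ₐ[ℂ] Module.End ℂ (StateSpace L1 L2 A H) :=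
  AlgHom.ofLinearMap (onPlaq L1 H p)
    (by
      change (slotMap p (1 : Module.End ℂ A)).lTensor _ = _
      rw [slotMap_one]
      exact LinearMap.lTensor_id _ _)
    (fun f g => by
      change (slotMap p (f * g)).lTensor _ = _
      rw [slotMap_mul]
      exact LinearMap.lTensor_mul _ _ _)

theorem onEdgeHom_commute {e e' : L1} (h : e ≠ e') (f g : Module.End ℂ H) :
    Commute (onEdgeHom L2 A e f) (onEdgeHom L2 A e' g) := by
  change (slotMap e f).rTensor _ * (slotMap e' g).rTensor _ = _
  rw [← LinearMap.rTensor_mul, (slotMap_commute h f g).eq, LinearMap.rTensor_mul]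
  rfl

theorem onPlaqHom_commute {p q : L2} (h : p ≠ q) (f g : Module.End ℂ A) :
    Commute (onPlaqHom L1 H p f) (onPlaqHom L1 H q g) := by
  change (slotMap p f).lTensor _ * (slotMap q g).lTensor _ = _
  rw [← LinearMap.lTensor_mul, (slotMap_commute h f g).eq, LinearMap.lTensor_mul]
  rfl

theorem onEdgeHom_commute_onPlaqHom (e : L1) (p : L2) (f : Module.End ℂ H) (g : Module.End ℂ A) :
    Commute (onEdgeHom L2 A e f) (onPlaqHom L1 H p g) := by
  change (slotMap e f).rTensor _ ∘ₗ (slotMap p g).lTensor _ =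
    (slotMap p g).lTensor _ ∘ₗ (slotMap e f).rTensor _
  rw [LinearMap.rTensor_comp_lTensor, LinearMap.lTensor_comp_rTensor]

theorem readEdge_readMap (e : L1) (z : Module.End ℂ H ⊗[ℂ] H) :
    readEdge L2 A e (readMap H H z) =
      readMap _ H (Algebra.TensorProduct.map (onEdgeHom L2 A e) (AlgHom.id ℂ H) z) := by
  rw [readEdge, slotRead_readMap]
  ext m x
  induction z with
  | zero => simp
  | tmul β y => rfl
  | add z w hz hw =>
    simp only [map_add, LinearMap.add_apply, LinearMap.rTensor_add, LinearMap.comp_add,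
      LinearMap.compMultilinearMap_apply, TensorProduct.AlgebraTensorModule.curry_apply,
      TensorProduct.curry_apply, LinearMap.restrictScalars_self] at hz hw ⊢
    rw [hz, hw]

theorem readPlaq_readMap (p : L2) (z : Module.End ℂ A ⊗[ℂ] H) :
    readPlaq L1 p (readMap A H z) =
      readMap _ H (Algebra.TensorProduct.map (onPlaqHom L1 H p) (AlgHom.id ℂ H) z) := by
  rw [readPlaq, slotRead_readMap]
  ext m x
  induction z with
  | zero => simp
  | tmul β y => rfl
  | add z w hz hw =>
    simp only [map_add, LinearMap.add_apply, LinearMap.lTensor_add, LinearMap.comp_add,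
      LinearMap.compMultilinearMap_apply, TensorProduct.AlgebraTensorModule.curry_apply,
      TensorProduct.curry_apply, LinearMap.restrictScalars_self] at hz hw ⊢
    rw [hz, hw]

theorem readProd_readMap {T : Type*} [AddCommGroup T] [Module ℂ T]
    (l : List (Module.End ℂ T ⊗[ℂ] H)) :
    readProd (l.map (readMap T H)) = readMap T H l.prod := by
  induction l with
  | nil => rfl
  | cons z l ih =>
    rw [List.map_cons, readProd, ih, List.prod_cons]
    generalize l.prod = w
    ext t
    induction w with
    | zero => simp
    | add x y hx hy => simp only [map_add, mul_add, LinearMap.add_apply, LinearMap.comp_add, hx, hy]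
    | tmul c y =>
      induction z with
      | zero => simp
      | add x y hx hy =>
        simp only [map_add, add_mul, LinearMap.add_apply, LinearMap.rTensor_add,
          LinearMap.comp_add, LinearMap.add_comp, hx, hy]
      | tmul b x => simp

theorem HopfCrossedModule.readAct_readMap (X : HopfCrossedModule A H) {T : Type*} [AddCommGroup T]
    [Module ℂ T] (K : A →ₗ[ℂ] Module.End ℂ T) (z : Module.End ℂ T ⊗[ℂ] H) :
    X.readAct K (readMap T H z) = transport K (X.actLeg _ z) := by
  ext a t
  change TensorProduct.lift (K ∘ₗ X.act.toLinearMap.flip a).flip (readMap T H z t) = _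
  induction z with
  | zero => simp
  | add x y hx hy => simp only [map_add, LinearMap.add_apply, hx, hy]
  | tmul b x => simp [HopfCrossedModule.actLeg]

/-- The reading of the dart `d`, as an element of `End(state space) ⊗ H`. -/
def dartReading (L2 A : Type*) [Ring A] [HopfAlgebra ℂ A] [FiniteDimensional ℂ H] (d : L1 × Bool) :
    Module.End ℂ (StateSpace L1 L2 A H) ⊗[ℂ] H :=
  Algebra.TensorProduct.map (onEdgeHom L2 A d.1) (AlgHom.id ℂ H)
    (HopfCrossedModule.edgeReading H d.2)

namespace HopfCrossedModule

variable {L0 : Type*} (X : HopfCrossedModule A H) (L : CellDecomposition L0 L1 L2)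

/-- The plaquette operators are the evaluations of the product of the readings on the boundary and
on the plaquette. -/
theorem plaqOp_eq [FiniteDimensional ℂ H] [FiniteDimensional ℂ A] (p : L2)
    (φ : Module.Dual ℂ H) :
    X.plaqOp L p φ = evalDual _ H φ (((L.boundary p).map (dartReading L2 A)).prod *
      Algebra.TensorProduct.map (onPlaqHom L1 H p) (AlgHom.id ℂ H) X.plaqReading) := by
  have h : X.holonomy L p = readMap _ H (((L.boundary p).map (dartReading L2 A)).prod *
      Algebra.TensorProduct.map (onPlaqHom L1 H p) (AlgHom.id ℂ H) X.plaqReading) := by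
    rw [holonomy, ← List.prod_singleton (x := Algebra.TensorProduct.map (onPlaqHom L1 H p) _ _),
      ← List.prod_append, ← readProd_readMap, List.map_append, List.map_map, List.map_singleton,
      ← readPlaq_readMap, plaqReading, readMap_reading]
    congr 2
    refine List.map_congr_left fun d _ => ?_
    rw [Function.comp_apply, dartReading, ← readEdge_readMap, edgeReading, readMap_reading]
  have h1 : ∀ z : Module.End ℂ (StateSpace L1 L2 A H) ⊗[ℂ] H,
      (TensorProduct.rid ℂ _).toLinearMap ∘ₗ φ.lTensor _ ∘ₗ readMap _ H z = evalDual _ H φ z := by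
    intro z
    refine LinearMap.ext fun t => ?_
    induction z with
    | zero => simp
    | add x y hx hy => simp only [map_add, LinearMap.add_apply, LinearMap.comp_add, hx, hy]
    | tmul b x => simp
  change (TensorProduct.rid ℂ _).toLinearMap ∘ₗ φ.lTensor _ ∘ₗ X.holonomy L p = _
  rw [h, h1]

theorem actLeg_map {B B' : Type*} [Ring B] [Algebra ℂ B] [Ring B'] [Algebra ℂ B'] (f : B →ₐ[ℂ] B')
    (z : B ⊗[ℂ] H) : X.actLeg B' (Algebra.TensorProduct.map f (AlgHom.id ℂ H) z) =
      Algebra.TensorProduct.map f (AlgHom.id ℂ _) (X.actLeg B z) := by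
  induction z with
  | zero => simp
  | add x y hx hy => simp only [map_add, hx, hy]
  | tmul b x => simp [actLeg]

theorem actLeg_list_prod_congr {B ι : Type*} [Ring B] [Algebra ℂ B] {l : List ι}
    {f g : ι → B ⊗[ℂ] H} (h : ∀ d ∈ l, X.actLeg B (f d) = X.actLeg B (g d)) :
    X.actLeg B (l.map f).prod = X.actLeg B (l.map g).prod := by
  induction l with
  | nil => rfl
  | cons d l ih =>
    rw [List.map_cons, List.map_cons, List.prod_cons, List.prod_cons, map_mul, map_mul,
      h d (by simp), ih fun d hd => h d (by simp [hd])]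

theorem transport_actLeg_comp_antipode {B : Type*} [Ring B] [Algebra ℂ B] (K : A →ₗ[ℂ] B)
    (z : B ⊗[ℂ] H) : transport K (X.actLeg B z) ∘ₗ HopfAlgebra.antipode ℂ =
      transport (K ∘ₗ HopfAlgebra.antipode ℂ) (X.actLeg B z) := by
  refine LinearMap.ext fun a => ?_
  rw [LinearMap.comp_apply]
  induction z with
  | zero => simp
  | add x y hx hy => simp only [map_add, LinearMap.add_apply, hx, hy]
  | tmul b x => simp [actLeg, antipode_act]

variable [FiniteDimensional ℂ H] [IsSemisimpleRing H] [FiniteDimensional ℂ A]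

theorem edgeOpLeft_eq (e : L1) :
    X.edgeOpLeft L e =
      transport ((onPlaqHom L1 H (L.left (e, true))).toLinearMap ∘ₗ LinearMap.mul ℂ A)
        (X.actLeg (Module.End ℂ (StateSpace L1 L2 A H))
          ((L.leftPath e).map (dartReading L2 A)).prod) := by
  have h : (L.leftPath e).map (fun d => readEdge L2 A d.1 (readSecond (H := H) d.2)) =
      ((L.leftPath e).map fun d => Algebra.TensorProduct.map (onEdgeHom L2 A d.1) (AlgHom.id ℂ H)
        (reading (readSecond (H := H) d.2))).map (readMap _ H) := by
    rw [List.map_map]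
    refine List.map_congr_left fun d _ => ?_
    rw [Function.comp_apply, ← readEdge_readMap, readMap_reading]
  rw [edgeOpLeft, h, readProd_readMap, readAct_readMap]
  refine congrArg (transport (B := Module.End ℂ (StateSpace L1 L2 A H)) _)
    (X.actLeg_list_prod_congr fun d _ => ?_)
  rw [dartReading, actLeg_map, actLeg_map, map_act_reading_readSecond, map_act_reading_readFirst]

theorem edgeOpRight_eq (e : L1) :
    X.edgeOpRight L e = transport ((onPlaqHom L1 H (L.left (e, false))).toLinearMap ∘ₗ
        (LinearMap.mul ℂ A).flip ∘ₗ HopfAlgebra.antipode ℂ)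
      (X.actLeg (Module.End ℂ (StateSpace L1 L2 A H))
        ((L.rightPath e).map (dartReading L2 A)).prod) := by
  have h : (L.rightPath e).map (fun d => readEdge L2 A d.1 (readFirst (H := H) d.2)) =
      ((L.rightPath e).map fun d => Algebra.TensorProduct.map (onEdgeHom L2 A d.1) (AlgHom.id ℂ H)
        (reading (readFirst (H := H) d.2))).map (readMap _ H) := by
    rw [List.map_map]
    refine List.map_congr_left fun d _ => ?_
    rw [Function.comp_apply, ← readEdge_readMap, readMap_reading]
  rw [edgeOpRight, h, readProd_readMap, readAct_readMap]
  refine (X.transport_actLeg_comp_antipode (B := Module.End ℂ (StateSpace L1 L2 A H)) _ _).trans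
    (congrArg (transport (B := Module.End ℂ (StateSpace L1 L2 A H)) _)
      (X.actLeg_list_prod_congr fun d _ => ?_))
  rw [dartReading, actLeg_map, actLeg_map, map_act_reading_readFirst]

end HopfCrossedModule

end StateSpace

/-! ### Boundaries, stars and paths -/

section PermList

variable {α : Type*} [Fintype α] [DecidableEq α]

/-- The list of a nontrivial cycle starting at `x` ends at the preimage of `x`. -/
theorem exists_toList_eq {f : Equiv.Perm α} {x : α} (hx : f x ≠ x) :
    ∃ m y, f.toList x = x :: (m ++ [y]) ∧ f y = x := by
  have hs : x ∈ f.support := Equiv.Perm.mem_support.2 hx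
  have h2 := Equiv.Perm.two_le_length_toList_iff_mem_support.2 hs
  obtain ⟨a, l, hl⟩ : ∃ a l, f.toList x = a :: l :=
    List.exists_cons_of_ne_nil (by intro h; simp [h] at h2)
  have ha : a = x := by
    have h := Equiv.Perm.toList_getElem_zero (p := f) x hs
    simpa [hl] using h
  obtain ⟨m, y, hm⟩ : ∃ m y, l = m ++ [y] := by
    rcases List.eq_nil_or_concat l with h | ⟨m, y, h⟩
    · simp [hl, h] at h2
    · exact ⟨m, y, by simpa using h⟩
  subst ha hm
  refine ⟨m, y, hl, ?_⟩
  have h3 : f.toList a = (a :: m) ++ [y] := by simp [hl]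
  have hlen : (f.toList a).length = m.length + 2 := by simp [hl]
  have h4 : (f.toList a)[m.length + 1]'(by omega) = y := by simp [h3]
  rw [Equiv.Perm.getElem_toList] at h4
  rw [← h4, ← Equiv.Perm.mul_apply, ← pow_succ']
  rw [Equiv.Perm.length_toList] at hlen
  rw [show m.length + 1 + 1 = m.length + 2 from rfl, ← hlen, ← Equiv.Perm.cycleOf_pow_apply_self,
    ← (Equiv.Perm.isCycle_cycleOf f hx).orderOf, pow_orderOf_eq_one]
  rfl

theorem apply_eq_of_toList_eq {f : Equiv.Perm α} {x y z : α} {l m : List α}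
    (h : f.toList x = l ++ y :: z :: m) : z = f y := by
  have hlen : (f.toList x).length = l.length + (m.length + 2) := by simp [h]
  have h1 : (f.toList x)[l.length]'(by omega) = y := by simp [h]
  have h2 : (f.toList x)[l.length + 1]'(by omega) = z := by simp [h]
  rw [Equiv.Perm.getElem_toList] at h1 h2
  rw [← h1, ← h2, pow_succ']
  rfl

end PermList

namespace CellDecomposition

variable {L0 L1 L2 : Type*} (L : CellDecomposition L0 L1 L2)

theorem src_face (d : L1 × Bool) : L.src (L.face d) = L.src (d.1, !d.2) :=
  (L.src_eq_iff _ _).2 ⟨1, by simpa using L.rot_face d⟩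

theorem left_face (d : L1 × Bool) : L.left (L.face d) = L.left d :=
  ((L.left_eq_iff _ _).2 ⟨1, by simp⟩).symm

theorem src_not_ne (d : L1 × Bool) : L.src (d.1, !d.2) ≠ L.src d := by
  obtain ⟨e, θ⟩ := d
  cases θ
  · exact L.no_loop e
  · exact (L.no_loop e).symm

theorem face_ne (d : L1 × Bool) : L.face d ≠ d := by
  intro h
  have h1 := L.src_face d
  rw [h] at h1
  exact L.src_not_ne d h1.symm

/-- The two sides of an edge belong to different plaquettes: otherwise regularity would make the
head of the edge a univalent vertex. -/
theorem left_not_ne (d : L1 × Bool) : L.left (d.1, !d.2) ≠ L.left d := by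
  intro h
  have h1 : L.face d = (d.1, !d.2) :=
    L.regular _ _ (by rw [left_face, h]) (L.src_face d)
  exact L.no_univalent (L.face d) (by rw [L.rot_face, h1])

theorem eq_or_eq_not {d d' : L1 × Bool} (h : d.1 = d'.1) : d = d' ∨ d = (d'.1, !d'.2) := by
  obtain ⟨e, θ⟩ := d
  obtain ⟨e', θ'⟩ := d'
  cases h
  cases θ <;> cases θ' <;> simp

theorem fst_ne_of_left_eq {d d' : L1 × Bool} (h : L.left d = L.left d') (hne : d ≠ d') :
    d.1 ≠ d'.1 := by
  intro h1
  rcases eq_or_eq_not h1 with h2 | h2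
  · exact hne h2
  · rw [h2] at h
    exact L.left_not_ne d' h

theorem fst_ne_of_src_eq {d d' : L1 × Bool} (h : L.src d = L.src d') (hne : d ≠ d') :
    d.1 ≠ d'.1 := by
  intro h1
  rcases eq_or_eq_not h1 with h2 | h2
  · exact hne h2
  · rw [h2] at h
    exact L.src_not_ne d' h

/-- If the dart `x` has the plaquette of the corner `c` on its left and its edge meets the vertex of
this corner, then `x` is one of the two darts at this corner. -/
theorem eq_or_face_eq {c w x : L1 × Bool} (hx : L.left x = L.left c) (hw : L.src w = L.src c)
    (h : w.1 = x.1) : x = c ∨ L.face x = c := by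
  rcases eq_or_eq_not h with h1 | h1
  · left
    rw [h1] at hw
    exact L.regular _ _ hx hw
  · right
    refine L.regular _ _ (by rw [left_face, hx]) ?_
    rw [src_face, ← h1, hw]

theorem cornerDart_eq {d : L1 × Bool} {v : L0} {p : L2} (hs : L.IsSite v p) (h : L.src d = v)
    (h' : L.left d = p) : L.cornerDart v p hs = d :=
  L.regular _ _ (hs.choose_spec.2.trans h'.symm) (hs.choose_spec.1.trans h.symm)

theorem src_cornerDart {v : L0} {p : L2} (hs : L.IsSite v p) :
    L.src (L.cornerDart v p hs) = v := hs.choose_spec.1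

theorem left_cornerDart {v : L0} {p : L2} (hs : L.IsSite v p) :
    L.left (L.cornerDart v p hs) = p := hs.choose_spec.2

theorem isSite_base (p : L2) : L.IsSite (L.base p) p := L.base_mem p

variable [Fintype L1] [DecidableEq L1]

theorem boundary_eq_toList (p : L2) :
    L.boundary p = L.face.toList (L.cornerDart (L.base p) p (L.isSite_base p)) := rfl

theorem mem_boundary {p : L2} {d : L1 × Bool} : d ∈ L.boundary p ↔ L.left d = p := by
  rw [boundary_eq_toList, Equiv.Perm.mem_toList_iff, ← L.left_eq_iff, L.left_cornerDart]
  exact ⟨fun h => h.1.symm, fun h => ⟨h.symm, Equiv.Perm.mem_support.2 (L.face_ne _)⟩⟩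

theorem mem_star {v : L0} {p : L2} (hs : L.IsSite v p) {d : L1 × Bool} :
    d ∈ L.star v p hs ↔ L.src d = v := by
  have h0 : L.src (L.rot (L.cornerDart v p hs)) = v :=
    ((L.src_eq_iff _ _).2 ⟨1, by simp⟩).symm.trans (L.src_cornerDart hs)
  rw [star, Equiv.Perm.mem_toList_iff, ← L.src_eq_iff, h0]
  exact ⟨fun h => h.1.symm, fun h => ⟨h.symm, Equiv.Perm.mem_support.2 (L.no_univalent _)⟩⟩

theorem nodup_boundary (p : L2) : (L.boundary p).Nodup := Equiv.Perm.nodup_toList _ _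

theorem nodup_star {v : L0} {p : L2} (hs : L.IsSite v p) : (L.star v p hs).Nodup :=
  Equiv.Perm.nodup_toList _ _

theorem boundary_pairwise (p : L2) : (L.boundary p).Pairwise fun d d' => d.1 ≠ d'.1 :=
  (L.nodup_boundary p).imp_of_mem fun hd hd' h =>
    L.fst_ne_of_left_eq ((L.mem_boundary.1 hd).trans (L.mem_boundary.1 hd').symm) h

theorem star_pairwise {v : L0} {p : L2} (hs : L.IsSite v p) :
    (L.star v p hs).Pairwise fun d d' => d.1 ≠ d'.1 :=
  (L.nodup_star hs).imp_of_mem fun hd hd' h =>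
    L.fst_ne_of_src_eq (((L.mem_star hs).1 hd).trans ((L.mem_star hs).1 hd').symm) h

/-- The boundary of `p` starts with the dart `c` that leaves the base-point and ends with the dart
whose successor is `c`. -/
theorem exists_boundary_eq {c : L1 × Bool} (hc : L.src c = L.base (L.left c)) :
    ∃ m y, L.boundary (L.left c) = c :: (m ++ [y]) ∧ L.face y = c := by
  rw [boundary_eq_toList, L.cornerDart_eq _ hc rfl]
  exact exists_toList_eq (L.face_ne c)

/-- The darts around a vertex, starting after the corner `c`, where `y` is the dart before `c` in
the boundary of the plaquette. -/
theorem exists_star_eq {c y : L1 × Bool} (hy : L.face y = c) (hs : L.IsSite (L.src c) (L.left c)) :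
    ∃ m, L.star (L.src c) (L.left c) hs = (y.1, !y.2) :: (m ++ [c]) := by
  rw [star, L.cornerDart_eq hs rfl rfl]
  obtain ⟨m, z, h, hz⟩ := exists_toList_eq (L.no_univalent (L.rot c))
  have h1 : L.rot c = (y.1, !y.2) := by rw [← hy, L.rot_face]
  refine ⟨m, ?_⟩
  rw [h, L.rot.injective hz, h1]

theorem leftPath_eq_nil {e : L1} (h : L.src (e, true) = L.base (L.left (e, true))) :
    L.leftPath e = [] := by
  obtain ⟨m, y, h1, -⟩ := L.exists_boundary_eq h
  rw [leftPath, h1]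
  simp

theorem mem_leftPath {e : L1} {d : L1 × Bool} (h : d ∈ L.leftPath e) :
    L.left d = L.left (e, true) ∧ d ≠ (e, true) :=
  ⟨L.mem_boundary.1 ((List.takeWhile_sublist _).subset h), by
    simpa using List.mem_takeWhile_imp h⟩

theorem fst_ne_of_mem_leftPath {e : L1} {d : L1 × Bool} (h : d ∈ L.leftPath e) : d.1 ≠ e :=
  L.fst_ne_of_left_eq (L.mem_leftPath h).1 (L.mem_leftPath h).2

theorem leftPath_pairwise (e : L1) : (L.leftPath e).Pairwise fun d d' => d.1 ≠ d'.1 :=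
  (L.boundary_pairwise _).sublist (List.takeWhile_sublist _)

theorem mem_rightPath {e : L1} {d : L1 × Bool} (h : d ∈ L.rightPath e) :
    L.left (d.1, !d.2) = L.left (e, false) ∧ (d.1, !d.2) ≠ (e, false) := by
  obtain ⟨x, hx, rfl⟩ := List.mem_map.1 h
  simp only [Bool.not_not]
  exact ⟨L.mem_boundary.1 (List.mem_reverse.1 ((List.takeWhile_sublist _).subset hx)), by
    simpa using List.mem_takeWhile_imp hx⟩

theorem fst_ne_of_mem_rightPath {e : L1} {d : L1 × Bool} (h : d ∈ L.rightPath e) : d.1 ≠ e :=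
  L.fst_ne_of_left_eq (L.mem_rightPath h).1 (L.mem_rightPath h).2

theorem rightPath_pairwise (e : L1) : (L.rightPath e).Pairwise fun d d' => d.1 ≠ d'.1 := by
  refine List.pairwise_map.2 (List.Pairwise.sublist (List.takeWhile_sublist _) ?_)
  exact List.pairwise_reverse.2 ((L.boundary_pairwise _).imp Ne.symm)

theorem rightPath_eq_nil {e : L1} (h : L.src (e, true) = L.base (L.left (e, false))) :
    L.rightPath e = [] := by
  have h0 : L.left (L.face (e, false)) = L.left (e, false) := L.left_face _
  obtain ⟨m, y, h1, h2⟩ := L.exists_boundary_eq (c := L.face (e, false))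
    (by rw [h0, ← h, L.src_face]; rfl)
  rw [rightPath, ← h0, h1, L.face.injective h2]
  simp

/-- Unless the starting vertex of `e` is the base-point of the plaquette on its right, the path to
it ends with the edge that follows `e` in the boundary of this plaquette. -/
theorem exists_rightPath_eq {e : L1} (h : L.src (e, true) ≠ L.base (L.left (e, false))) :
    ∃ l, L.rightPath e = l ++ [((L.face (e, false)).1, !(L.face (e, false)).2)] := by
  obtain ⟨l, m, hlm⟩ := List.append_of_mem (L.mem_boundary.2 (rfl : L.left (e, false) = _))
  have hm : ∀ x ∈ m.reverse, x ≠ (e, false) := by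
    intro x hx hxe
    have h1 := L.nodup_boundary (L.left (e, false))
    rw [hlm, List.nodup_append] at h1
    rw [hxe] at hx
    exact (List.nodup_cons.1 h1.2.1).1 (List.mem_reverse.1 hx)
  have h1 : L.rightPath e = m.reverse.map fun d => (d.1, !d.2) := by
    rw [rightPath, hlm, List.reverse_append, List.reverse_cons, List.append_assoc,
      List.takeWhile_append_of_pos (by simpa using hm)]
    simp
  cases m with
  | nil =>
    obtain ⟨c, hc, hc'⟩ := L.base_mem (L.left (e, false))
    obtain ⟨m', y, h2, h3⟩ := L.exists_boundary_eq (c := c) (by rw [hc, hc'])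
    rw [hc', hlm, ← List.cons_append] at h2
    have h4 : (e, false) = y := by simpa using (List.append_inj' h2 rfl).2
    have h5 := L.src_face y
    rw [h3, hc, ← h4] at h5
    exact absurd h5.symm h
  | cons d m =>
    rw [boundary_eq_toList] at hlm
    rw [h1, apply_eq_of_toList_eq hlm]
    exact ⟨m.reverse.map fun d => (d.1, !d.2), by simp⟩

end CellDecomposition

/-! ### Vertex, edge and plaquette operators are representations -/

/-- Commuting actions of the endomorphism algebras of `H` and `A`, one for each edge and one for
each plaquette, on a common algebra `B`. -/
structure SlotSystem (L1 L2 A H B : Type*) [Ring A] [Algebra ℂ A] [Ring H] [Algebra ℂ H]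
    [Ring B] [Algebra ℂ B] where
  /-- endomorphisms of `H` acting on an edge -/
  edge : L1 → Module.End ℂ H →ₐ[ℂ] B
  /-- endomorphisms of `A` acting on a plaquette -/
  plaq : L2 → Module.End ℂ A →ₐ[ℂ] B
  edge_commute : ∀ {e e' : L1}, e ≠ e' → ∀ f g, Commute (edge e f) (edge e' g)
  plaq_commute : ∀ {p q : L2}, p ≠ q → ∀ f g, Commute (plaq p f) (plaq q g)
  edge_plaq_commute : ∀ e p f g, Commute (edge e f) (plaq p g)

namespace SlotSystem

open HopfCrossedModule

variable {L0 L1 L2 A H B N : Type*} [Ring A] [HopfAlgebra ℂ A] [Ring H] [HopfAlgebra ℂ H] [Ring B]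
  [Algebra ℂ B] [FiniteDimensional ℂ H] [FiniteDimensional ℂ A]
  (S : SlotSystem L1 L2 A H B) (X : HopfCrossedModule A H)

/-- The reading of a dart in the boundary of a plaquette. -/
def dart (d : L1 × Bool) : B ⊗[ℂ] H :=
  Algebra.TensorProduct.map (S.edge d.1) (AlgHom.id ℂ H) (edgeReading H d.2)

/-- The reading of the element on a plaquette. -/
def plaqRead (p : L2) : B ⊗[ℂ] H :=
  Algebra.TensorProduct.map (S.plaq p) (AlgHom.id ℂ H) X.plaqReading

/-- The action of `H` on the edge of a dart that leaves a vertex. -/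
def dartAct (d : L1 × Bool) : H →ₗ[ℂ] B := (S.edge d.1).toLinearMap ∘ₗ edgeAct d.2

/-- The action of `H` on a plaquette. -/
def plaqAct (p : L2) : H →ₗ[ℂ] B := (S.plaq p).toLinearMap ∘ₗ X.act.toLinearMap

/-- Left multiplication by elements of `A` on a plaquette. -/
def mulLeft (p : L2) : A →ₗ[ℂ] B := (S.plaq p).toLinearMap ∘ₗ LinearMap.mul ℂ A

/-- Right multiplication by the antipodes of elements of `A` on a plaquette. -/
def mulRightAntipode (p : L2) : A →ₗ[ℂ] B :=
  (S.plaq p).toLinearMap ∘ₗ (LinearMap.mul ℂ A).flip ∘ₗ HopfAlgebra.antipode ℂ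

/-- The operators `t ↦ K (x ▷ a) t'` where `x` is the element of `H` read off along a path. -/
def alongPath (K : A →ₗ[ℂ] B) (l : List (L1 × Bool)) : A →ₗ[ℂ] B :=
  transport K (X.actLeg B (l.map S.dart).prod)

/-- The action `v ↦ ∂a v` of `A` on an edge. -/
def edgeMid (e : L1) : A →ₗ[ℂ] B :=
  (S.edge e).toLinearMap ∘ₗ LinearMap.mul ℂ H ∘ₗ X.bd.toCoalgHom.toLinearMap

section Commute

theorem commute_dart_edge {d : L1 × Bool} {e : L1} (h : d.1 ≠ e) (f : Module.End ℂ H) :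
    Commute (S.dart d) (S.edge e f ⊗ₜ 1) :=
  commute_map_tmul_one _ _ fun _ => S.edge_commute h _ _

theorem commute_dart_plaq (d : L1 × Bool) (p : L2) (f : Module.End ℂ A) :
    Commute (S.dart d) (S.plaq p f ⊗ₜ 1) :=
  commute_map_tmul_one _ _ fun _ => S.edge_plaq_commute _ _ _ _

theorem commute_plaqRead_edge (p : L2) (e : L1) (f : Module.End ℂ H) :
    Commute (S.plaqRead X p) (S.edge e f ⊗ₜ 1) :=
  commute_map_tmul_one _ _ fun _ => (S.edge_plaq_commute _ _ _ _).symm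

theorem commute_plaqRead_plaq {p q : L2} (h : p ≠ q) (f : Module.End ℂ A) :
    Commute (S.plaqRead X p) (S.plaq q f ⊗ₜ 1) :=
  commute_map_tmul_one _ _ fun _ => S.plaq_commute h _ _

theorem legsCommute_dart {d d' : L1 × Bool} (h : d.1 ≠ d'.1) : LegsCommute (S.dart d) (S.dart d') :=
  legsCommute_of_commute _ _ (fun _ _ => S.edge_commute h _ _) _ _

theorem legsCommute_plaqRead_dart (p : L2) (d : L1 × Bool) :
    LegsCommute (S.plaqRead X p) (S.dart d) :=
  legsCommute_of_commute _ _ (fun _ _ => (S.edge_plaq_commute _ _ _ _).symm) _ _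

theorem legsCommute_plaqRead_actLeg_dart (p : L2) (d : L1 × Bool) :
    LegsCommute (S.plaqRead X p) (X.actLeg B (S.dart d)) := by
  rw [dart, actLeg_map]
  exact legsCommute_of_commute _ _ (fun _ _ => (S.edge_plaq_commute _ _ _ _).symm) _ _

theorem legsCommute_dart_actLeg_dart [IsSemisimpleRing H] (d d' : L1 × Bool) :
    LegsCommute (S.dart d) (X.actLeg B (S.dart d')) := by
  rw [dart, dart, actLeg_map]
  by_cases h : d.1 = d'.1
  · rw [h]
    exact (X.legsCommute_edgeReading_map_act d.2 d'.2).map _ _ _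
  · exact legsCommute_of_commute _ _ (fun _ _ => S.edge_commute h _ _) _ _

theorem legsCommute_actLeg_dart_actLeg_dart [IsSemisimpleRing H] (d d' : L1 × Bool) :
    LegsCommute (X.actLeg B (S.dart d)) (X.actLeg B (S.dart d')) := by
  have h := (S.legsCommute_dart_actLeg_dart X d d').map (AlgHom.id ℂ B) X.act
    (AlgHom.id ℂ (Module.End ℂ A))
  rwa [Algebra.TensorProduct.map_id] at h

theorem actLeg_tmul_one (b : B) : X.actLeg B (b ⊗ₜ 1) = b ⊗ₜ 1 := by
  simp [actLeg]

theorem actLeg_list_prod (l : List (B ⊗[ℂ] H)) :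
    X.actLeg B l.prod = (l.map (X.actLeg B)).prod := by
  induction l with
  | nil => exact actLeg_tmul_one X 1
  | cons d l ih => rw [List.prod_cons, map_mul, List.map_cons, List.prod_cons, ih]

theorem commute_list_map_dart {l : List (L1 × Bool)} {w : B ⊗[ℂ] H}
    (h : ∀ d ∈ l, Commute (S.dart d) w) : Commute (l.map S.dart).prod w := by
  refine Commute.list_prod_left _ _ fun x hx => ?_
  obtain ⟨d, hd, rfl⟩ := List.mem_map.1 hx
  exact h d hd

theorem commute_alongPath {K : A →ₗ[ℂ] B} {l : List (L1 × Bool)} {b : B}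
    (h : ∀ a, Commute b (K a)) (hl : ∀ d ∈ l, Commute (S.dart d) (b ⊗ₜ 1)) (a : A) :
    Commute b (S.alongPath X K l a) := by
  refine commute_transport h ?_ a
  rw [← actLeg_tmul_one X b]
  exact (S.commute_list_map_dart hl).map (X.actLeg B)

theorem commute_alongPath_tmul_one [Ring N] [Algebra ℂ N] {K : A →ₗ[ℂ] B} {l : List (L1 × Bool)}
    {r : B ⊗[ℂ] N} (h : ∀ a, Commute r (K a ⊗ₜ 1))
    (hl : ∀ d ∈ l, LegsCommute r (X.actLeg B (S.dart d))) (a : A) :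
    Commute r (S.alongPath X K l a ⊗ₜ 1) := by
  refine commute_transport_tmul_one h ?_ a
  rw [actLeg_list_prod, List.map_map]
  refine LegsCommute.list_prod_right fun s hs => ?_
  obtain ⟨d, hd, rfl⟩ := List.mem_map.1 hs
  exact hl d hd

end Commute

section Reps

theorem isRep_mulLeft (p : L2) : IsRep (S.mulLeft p) := (isRep_mul A).comp _

theorem isRep_mulRightAntipode (p : L2) : IsRep (S.mulRightAntipode p) :=
  (isRep_mul_flip_antipode A).comp _

theorem isRep_plaqAct (p : L2) : IsRep (S.plaqAct X p) := (isRep_algHom X.act).comp _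

theorem isRep_edgeMid (e : L1) : IsRep (S.edgeMid X e) := by
  refine IsRep.comp (Y := LinearMap.mul ℂ H ∘ₗ X.bd.toCoalgHom.toLinearMap) ⟨?_, fun x y => ?_⟩ _
  · rw [LinearMap.comp_apply, bd_one]
    exact (isRep_mul H).1
  · rw [LinearMap.comp_apply, bd_mul]
    exact (isRep_mul H).2 _ _

variable [IsSemisimpleRing H]

theorem isRep_dartAct (d : L1 × Bool) : IsRep (S.dartAct d) := (isRep_edgeAct d.2).comp _

theorem isCoaction_dart (d : L1 × Bool) : IsCoaction (S.dart d) :=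
  (isCoaction_edgeReading d.2).map _

theorem isCoaction_list_map_dart {l : List (L1 × Bool)}
    (hl : l.Pairwise fun d d' => d.1 ≠ d'.1) : IsCoaction (l.map S.dart).prod := by
  refine isCoaction_list_prod (fun r hr => ?_) (List.pairwise_map.2 (hl.imp fun h => ?_))
  · obtain ⟨d, -, rfl⟩ := List.mem_map.1 hr
    exact S.isCoaction_dart d
  · exact S.legsCommute_dart h.symm

theorem isRep_alongPath {K : A →ₗ[ℂ] B} (hK : IsRep K) {l : List (L1 × Bool)}
    (hl : l.Pairwise fun d d' => d.1 ≠ d'.1) (hc : ∀ d ∈ l, ∀ a, Commute (S.dart d) (K a ⊗ₜ 1)) :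
    IsRep (S.alongPath X K l) :=
  isRep_transport hK X.act X.act_mul X.act_one (S.isCoaction_list_map_dart hl)
    fun a => S.commute_list_map_dart fun d hd => hc d hd a

variable [Fintype L1] [DecidableEq L1] (L : CellDecomposition L0 L1 L2)

/-- The holonomy around a plaquette. -/
def hol (p : L2) : B ⊗[ℂ] H := ((L.boundary p).map S.dart).prod * S.plaqRead X p

theorem isCoaction_hol (p : L2) : IsCoaction (S.hol X L p) := by
  refine (S.isCoaction_list_map_dart (L.boundary_pairwise p)).mul
    (X.isCoaction_plaqReading.map _) (LegsCommute.list_prod_right fun s hs => ?_)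
  obtain ⟨d, -, rfl⟩ := List.mem_map.1 hs
  exact S.legsCommute_plaqRead_dart X p d

/-- The part of an edge operator that acts on the plaquette on the left. -/
def edgeLeft (e : L1) : A →ₗ[ℂ] B :=
  S.alongPath X (S.mulLeft (L.left (e, true))) (L.leftPath e)

/-- The part of an edge operator that acts on the plaquette on the right. -/
def edgeRight (e : L1) : A →ₗ[ℂ] B :=
  S.alongPath X (S.mulRightAntipode (L.left (e, false))) (L.rightPath e)

/-- The edge operators. -/
def edgeOp (e : L1) : A →ₗ[ℂ] B :=
  (toConv (S.edgeLeft X L e) * toConv (S.edgeRight X L e) * toConv (S.edgeMid X e)).ofConv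

theorem isRep_edgeLeft (e : L1) : IsRep (S.edgeLeft X L e) :=
  S.isRep_alongPath X (S.isRep_mulLeft _) (L.leftPath_pairwise e)
    fun _ _ _ => S.commute_dart_plaq _ _ _

theorem isRep_edgeRight (e : L1) : IsRep (S.edgeRight X L e) :=
  S.isRep_alongPath X (S.isRep_mulRightAntipode _) (L.rightPath_pairwise e)
    fun _ _ _ => S.commute_dart_plaq _ _ _

theorem commute_edgeLeft_edgeRight (e : L1) (a b : A) :
    Commute (S.edgeLeft X L e a) (S.edgeRight X L e b) := by
  refine commute_transport (fun b => ?_) ?_ b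
  · exact (S.commute_alongPath X (fun a => S.plaq_commute (L.left_not_ne (e, true)) _ _)
      (fun d _ => S.commute_dart_plaq _ _ _) a).symm
  · refine S.commute_alongPath_tmul_one X (fun a => ?_) (fun d _ => ?_) a
    · rw [← actLeg_tmul_one X]
      exact (S.commute_list_map_dart fun d _ => S.commute_dart_plaq _ _ _).map (X.actLeg B)
    · rw [actLeg_list_prod, List.map_map]
      refine LegsCommute.list_prod_left fun s hs => ?_
      obtain ⟨d', -, rfl⟩ := List.mem_map.1 hs
      exact S.legsCommute_actLeg_dart_actLeg_dart X d' d

theorem commute_edgeMid_edgeLeft (e : L1) (a b : A) :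
    Commute (S.edgeMid X e a) (S.edgeLeft X L e b) :=
  S.commute_alongPath X (fun _ => S.edge_plaq_commute _ _ _ _)
    (fun _ hd => S.commute_dart_edge (L.fst_ne_of_mem_leftPath hd) _) b

theorem commute_edgeMid_edgeRight (e : L1) (a b : A) :
    Commute (S.edgeMid X e a) (S.edgeRight X L e b) :=
  S.commute_alongPath X (fun _ => S.edge_plaq_commute _ _ _ _)
    (fun _ hd => S.commute_dart_edge (L.fst_ne_of_mem_rightPath hd) _) b

theorem isRep_edgeOp (e : L1) : IsRep (S.edgeOp X L e) :=
  IsRep.convMul (IsRep.convMul (S.isRep_edgeLeft X L e) (S.isRep_edgeRight X L e)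
    (S.commute_edgeLeft_edgeRight X L e)) (S.isRep_edgeMid X e) fun a b =>
    (convMul_commute (S.commute_edgeMid_edgeLeft X L e b)
      (S.commute_edgeMid_edgeRight X L e b) a).symm

variable [Fintype L2] [DecidableEq L0]

/-- The factors of a vertex operator on the edges. -/
def starFactors (v : L0) (p : L2) (hs : L.IsSite v p) : List (WithConv (H →ₗ[ℂ] B)) :=
  (L.star v p hs).map fun d => toConv (S.dartAct d)

/-- The factors of a vertex operator on the plaquettes. -/
def baseFactors (v : L0) : List (WithConv (H →ₗ[ℂ] B)) :=
  (Finset.univ.filter fun q : L2 => L.base q = v).toList.map fun q => toConv (S.plaqAct X q)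

/-- The vertex operators. -/
def vertexOp (v : L0) (p : L2) (hs : L.IsSite v p) : H →ₗ[ℂ] B :=
  (S.starFactors L v p hs ++ S.baseFactors X L v).prod.ofConv

theorem isRep_vertexOp (v : L0) (p : L2) (hs : L.IsSite v p) : IsRep (S.vertexOp X L v p hs) := by
  refine isRep_list_prod (fun Y hY => ?_) (List.pairwise_append.2 ⟨?_, ?_, ?_⟩)
  · rcases List.mem_append.1 hY with h | h
    · obtain ⟨d, -, rfl⟩ := List.mem_map.1 h
      exact S.isRep_dartAct d
    · obtain ⟨q, -, rfl⟩ := List.mem_map.1 h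
      exact S.isRep_plaqAct X q
  · exact List.pairwise_map.2 ((L.star_pairwise hs).imp fun h _ _ => S.edge_commute h _ _)
  · exact List.pairwise_map.2 ((Finset.nodup_toList _).imp fun h _ _ => S.plaq_commute h _ _)
  · intro Y hY Z hZ x y
    obtain ⟨d, -, rfl⟩ := List.mem_map.1 hY
    obtain ⟨q, -, rfl⟩ := List.mem_map.1 hZ
    exact S.edge_plaq_commute _ _ _ _

end Reps

end SlotSystem

/-! ### Equivariant families of operators -/

section Equivariance

variable {A H B : Type*} [Ring A] [HopfAlgebra ℂ A] [Ring H] [HopfAlgebra ℂ H] [Ring B]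
  [Algebra ℂ B] (X : HopfCrossedModule A H)

/-- The relation `V h * K a = K (h₁ ▷ a) * V h₂`. -/
def IsEquivariant (V : WithConv (H →ₗ[ℂ] B)) (K : A →ₗ[ℂ] B) : Prop :=
  ∀ a, V * convConst H (K a) = toConv (K ∘ₗ X.act.toLinearMap.flip a) * V

variable {X}

theorem IsEquivariant.mul_right {V Y : WithConv (H →ₗ[ℂ] B)} {K : A →ₗ[ℂ] B}
    (h : IsEquivariant X V K) (hY : ∀ x a, Commute (Y x) (K a)) : IsEquivariant X (V * Y) K := by
  intro a
  rw [mul_assoc, ← (commute_convConst fun x => (hY x a).symm).eq, ← mul_assoc, h, mul_assoc]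

/-- A factor that commutes with `K` may be multiplied from the left because of the Yetter–Drinfeld
condition. -/
theorem IsEquivariant.mul_left {V Y : WithConv (H →ₗ[ℂ] B)} {K : A →ₗ[ℂ] B}
    (h : IsEquivariant X V K) (hY : ∀ x a, Commute (Y x) (K a)) : IsEquivariant X (Y * V) K := by
  intro a
  have h1 : Commute Y (toConv (K ∘ₗ X.act.toLinearMap.flip a)) :=
    X.commute_conv_comp_act K a Y.ofConv hY
  rw [mul_assoc, h, ← mul_assoc, h1.eq, mul_assoc]

theorem IsEquivariant.list_prod {l m : List (WithConv (H →ₗ[ℂ] B))} {V : WithConv (H →ₗ[ℂ] B)}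
    {K : A →ₗ[ℂ] B} (h : IsEquivariant X V K) (hl : ∀ Y ∈ l, ∀ x a, Commute (Y x) (K a))
    (hm : ∀ Y ∈ m, ∀ x a, Commute (Y x) (K a)) : IsEquivariant X (l ++ V :: m).prod K := by
  have key : ∀ l : List (WithConv (H →ₗ[ℂ] B)), (∀ Y ∈ l, ∀ x a, Commute (Y x) (K a)) →
      ∀ x a, Commute (l.prod x) (K a) := fun l hl x a =>
    (conv_list_prod_commute (b := K a) (fun Y hY x => (hl Y hY x a).symm) x).symm
  rw [List.prod_append, List.prod_cons]
  exact (h.mul_right (key m hm)).mul_left (key l hl)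

/-- Because `▷` is a morphism of coalgebras, the equivariant maps are closed under convolution. -/
theorem IsEquivariant.conv_mul {V : WithConv (H →ₗ[ℂ] B)} {K K' : A →ₗ[ℂ] B}
    (h : IsEquivariant X V K) (h' : IsEquivariant X V K') :
    IsEquivariant X V (toConv K * toConv K').ofConv := by
  intro a
  have h1 : convConst H ((toConv K * toConv K').ofConv a) = ∑ j ∈ (ℛ ℂ a).index,
      convConst H (K ((ℛ ℂ a).left j)) * convConst H (K' ((ℛ ℂ a).right j)) := by
    change convConst H ((toConv K * toConv K') a) = _
    rw [(ℛ ℂ a).convMul_apply]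
    refine conv_ext fun x => ?_
    simp only [← convConst_mul]
    change _ = (∑ j ∈ (ℛ ℂ a).index, convConst H (K ((ℛ ℂ a).left j) * K' ((ℛ ℂ a).right j)) :
      WithConv (H →ₗ[ℂ] B)).ofConv x
    rw [ofConv_sum, LinearMap.sum_apply, convConst_apply, Finset.smul_sum]
    rfl
  have h2 : toConv ((toConv K * toConv K').ofConv ∘ₗ X.act.toLinearMap.flip a) =
      ∑ j ∈ (ℛ ℂ a).index, toConv (K ∘ₗ X.act.toLinearMap.flip ((ℛ ℂ a).left j)) *
        toConv (K' ∘ₗ X.act.toLinearMap.flip ((ℛ ℂ a).right j)) := by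
    refine conv_ext fun x => ?_
    change (toConv K * toConv K') (X.act x a) = (∑ j ∈ (ℛ ℂ a).index, toConv
      (K ∘ₗ X.act.toLinearMap.flip ((ℛ ℂ a).left j)) *
        toConv (K' ∘ₗ X.act.toLinearMap.flip ((ℛ ℂ a).right j)) : WithConv (H →ₗ[ℂ] B)).ofConv x
    rw [ofConv_sum, LinearMap.sum_apply, LinearMap.convMul_apply, X.comul_act_eq_sum,
      Finset.sum_comm]
    simp only [map_sum, TensorProduct.map_tmul, LinearMap.mul'_apply]
    refine Finset.sum_congr rfl fun j _ => ?_
    change _ = (toConv (K ∘ₗ X.act.toLinearMap.flip ((ℛ ℂ a).left j)) *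
      toConv (K' ∘ₗ X.act.toLinearMap.flip ((ℛ ℂ a).right j)) : WithConv (H →ₗ[ℂ] B)) x
    rw [(ℛ ℂ x).convMul_apply]
    rfl
  rw [h1, h2, Finset.mul_sum, Finset.sum_mul]
  refine Finset.sum_congr rfl fun j _ => ?_
  rw [← mul_assoc, h, mul_assoc, h', mul_assoc]

/-- If the reading `r` absorbs the action `V` of `H`, operators that act by `r` are equivariant. -/
theorem isEquivariant_transport {V : H →ₗ[ℂ] B} {K : A →ₗ[ℂ] B} {z r : B ⊗[ℂ] H}
    (hr : convConst H r * (convRight B (toConv LinearMap.id) * convLeft H (toConv V)) =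
      convLeft H (toConv V) * convConst H r)
    (hK : ∀ x a, Commute (V x) (K a)) (hz : ∀ x, Commute z (V x ⊗ₜ 1)) :
    IsEquivariant X (toConv V) (transport K (X.actLeg B (z * r))) := by
  intro a
  refine conv_ext fun x => ?_
  have h1 := congrArg (fun f => f.ofConv x) hr
  change (convConst H r * _) x = (convLeft H (toConv V) * convConst H r) x at h1
  rw [convConst_mul_apply, mul_convConst_apply, (ℛ ℂ x).convMul_apply, Finset.mul_sum] at h1
  simp only [convRight_apply, convLeft_apply, Algebra.TensorProduct.tmul_mul_tmul, one_mul,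
    mul_one] at h1
  have h2 : ∀ b : B, X.actLeg B (b ⊗ₜ 1) = b ⊗ₜ 1 := fun b => by
    simp [HopfCrossedModule.actLeg]
  have h3 : ∀ (w : B ⊗[ℂ] H) (y : H), transport K (X.actLeg B w) (X.act y a) =
      transport K (X.actLeg B (w * (1 ⊗ₜ y))) a := by
    intro w y
    induction w with
    | zero => simp
    | tmul c x => simp [HopfCrossedModule.actLeg]
    | add x y hx hy => simp only [map_add, add_mul, LinearMap.add_apply, hx, hy]
  rw [mul_convConst_apply, (ℛ ℂ x).convMul_apply]
  change V x * _ = ∑ i ∈ (ℛ ℂ x).index, transport K (X.actLeg B (z * r))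
    (X.act ((ℛ ℂ x).left i) a) * V ((ℛ ℂ x).right i)
  rw [← transport_tmul_one_mul K _ (hK x), ← h2, ← map_mul, ← mul_assoc, ← (hz x).eq, mul_assoc,
    ← h1, Finset.mul_sum, map_sum, map_sum, LinearMap.sum_apply]
  refine Finset.sum_congr rfl fun i _ => ?_
  rw [h3, ← transport_mul_tmul_one, ← h2 (V _), ← map_mul]
  simp only [mul_assoc, Algebra.TensorProduct.tmul_mul_tmul, one_mul, mul_one]
  rfl

end Equivariance

/-! ### Relations at a single edge or plaquette -/

section Equivariance

variable {A H B B' : Type*} [Ring A] [HopfAlgebra ℂ A] [Ring H] [HopfAlgebra ℂ H] [Ring B]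
  [Algebra ℂ B] [Ring B'] [Algebra ℂ B'] {X : HopfCrossedModule A H}

theorem IsEquivariant.map {V : WithConv (H →ₗ[ℂ] B)} {K : A →ₗ[ℂ] B} (h : IsEquivariant X V K)
    (f : B →ₐ[ℂ] B') : IsEquivariant X (convMap H f V) (f.toLinearMap ∘ₗ K) := by
  intro a
  have h1 := congrArg (convMap H f) (h a)
  rw [map_mul, map_mul, convMap_convConst] at h1
  exact h1

theorem IsEquivariant.list_map_prod {ι : Type*} {l : List ι} {F : ι → WithConv (H →ₗ[ℂ] B)}
    {x : ι} {K : A →ₗ[ℂ] B} (h : IsEquivariant X (F x) K) (hx : x ∈ l) (hn : l.Nodup)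
    (hl : ∀ y ∈ l, y ≠ x → ∀ h a, Commute (F y h) (K a)) : IsEquivariant X (l.map F).prod K := by
  obtain ⟨s, t, rfl⟩ := List.append_of_mem hx
  rw [List.nodup_append, List.nodup_cons] at hn
  rw [List.map_append, List.map_cons]
  refine h.list_prod (fun Y hY => ?_) fun Y hY => ?_
  · obtain ⟨y, hy, rfl⟩ := List.mem_map.1 hY
    exact hl y (by simp [hy]) (hn.2.2 y hy x (by simp))
  · obtain ⟨y, hy, rfl⟩ := List.mem_map.1 hY
    exact hl y (by simp [hy]) fun h => hn.2.1.1 (h ▸ hy)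

end Equivariance

namespace SlotSystem

open HopfCrossedModule

variable {L0 L1 L2 A H B : Type*} [Ring A] [HopfAlgebra ℂ A] [Ring H] [HopfAlgebra ℂ H] [Ring B]
  [Algebra ℂ B] [FiniteDimensional ℂ H] [FiniteDimensional ℂ A] [IsSemisimpleRing H]
  (S : SlotSystem L1 L2 A H B) (X : HopfCrossedModule A H)

section Local

theorem isEquivariant_mulLeft (p : L2) :
    IsEquivariant X (toConv (S.plaqAct X p)) (S.mulLeft p) :=
  IsEquivariant.map (V := toConv X.act.toLinearMap) X.act_mul_convConst_mul (S.plaq p)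

theorem isEquivariant_mulRightAntipode (p : L2) :
    IsEquivariant X (toConv (S.plaqAct X p)) (S.mulRightAntipode p) :=
  IsEquivariant.map (V := toConv X.act.toLinearMap) X.act_mul_convConst_mul_flip (S.plaq p)

theorem isEquivariant_edgeMid (e : L1) :
    IsEquivariant X (toConv (S.dartAct (e, true))) (S.edgeMid X e) := by
  have h : IsEquivariant X (toConv (edgeAct true))
      (LinearMap.mul ℂ H ∘ₗ X.bd.toCoalgHom.toLinearMap) := fun a => X.edgeAct_mul_convConst a
  exact h.map (S.edge e)

theorem dart_mul_dartAct (d : L1 × Bool) :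
    convConst H (S.dart d) * (convRight B (toConv LinearMap.id) *
        convLeft H (toConv (S.dartAct (d.1, !d.2)))) =
      convLeft H (toConv (S.dartAct (d.1, !d.2))) * convConst H (S.dart d) := by
  have h := congrArg (convMap H (Algebra.TensorProduct.map (S.edge d.1) (AlgHom.id ℂ H)))
    (edgeReading_mul_edgeAct_not (H := H) d.2)
  simp only [map_mul, convMap_convConst, convMap_map_convLeft, convMap_map_convRight] at h
  exact h

theorem dart_true_mul_dartAct (e : L1) :
    convConst H (S.dart (e, true)) * convLeft H (toConv (S.dartAct (e, true))) =
      convLeft H (toConv (S.dartAct (e, true))) * convRight B (toConv LinearMap.id) *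
        convConst H (S.dart (e, true)) := by
  have h := congrArg (convMap H (Algebra.TensorProduct.map (S.edge e) (AlgHom.id ℂ H)))
    (edgeReading_mul_edgeAct (H := H))
  simp only [map_mul, convMap_convConst, convMap_map_convLeft, convMap_map_convRight] at h
  exact h

theorem dartAct_comp_bd (e : L1) :
    S.dartAct (e, true) ∘ₗ X.bd.toCoalgHom.toLinearMap = S.edgeMid X e := by
  have h : edgeAct true = LinearMap.mul ℂ H := by
    ext x y
    exact edgeAct_true x y
  rw [dartAct, edgeMid, h]
  rfl

theorem dart_false_mul_edgeMid (e : L1) :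
    convConst A (S.dart (e, false)) * (convRight B (toConv X.bd.toCoalgHom.toLinearMap) *
        convLeft H (toConv (S.edgeMid X e))) =
      convLeft H (toConv (S.edgeMid X e)) * convConst A (S.dart (e, false)) := by
  have h := congrArg (convComp (B ⊗[ℂ] H) X.bd.toCoalgHom) (S.dart_mul_dartAct (e, false))
  rw [map_mul, map_mul, map_mul, convComp_convConst] at h
  rw [← dartAct_comp_bd]
  exact h

theorem dart_true_mul_edgeMid (e : L1) :
    convConst A (S.dart (e, true)) * convLeft H (toConv (S.edgeMid X e)) =
      convLeft H (toConv (S.edgeMid X e)) * convRight B (toConv X.bd.toCoalgHom.toLinearMap) *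
        convConst A (S.dart (e, true)) := by
  have h := congrArg (convComp (B ⊗[ℂ] H) X.bd.toCoalgHom) (S.dart_true_mul_dartAct e)
  rw [map_mul, map_mul, map_mul, convComp_convConst] at h
  rw [← dartAct_comp_bd]
  exact h

theorem plaqRead_mul_mulLeft (p : L2) :
    convConst A (S.plaqRead X p) * (convRight B (toConv X.bd.toCoalgHom.toLinearMap) *
        convLeft H (toConv (S.mulLeft p))) =
      convLeft H (toConv (S.mulLeft p)) * convConst A (S.plaqRead X p) := by
  have h := congrArg (convMap A (Algebra.TensorProduct.map (S.plaq p) (AlgHom.id ℂ H)))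
    X.plaqReading_mul_mul
  simp only [map_mul, convMap_convConst, convMap_map_convLeft, convMap_map_convRight] at h
  exact h

theorem plaqRead_mul_mulRightAntipode (p : L2) :
    convConst A (S.plaqRead X p) * convLeft H (toConv (S.mulRightAntipode p)) =
      convLeft H (toConv (S.mulRightAntipode p)) *
        convRight B (toConv X.bd.toCoalgHom.toLinearMap) * convConst A (S.plaqRead X p) := by
  have h := congrArg (convMap A (Algebra.TensorProduct.map (S.plaq p) (AlgHom.id ℂ H)))
    X.plaqReading_mul_mul_flip
  simp only [map_mul, convMap_convConst, convMap_map_convLeft, convMap_map_convRight] at h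
  exact h

theorem commute_plaqRead_plaqAct (p : L2) :
    Commute (convConst H (S.plaqRead X p))
      (convRight B (toConv LinearMap.id) * convLeft H (toConv (S.plaqAct X p))) := by
  have h := congrArg (convMap H (Algebra.TensorProduct.map (S.plaq p) (AlgHom.id ℂ H)))
    X.commute_plaqReading_act.eq
  simp only [map_mul, convMap_convConst, convMap_map_convLeft, convMap_map_convRight] at h
  exact h

/-- The action on a plaquette commutes with every factor in the convolution algebra. -/
theorem commute_convLeft_plaqAct (p : L2) {Y : WithConv (H →ₗ[ℂ] B ⊗[ℂ] H)}
    (hY : ∀ x y, Commute (Y x) (S.plaqAct X p y ⊗ₜ 1)) :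
    Commute Y (convLeft H (toConv (S.plaqAct X p))) := by
  have h := X.commute_conv_act ((Algebra.TensorProduct.includeLeft (R := ℂ) (S := ℂ) (A := B)
    (B := H)).toLinearMap ∘ₗ (S.plaq p).toLinearMap) Y.ofConv fun x y => hY x y
  rw [LinearMap.comp_assoc] at h
  exact h

end Local

end SlotSystem

/-! ### Vertex and edge operators -/

namespace SlotSystem

open HopfCrossedModule

variable {L0 L1 L2 A H B : Type*} [Ring A] [HopfAlgebra ℂ A] [Ring H] [HopfAlgebra ℂ H] [Ring B]
  [Algebra ℂ B] [FiniteDimensional ℂ H] [FiniteDimensional ℂ A] [IsSemisimpleRing H]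
  (S : SlotSystem L1 L2 A H B) (X : HopfCrossedModule A H)
  [Fintype L1] [DecidableEq L1] (L : CellDecomposition L0 L1 L2)

theorem edgeLeft_eq_mulLeft {e : L1} (h : L.src (e, true) = L.base (L.left (e, true))) :
    S.edgeLeft X L e = S.mulLeft (L.left (e, true)) := by
  rw [edgeLeft, L.leftPath_eq_nil h, alongPath, List.map_nil, List.prod_nil]
  exact (congrArg _ (actLeg_tmul_one X 1)).trans (transport_one _)

theorem edgeRight_eq_mulRightAntipode {e : L1}
    (h : L.src (e, true) = L.base (L.left (e, false))) :
    S.edgeRight X L e = S.mulRightAntipode (L.left (e, false)) := by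
  rw [edgeRight, L.rightPath_eq_nil h, alongPath, List.map_nil, List.prod_nil]
  exact (congrArg _ (actLeg_tmul_one X 1)).trans (transport_one _)

section VertexEdge

variable [Fintype L2] [DecidableEq L0]

theorem isEquivariant_vertexOp_of_star {v : L0} {p : L2} (hs : L.IsSite v p) {K : A →ₗ[ℂ] B}
    {d : L1 × Bool} (hd : L.src d = v) (h : IsEquivariant X (toConv (S.dartAct d)) K)
    (h₁ : ∀ d', L.src d' = v → d' ≠ d → ∀ f a, Commute (S.edge d'.1 f) (K a))
    (h₂ : ∀ q, L.base q = v → ∀ f a, Commute (S.plaq q f) (K a)) :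
    IsEquivariant X (toConv (S.vertexOp X L v p hs)) K := by
  change IsEquivariant X (S.starFactors L v p hs ++ S.baseFactors X L v).prod K
  rw [List.prod_append]
  refine IsEquivariant.mul_right (IsEquivariant.list_map_prod (F := fun d => toConv (S.dartAct d))
    h ((L.mem_star hs).2 hd) (L.nodup_star hs)
    fun d' hd' hne x a => h₁ d' ((L.mem_star hs).1 hd') hne _ _) fun x a => ?_
  refine (conv_list_prod_commute (fun Y hY c => ?_) x).symm
  obtain ⟨q, hq, rfl⟩ := List.mem_map.1 hY
  exact (h₂ q (by simpa using hq) _ _).symm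

theorem isEquivariant_vertexOp_of_base {v : L0} {p : L2} (hs : L.IsSite v p) {K : A →ₗ[ℂ] B}
    {q : L2} (hq : L.base q = v) (h : IsEquivariant X (toConv (S.plaqAct X q)) K)
    (h₁ : ∀ d f a, Commute (S.edge d f) (K a))
    (h₂ : ∀ q', q' ≠ q → ∀ f a, Commute (S.plaq q' f) (K a)) :
    IsEquivariant X (toConv (S.vertexOp X L v p hs)) K := by
  change IsEquivariant X (S.starFactors L v p hs ++ S.baseFactors X L v).prod K
  rw [List.prod_append]
  refine IsEquivariant.mul_left (IsEquivariant.list_map_prod (F := fun q => toConv (S.plaqAct X q))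
    h (by simpa using hq) (Finset.nodup_toList _)
    fun q' _ hne x a => h₂ q' hne _ _) fun x a => ?_
  refine (conv_list_prod_commute (fun Y hY c => ?_) x).symm
  obtain ⟨d, hd, rfl⟩ := List.mem_map.1 hY
  exact (h₁ d.1 _ _).symm

variable {e : L1} (hb : L.base (L.left (e, true)) = L.src (e, true)) {p : L2}
  (hs : L.IsSite (L.src (e, true)) p)

include hb in
theorem isEquivariant_edgeLeft :
    IsEquivariant X (toConv (S.vertexOp X L (L.src (e, true)) p hs)) (S.edgeLeft X L e) := by
  rw [S.edgeLeft_eq_mulLeft X L hb.symm]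
  exact S.isEquivariant_vertexOp_of_base X L hs hb (S.isEquivariant_mulLeft X _)
    (fun _ _ _ => S.edge_plaq_commute _ _ _ _) fun _ hq _ _ => S.plaq_commute hq _ _

theorem isEquivariant_vertexOp_edgeMid :
    IsEquivariant X (toConv (S.vertexOp X L (L.src (e, true)) p hs)) (S.edgeMid X e) :=
  S.isEquivariant_vertexOp_of_star X L hs rfl (S.isEquivariant_edgeMid X e)
    (fun _ hd hne _ _ => S.edge_commute (L.fst_ne_of_src_eq hd hne) _ _)
    fun _ _ _ _ => (S.edge_plaq_commute _ _ _ _).symm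

/-- On the right of `e`, either the vertex is the base-point and acts on the plaquette directly, or
the path to it ends with an edge at this vertex, whose reading absorbs the action of the vertex
operator. -/
theorem isEquivariant_edgeRight :
    IsEquivariant X (toConv (S.vertexOp X L (L.src (e, true)) p hs)) (S.edgeRight X L e) := by
  -- either the vertex is the base point, and the plaquette transforms under the vertex operator, or
  -- the path to the vertex is not empty, and it is its last edge `d₀` that does
  by_cases hq : L.src (e, true) = L.base (L.left (e, false))
  · rw [S.edgeRight_eq_mulRightAntipode X L hq]
    exact S.isEquivariant_vertexOp_of_base X L hs hq.symm (S.isEquivariant_mulRightAntipode X _)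
      (fun _ _ _ => S.edge_plaq_commute _ _ _ _) fun _ hq _ _ => S.plaq_commute hq _ _
  · obtain ⟨l, hl⟩ := L.exists_rightPath_eq hq
    set d₀ := L.face (e, false) with hd₀
    have hsrc : L.src d₀ = L.src (e, true) := L.src_face (e, false)
    have hleft : L.left d₀ = L.left (e, false) := L.left_face _
    refine S.isEquivariant_vertexOp_of_star X L hs hsrc ?_ (fun d hd hne f a => ?_)
      fun q hqv f a => ?_
    · rw [edgeRight, alongPath, hl, List.map_append, List.prod_append, List.map_cons, List.map_nil,
        List.prod_singleton]
      refine isEquivariant_transport ?_ (fun _ _ => S.edge_plaq_commute _ _ _ _) fun x => ?_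
      · simpa only [Bool.not_not] using S.dart_mul_dartAct (d₀.1, !d₀.2)
      · have hp := L.rightPath_pairwise e
        rw [hl, List.pairwise_append] at hp
        exact S.commute_list_map_dart fun d hd =>
          S.commute_dart_edge (hp.2.2 d hd (d₀.1, !d₀.2) (by simp)) _
    · refine S.commute_alongPath X (fun _ => S.edge_plaq_commute _ _ _ _) (fun x hx => ?_) a
      refine S.commute_dart_edge (fun hxd => ?_) f
      obtain ⟨h1, h2⟩ := L.mem_rightPath hx
      rcases L.eq_or_face_eq (c := d₀) (w := d) (h1.trans hleft.symm) (hd.trans hsrc.symm)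
        hxd.symm with h3 | h3
      · exact L.fst_ne_of_src_eq (hd.trans hsrc.symm) hne (by rw [← hxd, ← h3])
      · exact h2 (L.face.injective h3)
    · refine S.commute_alongPath X (fun _ => S.plaq_commute (fun h => hq ?_) _ _)
        (fun x _ => S.commute_dart_plaq _ _ _) a
      rw [← h, hqv]

include hb in
/-- The edge operators at the base-point of the plaquette on the left are equivariant for the vertex
operators. -/
theorem isEquivariant_edgeOp :
    IsEquivariant X (toConv (S.vertexOp X L (L.src (e, true)) p hs)) (S.edgeOp X L e) :=
  ((S.isEquivariant_edgeLeft X L hb hs).conv_mul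
    (S.isEquivariant_edgeRight X L hs)).conv_mul (S.isEquivariant_vertexOp_edgeMid X L hs)

end VertexEdge

end SlotSystem

/-! ### The holonomy of a plaquette -/

theorem commute_of_commute_convConst {C B : Type*} [AddCommGroup C] [Module ℂ C] [Coalgebra ℂ C]
    [Ring B] [Algebra ℂ B] {b : B} {f : WithConv (C →ₗ[ℂ] B)} (h : Commute (convConst C b) f)
    (c : C) : Commute b (f c) := by
  have h1 := congrArg (fun f => f.ofConv c) h.eq
  change (convConst C b * f) c = (f * convConst C b) c at h1
  rwa [convConst_mul_apply, mul_convConst_apply] at h1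

namespace SlotSystem

open HopfCrossedModule

variable {L0 L1 L2 A H B : Type*} [Ring A] [HopfAlgebra ℂ A] [Ring H] [HopfAlgebra ℂ H] [Ring B]
  [Algebra ℂ B] [FiniteDimensional ℂ H] [FiniteDimensional ℂ A] [IsSemisimpleRing H]
  (S : SlotSystem L1 L2 A H B) (X : HopfCrossedModule A H)
  [Fintype L1] [DecidableEq L1] (L : CellDecomposition L0 L1 L2)

theorem convLeft_edgeOp (e : L1) :
    convLeft H (toConv (S.edgeOp X L e)) = convLeft H (toConv (S.edgeLeft X L e)) *
      convLeft H (toConv (S.edgeRight X L e)) * convLeft H (toConv (S.edgeMid X e)) := by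
  rw [← convLeft_mul, ← convLeft_mul]
  rfl

/-- A holonomy commutes with the action of an edge operator on another plaquette. The edge operator
only reads the edges of the boundary, and readings used to act on `A` commute with all other
readings. -/
theorem commute_hol_edgeLeft {e : L1} {p : L2} (h : p ≠ L.left (e, true)) (a : A) :
    Commute (S.hol X L p) (S.edgeLeft X L e a ⊗ₜ 1) :=
  (S.commute_list_map_dart fun _ _ => S.commute_alongPath_tmul_one X
    (fun _ => S.commute_dart_plaq _ _ _)
    (fun _ _ => S.legsCommute_dart_actLeg_dart X _ _) a).mul_left
    (S.commute_alongPath_tmul_one X (fun _ => S.commute_plaqRead_plaq X h _)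
      (fun _ _ => S.legsCommute_plaqRead_actLeg_dart X _ _) a)

theorem commute_hol_edgeRight {e : L1} {p : L2} (h : p ≠ L.left (e, false)) (a : A) :
    Commute (S.hol X L p) (S.edgeRight X L e a ⊗ₜ 1) :=
  (S.commute_list_map_dart fun _ _ => S.commute_alongPath_tmul_one X
    (fun _ => S.commute_dart_plaq _ _ _)
    (fun _ _ => S.legsCommute_dart_actLeg_dart X _ _) a).mul_left
    (S.commute_alongPath_tmul_one X (fun _ => S.commute_plaqRead_plaq X h _)
      (fun _ _ => S.legsCommute_plaqRead_actLeg_dart X _ _) a)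

/-- The edge operators at the base-point of `P`, for an edge oriented counter-clockwise around `P`,
intertwine the holonomy. -/
theorem intertwines_hol_edgeOp {e : L1} (hb : L.base (L.left (e, true)) = L.src (e, true)) :
    Intertwines (S.hol X L (L.left (e, true))) X.bd.toCoalgHom.toLinearMap (S.edgeOp X L e) := by
  obtain ⟨m, y, hm, -⟩ := L.exists_boundary_eq (c := (e, true)) hb.symm
  have hp := L.boundary_pairwise (L.left (e, true))
  rw [hm, List.pairwise_cons] at hp
  have h0 := fun a => S.commute_hol_edgeRight X L (L.left_not_ne (e, false)) a
  have h1 : S.hol X L (L.left (e, true)) = S.dart (e, true) * ((m ++ [y]).map S.dart).prod *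
      S.plaqRead X (L.left (e, true)) := by
    rw [hol, hm, List.map_cons, List.prod_cons]
  unfold Intertwines
  simp only [Bool.not_false] at h0
  rw [h1] at h0 ⊢
  rw [convLeft_edgeOp, S.edgeLeft_eq_mulLeft X L hb.symm, convConst_mul, convConst_mul]
  refine intertwine_of_ends (S.plaqRead_mul_mulLeft X _) (S.dart_true_mul_edgeMid X e) ?_ ?_ ?_
  · rw [← convConst_mul]
    exact commute_convConst fun a => (S.commute_dart_plaq _ _ _).mul_left
      (S.commute_list_map_dart fun _ _ => S.commute_dart_plaq _ _ _)
  · rw [← convConst_mul, ← convConst_mul]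
    exact commute_convConst h0
  · rw [← convConst_mul]
    exact commute_convConst fun a => (S.commute_list_map_dart fun d hd =>
      S.commute_dart_edge (hp.1 d hd).symm _).mul_left (S.commute_plaqRead_edge X _ _ _)

/-- The edge operators at the base-point of `P`, for an edge oriented clockwise around `P`, commute
with the holonomy: what they produce on the edge is absorbed by the plaquette. -/
theorem commute_hol_edgeOp {e : L1} (hb : L.base (L.left (e, false)) = L.src (e, true)) (a : A) :
    Commute (S.hol X L (L.left (e, false))) (S.edgeOp X L e a ⊗ₜ 1) := by
  -- `e` is the last edge of the boundary, traversed backwards, and its starting vertex is the base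
  -- point, so that no edge is carried along on the right
  have hc : L.left (L.face (e, false)) = L.left (e, false) := L.left_face _
  obtain ⟨m, y, hm, hy⟩ := L.exists_boundary_eq (c := L.face (e, false))
    (by rw [hc, hb]; exact L.src_face _)
  rw [hc, L.face.injective hy, ← List.cons_append] at hm
  generalize L.face (e, false) :: m = t at hm
  have hp := L.boundary_pairwise (L.left (e, false))
  rw [hm, List.pairwise_append] at hp
  have h0 : Commute (convConst A (S.hol X L (L.left (e, false))))
      (convLeft H (toConv (S.edgeLeft X L e))) :=
    commute_convConst fun a => S.commute_hol_edgeLeft X L (L.left_not_ne (e, true)) a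
  suffices h : Commute (convConst A (S.hol X L (L.left (e, false))))
      (convLeft H (toConv (S.edgeOp X L e))) by
    exact commute_of_commute_convConst h a
  rw [convLeft_edgeOp, mul_assoc]
  refine h0.mul_right ?_
  rw [S.edgeRight_eq_mulRightAntipode X L hb.symm, hol, hm, List.map_append, List.prod_append,
    List.map_cons, List.map_nil, List.prod_singleton, convConst_mul, convConst_mul]
  have h1 : Commute (convConst A (t.map S.dart).prod * convConst A (S.dart (e, false)))
      (convLeft H (toConv (S.mulRightAntipode (L.left (e, false))))) := by
    rw [← convConst_mul]
    exact commute_convConst fun a => (S.commute_list_map_dart fun _ _ =>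
      S.commute_dart_plaq _ _ _).mul_left (S.commute_dart_plaq _ _ _)
  have h2 : Commute (convConst A (t.map S.dart).prod) (convLeft H (toConv (S.edgeMid X e))) :=
    commute_convConst fun a => S.commute_list_map_dart fun d hd =>
      S.commute_dart_edge (hp.2.2 d hd (e, false) (by simp)) _
  have h3 : Commute (convConst A (S.plaqRead X (L.left (e, false))))
      (convLeft H (toConv (S.edgeMid X e))) :=
    commute_convConst fun a => S.commute_plaqRead_edge X _ _ _
  have h4 := S.dart_false_mul_edgeMid X e
  have h5 := S.plaqRead_mul_mulRightAntipode X (L.left (e, false))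
  generalize convConst A (S.plaqRead X (L.left (e, false))) = r at *
  generalize convConst A (t.map S.dart).prod = s at *
  generalize convConst A (S.dart (e, false)) = u at *
  generalize convLeft H (toConv (S.mulRightAntipode (L.left (e, false)))) = R at *
  generalize convLeft H (toConv (S.edgeMid X e)) = M at *
  generalize convRight B (toConv X.bd.toCoalgHom.toLinearMap) = g at *
  calc s * u * r * (R * M) = s * u * (r * R) * M := by simp only [mul_assoc]
    _ = (s * u * R) * g * (r * M) := by rw [h5]; simp only [mul_assoc]
    _ = R * s * (u * (g * M)) * r := by rw [h1.eq, h3.eq]; simp only [mul_assoc]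
    _ = R * (s * M) * u * r := by rw [h4]; simp only [mul_assoc]
    _ = R * M * (s * u * r) := by rw [h2.eq]; simp only [mul_assoc]

variable [Fintype L2] [DecidableEq L0]

theorem commute_convLeft_baseFactors (v : L0) {Y : WithConv (H →ₗ[ℂ] B ⊗[ℂ] H)}
    (hY : ∀ q x f, Commute (Y x) (S.plaq q f ⊗ₜ 1)) :
    Commute Y (convLeft H (S.baseFactors X L v).prod) := by
  rw [convLeft_list_prod]
  refine Commute.list_prod_right _ _ fun Z hZ => ?_
  simp only [baseFactors, List.map_map, List.mem_map] at hZ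
  obtain ⟨q, -, rfl⟩ := hZ
  exact S.commute_convLeft_plaqAct X q fun x y => hY q x _

/-- The reading of a plaquette commutes with `h₁ ⊗ U h₂`, where `U` is the part of a vertex operator
at the base-point of this plaquette that acts on plaquettes. -/
theorem commute_plaqRead_baseFactors {v : L0} {p : L2} (hp : L.base p = v) :
    Commute (convConst H (S.plaqRead X p)) (convRight B (toConv LinearMap.id) *
      convLeft H (S.baseFactors X L v).prod) := by
  have h : ∀ l : List L2, p ∉ l → Commute (convConst H (S.plaqRead X p))
      (convLeft H (l.map fun q => toConv (S.plaqAct X q)).prod) := fun l hl => by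
    rw [convLeft_list_prod]
    refine Commute.list_prod_right _ _ fun Y hY => ?_
    simp only [List.map_map, List.mem_map] at hY
    obtain ⟨q, hq, rfl⟩ := hY
    exact commute_convConst fun x =>
      S.commute_plaqRead_plaq X (fun h => hl (by rw [h]; exact hq)) _
  have h' : ∀ l : List L2, Commute (convRight B (toConv LinearMap.id))
      (convLeft H (l.map fun q => toConv (S.plaqAct X q)).prod) := fun l => by
    rw [convLeft_list_prod]
    refine Commute.list_prod_right _ _ fun Y hY => ?_
    simp only [List.map_map, List.mem_map] at hY
    obtain ⟨q, -, rfl⟩ := hY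
    refine S.commute_convLeft_plaqAct X q fun x y => ?_
    simp [convRight_apply, Commute, SemiconjBy]
  have hn := Finset.nodup_toList (Finset.univ.filter fun q : L2 => L.base q = v)
  have hmem : p ∈ (Finset.univ.filter fun q : L2 => L.base q = v).toList := by simpa using hp
  unfold baseFactors
  obtain ⟨s, t, hst⟩ := List.append_of_mem hmem
  rw [hst, List.nodup_append, List.nodup_cons] at hn
  rw [hst, List.map_append, List.prod_append, List.map_cons, List.prod_cons, convLeft_mul,
    convLeft_mul, ← mul_assoc, (h' s).eq, mul_assoc, ← mul_assoc (convRight _ _)]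
  exact (h s fun hps => hn.2.2 p hps p (by simp) rfl).mul_right
    ((S.commute_plaqRead_plaqAct X p).mul_right (h t hn.2.1.1))

/-- The part of a vertex operator that acts on the edges intertwines the reading along the boundary
of a plaquette with this base-point. -/
theorem intertwines_starFactors {e : L1} (hb : L.base (L.left (e, true)) = L.src (e, true))
    (hs : L.IsSite (L.src (e, true)) (L.left (e, true))) :
    Intertwines ((L.boundary (L.left (e, true))).map S.dart).prod LinearMap.id
      (S.starFactors L (L.src (e, true)) (L.left (e, true)) hs).prod.ofConv := by
  obtain ⟨m, y, hm, hy⟩ := L.exists_boundary_eq (c := (e, true)) hb.symm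
  obtain ⟨n, hn⟩ := L.exists_star_eq hy hs
  have hp := L.boundary_pairwise (L.left (e, true))
  have hq := L.star_pairwise hs
  have hleft : ∀ x ∈ m ++ [y], L.left x = L.left (e, true) := fun x hx =>
    L.mem_boundary.1 (by rw [hm]; exact List.mem_cons_of_mem _ hx)
  have hsrc : ∀ w ∈ n, L.src w = L.src (e, true) := fun w hw =>
    (L.mem_star hs).1 (by rw [hn]; simp [hw])
  rw [hm, List.pairwise_cons, List.pairwise_append] at hp
  rw [hn, List.pairwise_cons, List.pairwise_append] at hq
  -- the boundary and the star of a site have only the two edges next to the plaquette in common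
  have hne : ∀ w ∈ n, ∀ x, L.left x = L.left (e, true) → x.1 ≠ w.1 := by
    intro w hw x hx h
    rcases L.eq_or_face_eq hx (hsrc w hw) h.symm with h1 | h1
    · exact hq.2.2.2 w hw (e, true) (by simp) (by rw [← h, h1])
    · rw [← L.face.injective (h1.trans hy.symm)] at hq
      exact hq.1 w (by simp [hw]) h
  unfold Intertwines starFactors
  rw [hn, hm]
  simp only [List.map_cons, List.map_append, List.map_nil, List.prod_cons, List.prod_append,
    List.prod_nil, mul_one, toConv_ofConv]
  rw [← mul_assoc (S.dart _), ← mul_assoc (toConv (S.dartAct _)), convConst_mul, convConst_mul,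
    convLeft_mul, convLeft_mul]
  refine intertwine_of_ends (S.dart_mul_dartAct y) (S.dart_true_mul_dartAct e) ?_ ?_ ?_
  · rw [← convConst_mul]
    exact commute_convConst fun x => (S.commute_dart_edge (hp.1 y (by simp)) _).mul_left
      (S.commute_list_map_dart fun d hd => S.commute_dart_edge (hp.2.2.2 d hd y (by simp)) _)
  · rw [← convConst_mul, ← convConst_mul, convLeft_list_prod]
    refine Commute.list_prod_right _ _ fun Z hZ => ?_
    simp only [List.map_map, List.mem_map] at hZ
    obtain ⟨w, hw, rfl⟩ := hZ
    exact commute_convConst fun x => ((S.commute_dart_edge (hne w hw _ rfl) _).mul_left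
      (S.commute_list_map_dart fun d hd => S.commute_dart_edge
        (hne w hw d (hleft d (by simp [hd]))) _)).mul_left
          (S.commute_dart_edge (hne w hw y (hleft y (by simp))) _)
  · rw [← convConst_mul]
    exact commute_convConst fun x => (S.commute_list_map_dart fun d hd => S.commute_dart_edge
      (hp.1 d (by simp [hd])).symm _).mul_left (S.commute_dart_edge (hp.1 y (by simp)).symm _)

/-- The vertex operators at the base-point of a plaquette intertwine the holonomy. -/
theorem intertwines_hol_vertexOp {e : L1} (hb : L.base (L.left (e, true)) = L.src (e, true))
    (hs : L.IsSite (L.src (e, true)) (L.left (e, true))) :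
    Intertwines (S.hol X L (L.left (e, true))) LinearMap.id
      (S.vertexOp X L (L.src (e, true)) (L.left (e, true)) hs) := by
  have h1 := S.intertwines_starFactors L hb hs
  have h2 := S.commute_plaqRead_baseFactors X L hb
  unfold Intertwines hol vertexOp at *
  rw [toConv_ofConv] at h1 ⊢
  rw [List.prod_append, convLeft_mul, convConst_mul]
  have h3 : Commute (convConst H (S.plaqRead X (L.left (e, true))))
      (convLeft H (S.starFactors L (L.src (e, true)) (L.left (e, true)) hs).prod) := by
    rw [convLeft_list_prod]
    refine Commute.list_prod_right _ _ fun Z hZ => ?_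
    simp only [starFactors, List.map_map, List.mem_map] at hZ
    obtain ⟨w, -, rfl⟩ := hZ
    exact commute_convConst fun x => S.commute_plaqRead_edge X _ _ _
  have h4 : Commute (convLeft H (S.starFactors L (L.src (e, true)) (L.left (e, true)) hs).prod)
      (convLeft H (S.baseFactors X L (L.src (e, true))).prod) := by
    rw [convLeft_list_prod]
    refine Commute.list_prod_left _ _ fun Z hZ => ?_
    simp only [starFactors, List.map_map, List.mem_map] at hZ
    obtain ⟨w, -, rfl⟩ := hZ
    refine S.commute_convLeft_baseFactors X L _ fun q x f => ?_
    rw [Function.comp_apply, convLeft_apply, commute_iff_eq]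
    simp only [Algebra.TensorProduct.tmul_mul_tmul]
    exact congrArg (· ⊗ₜ[ℂ] (1 * 1 : H)) (S.edge_plaq_commute _ _ _ _).eq
  have h5 : Commute (convRight B (toConv LinearMap.id))
      (convLeft H (S.baseFactors X L (L.src (e, true))).prod) :=
    S.commute_convLeft_baseFactors X L _ fun q x f => by
      simp [convRight_apply, Commute, SemiconjBy]
  have h6 : Commute (convConst H ((L.boundary (L.left (e, true))).map S.dart).prod)
      (convLeft H (S.baseFactors X L (L.src (e, true))).prod) := by
    rw [convLeft_list_prod]
    refine Commute.list_prod_right _ _ fun Z hZ => ?_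
    simp only [baseFactors, List.map_map, List.mem_map] at hZ
    obtain ⟨q, -, rfl⟩ := hZ
    exact commute_convConst fun x => S.commute_list_map_dart fun _ _ => S.commute_dart_plaq _ _ _
  generalize convConst H (S.plaqRead X (L.left (e, true))) = r at *
  generalize convConst H ((L.boundary (L.left (e, true))).map S.dart).prod = s at *
  generalize convLeft H (S.starFactors L (L.src (e, true)) (L.left (e, true)) hs).prod = V at *
  generalize convLeft H (S.baseFactors X L (L.src (e, true))).prod = U at *
  generalize convRight B (toConv (LinearMap.id : H →ₗ[ℂ] H)) = g at *
  calc s * r * (g * (V * U)) = s * (r * (g * U)) * V := by rw [h4.eq]; simp only [mul_assoc]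
    _ = s * (g * U) * (r * V) := by rw [h2.eq]; simp only [mul_assoc]
    _ = (s * U) * g * V * r := by rw [h5.eq, h3.eq]; simp only [mul_assoc]
    _ = U * (s * (g * V)) * r := by rw [h6.eq]; simp only [mul_assoc]
    _ = U * V * g * s * r := by rw [h1]; simp only [mul_assoc]
    _ = V * (U * g) * s * r := by rw [← h4.eq]; simp only [mul_assoc]
    _ = V * U * g * (s * r) := by simp only [mul_assoc]

end SlotSystem

/-! ### Representations of the algebra of local operators -/

section TensorCoalgebra

variable (C D : Type*) {B H : Type*} [AddCommGroup C] [Module ℂ C] [Coalgebra ℂ C]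
  [AddCommGroup D] [Module ℂ D] [Coalgebra ℂ D] [Ring B] [Algebra ℂ B] [Ring H] [HopfAlgebra ℂ H]

/-- The morphism of coalgebras `c ⊗ d ↦ ε(d) c`. -/
def tensorFst : C ⊗[ℂ] D →ₗc[ℂ] C :=
  (Coalgebra.TensorProduct.rid ℂ ℂ C).toCoalgHom.comp
    (Coalgebra.TensorProduct.map (CoalgHom.id ℂ C) (counitCoalgHom ℂ D))

/-- The morphism of coalgebras `c ⊗ d ↦ ε(c) d`. -/
def tensorSnd : C ⊗[ℂ] D →ₗc[ℂ] D :=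
  (Coalgebra.TensorProduct.lid ℂ D).toCoalgHom.comp
    (Coalgebra.TensorProduct.map (counitCoalgHom ℂ C) (CoalgHom.id ℂ D))

variable {C D}

theorem convComp_tensorFst_apply (Y : C →ₗ[ℂ] B) (c : C) (d : D) :
    convComp B (tensorFst C D) (toConv Y) (c ⊗ₜ d) = counit (R := ℂ) d • Y c :=
  map_smul Y _ _

theorem convComp_tensorSnd_apply (Z : D →ₗ[ℂ] B) (c : C) (d : D) :
    convComp B (tensorSnd C D) (toConv Z) (c ⊗ₜ d) = counit (R := ℂ) c • Z d :=
  map_smul Z _ _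

theorem sum_counit_right_smul (c : C) :
    ∑ i ∈ (ℛ ℂ c).index, counit (R := ℂ) ((ℛ ℂ c).right i) • (ℛ ℂ c).left i = c := by
  have h := congrArg (TensorProduct.rid ℂ C) (sum_tmul_counit_eq (ℛ ℂ c))
  simpa only [map_sum, TensorProduct.rid_tmul, one_smul] using h

theorem convComp_tensorFst_mul_tensorSnd (Y : C →ₗ[ℂ] B) (Z : D →ₗ[ℂ] B) :
    convComp B (tensorFst C D) (toConv Y) * convComp B (tensorSnd C D) (toConv Z) =
      toConv (LinearMap.mul' ℂ B ∘ₗ TensorProduct.map Y Z) := by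
  refine WithConv.ofConv_injective (TensorProduct.ext' fun c d => ?_)
  change (convComp B (tensorFst C D) (toConv Y) * convComp B (tensorSnd C D) (toConv Z)) (c ⊗ₜ d) =
    Y c * Z d
  simp only [convMul_tmul_apply, convComp_tensorFst_apply, convComp_tensorSnd_apply]
  conv_rhs => rw [← sum_counit_right_smul c, ← sum_counit_smul (ℛ ℂ d)]
  simp [Finset.sum_mul_sum, smul_smul, mul_comm]

theorem commute_convComp_tensorFst_tensorSnd {Y : C →ₗ[ℂ] B} {Z : D →ₗ[ℂ] B}
    (h : ∀ c d, Commute (Y c) (Z d)) : Commute (convComp B (tensorFst C D) (toConv Y))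
      (convComp B (tensorSnd C D) (toConv Z)) := by
  refine (convComp_tensorFst_mul_tensorSnd Y Z).trans
    (WithConv.ofConv_injective (TensorProduct.ext' fun c d => ?_))
  change Y c * Z d =
    (convComp B (tensorSnd C D) (toConv Z) * convComp B (tensorFst C D) (toConv Y)) (c ⊗ₜ d)
  simp only [convMul_tmul_apply, convComp_tensorFst_apply, convComp_tensorSnd_apply]
  rw [(h c d).eq]
  conv_lhs => rw [← sum_counit_right_smul d, ← sum_counit_smul (ℛ ℂ c)]
  simp only [map_sum, map_smul, Finset.sum_mul_sum, smul_mul_smul_comm]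
  rw [Finset.sum_comm]
  simp only [mul_comm]

/-- Two families that intertwine the same reading combine to one indexed by the tensor product. -/
theorem Intertwines.tensor {r : B ⊗[ℂ] H} {g : C →ₗ[ℂ] H} {g' : D →ₗ[ℂ] H} {Y : C →ₗ[ℂ] B}
    {Z : D →ₗ[ℂ] B} (h : Intertwines r g Y) (h' : Intertwines r g' Z) :
    Intertwines r (LinearMap.mul' ℂ H ∘ₗ TensorProduct.map g g')
      (LinearMap.mul' ℂ B ∘ₗ TensorProduct.map Y Z) := by
  unfold Intertwines at *
  have h1 := congrArg (convComp (B ⊗[ℂ] H) (tensorFst C D)) h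
  have h2 := congrArg (convComp (B ⊗[ℂ] H) (tensorSnd C D)) h'
  simp only [map_mul, convComp_convConst] at h1 h2
  rw [← convComp_tensorFst_mul_tensorSnd, ← convComp_tensorFst_mul_tensorSnd, convLeft_mul,
    convRight_mul]
  have h3 : Commute (convComp (B ⊗[ℂ] H) (tensorFst C D) (convLeft H (toConv Y)))
      (convComp (B ⊗[ℂ] H) (tensorSnd C D) (convRight B (toConv g'))) :=
    commute_convComp_tensorFst_tensorSnd fun c d => by
      simp [Commute, SemiconjBy]
  have h4 : Commute (convComp (B ⊗[ℂ] H) (tensorFst C D) (convRight B (toConv g)))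
      (convComp (B ⊗[ℂ] H) (tensorSnd C D) (convLeft H (toConv Z))) :=
    commute_convComp_tensorFst_tensorSnd fun c d => by
      simp [Commute, SemiconjBy]
  change _ * (convComp (B ⊗[ℂ] H) (tensorFst C D) (convRight B (toConv g)) *
    convComp (B ⊗[ℂ] H) (tensorSnd C D) (convRight B (toConv g')) *
    (convComp (B ⊗[ℂ] H) (tensorFst C D) (convLeft H (toConv Y)) *
    convComp (B ⊗[ℂ] H) (tensorSnd C D) (convLeft H (toConv Z)))) =
    convComp (B ⊗[ℂ] H) (tensorFst C D) (convLeft H (toConv Y)) *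
    convComp (B ⊗[ℂ] H) (tensorSnd C D) (convLeft H (toConv Z)) *
    (convComp (B ⊗[ℂ] H) (tensorFst C D) (convRight B (toConv g)) *
    convComp (B ⊗[ℂ] H) (tensorSnd C D) (convRight B (toConv g'))) * _
  generalize convConst (C ⊗[ℂ] D) r = s at *
  generalize convComp (B ⊗[ℂ] H) (tensorFst C D) (convRight B (toConv g)) = g₁ at *
  generalize convComp (B ⊗[ℂ] H) (tensorSnd C D) (convRight B (toConv g')) = g₂ at *
  generalize convComp (B ⊗[ℂ] H) (tensorFst C D) (convLeft H (toConv Y)) = y at *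
  generalize convComp (B ⊗[ℂ] H) (tensorSnd C D) (convLeft H (toConv Z)) = z at *
  calc s * (g₁ * g₂ * (y * z)) = s * (g₁ * (y * g₂)) * z := by rw [h3.eq]; simp only [mul_assoc]
    _ = (s * (g₁ * y)) * (g₂ * z) := by simp only [mul_assoc]
    _ = y * g₁ * (s * (g₂ * z)) := by rw [h1]; simp only [mul_assoc]
    _ = y * (g₁ * z) * g₂ * s := by rw [h2]; simp only [mul_assoc]
    _ = y * z * (g₁ * g₂) * s := by rw [h4.eq]; simp only [mul_assoc]

end TensorCoalgebra

section Double

variable {C H : Type*} [Ring H] [HopfAlgebra ℂ H] [AddCommGroup C] [Module ℂ C] [Coalgebra ℂ C]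

theorem doubleMul_tmul (f g : C →ₗ[ℂ] H) (m : C ⊗[ℂ] C →ₗ[ℂ] C) (φ ψ : Module.Dual ℂ H) (u w : C) :
    doubleMul f g m ((φ ⊗ₜ u) ⊗ₜ (ψ ⊗ₜ w)) =
      TensorProduct.map (dualMul H ∘ₗ TensorProduct.mk ℂ _ _ φ)
        (m ∘ₗ (TensorProduct.mk ℂ C C).flip w) (twist f g (ψ ⊗ₜ u)) := by
  simp only [doubleMul, LinearMap.comp_apply, LinearEquiv.coe_coe, TensorProduct.assoc_tmul,
    LinearMap.lTensor_tmul, TensorProduct.assoc_symm_tmul, LinearMap.rTensor_tmul,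
    TensorProduct.comm_tmul]
  generalize twist f g (ψ ⊗ₜ u) = t
  induction t with
  | zero => simp
  | tmul χ x => rfl
  | add x y hx hy => simp only [TensorProduct.add_tmul, TensorProduct.tmul_add, map_add, hx, hy]

end Double

section LocalModel

variable {A H : Type*} [Ring A] [HopfAlgebra ℂ A] [Ring H] [HopfAlgebra ℂ H]

namespace HopfCrossedModule

variable (X : HopfCrossedModule A H)

theorem crossedMul_tmul (a b : A) (h k : H) : X.crossedMul ((a ⊗ₜ h) ⊗ₜ (b ⊗ₜ k)) =
    ∑ i ∈ (ℛ ℂ h).index, (a * X.act ((ℛ ℂ h).left i) b) ⊗ₜ[ℂ] ((ℛ ℂ h).right i * k) := by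
  simp only [crossedMul, TensorProduct.lift.tmul, LinearMap.compl₁₂_apply, LinearMap.comp_apply,
    LinearMap.mul_apply']
  conv_lhs => rw [← (ℛ ℂ h).eq]
  simp only [map_sum, TensorProduct.map₂_apply_tmul, LinearMap.sum_apply, Module.End.mul_apply,
    TensorProduct.map_tmul]
  rfl

theorem proj_eq : X.proj = LinearMap.mul' ℂ H ∘ₗ
    TensorProduct.map X.bd.toCoalgHom.toLinearMap LinearMap.id := rfl

theorem proj_tmul (a : A) (h : H) : X.proj (a ⊗ₜ h) = X.bd a * h := rfl

theorem comul_proj (u : A ⊗[ℂ] H) :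
    comul (R := ℂ) (X.proj u) = TensorProduct.map X.proj X.proj (comul (R := ℂ) u) := by
  induction u with
  | zero => simp
  | add x y hx hy => simp only [map_add, hx, hy]
  | tmul a h =>
    rw [proj_tmul, Bialgebra.comul_mul, comul_tmul_eq_sum, ← toCoalgHom_bd_apply]
    have h1 := X.comul_bd a
    change comul (R := ℂ) (X.bd.toCoalgHom a) = _ at h1
    rw [h1, ← (ℛ ℂ a).eq, ← (ℛ ℂ h).eq]
    simp only [map_sum, TensorProduct.map_tmul, Finset.sum_mul_sum,
      Algebra.TensorProduct.tmul_mul_tmul]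
    rfl

theorem counit_proj (u : A ⊗[ℂ] H) : counit (R := ℂ) (X.proj u) = counit (R := ℂ) u := by
  induction u with
  | zero => simp
  | add x y hx hy => simp only [map_add, hx, hy]
  | tmul a h =>
    have h1 := X.counit_bd a
    change counit (R := ℂ) (X.bd a) = _ at h1
    rw [proj_tmul, Bialgebra.counit_mul, h1, TensorProduct.counit_tmul, smul_eq_mul, mul_comm]

end HopfCrossedModule

/-- Operators `F φ`, `E a`, `V h` in an algebra `B` with the relations of the algebra of local
operators; the operators `F φ` are obtained from a reading `r` by `F φ = (id ⊗ φ) r`. -/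
structure LocalModel (X : HopfCrossedModule A H) (B : Type*) [Ring B] [Algebra ℂ B] where
  /-- the reading that defines the operators `F φ` -/
  reading : B ⊗[ℂ] H
  /-- the operators `E a` -/
  edge : A →ₗ[ℂ] B
  /-- the operators `V h` -/
  vertex : H →ₗ[ℂ] B
  evalDual_counit : evalDual B H counit reading = 1
  evalDual_dualMul : ∀ φ ψ, evalDual B H (dualMul H (φ ⊗ₜ ψ)) reading =
    evalDual B H φ reading * evalDual B H ψ reading
  isRep_edge : IsRep edge
  isRep_vertex : IsRep vertex
  isEquivariant : IsEquivariant X (toConv vertex) edge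
  intertwines_edge : Intertwines reading X.bd.toCoalgHom.toLinearMap edge
  intertwines_vertex : Intertwines reading LinearMap.id vertex

namespace LocalModel

variable {B : Type*} [Ring B] [Algebra ℂ B] {X : HopfCrossedModule A H} (M : LocalModel X B)

/-- The representation `a ⊗ h ↦ E a V h` of the crossed product. -/
def crossedRep : A ⊗[ℂ] H →ₗ[ℂ] B := LinearMap.mul' ℂ B ∘ₗ TensorProduct.map M.edge M.vertex

theorem crossedRep_tmul (a : A) (h : H) : M.crossedRep (a ⊗ₜ h) = M.edge a * M.vertex h := rfl

/-- The representation `φ ⊗ (a ⊗ h) ↦ F φ E a V h` of the algebra of local operators. -/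
def rep : Module.Dual ℂ H ⊗[ℂ] (A ⊗[ℂ] H) →ₗ[ℂ] B :=
  LinearMap.mul' ℂ B ∘ₗ TensorProduct.map ((evalDual B H).flip M.reading) M.crossedRep

theorem rep_tmul (φ : Module.Dual ℂ H) (u : A ⊗[ℂ] H) :
    M.rep (φ ⊗ₜ u) = evalDual B H φ M.reading * M.crossedRep u := rfl

theorem vertex_mul_edge (h : H) (a : A) : M.vertex h * M.edge a =
    ∑ i ∈ (ℛ ℂ h).index, M.edge (X.act ((ℛ ℂ h).left i) a) * M.vertex ((ℛ ℂ h).right i) := by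
  have h1 := congrArg (fun f => f.ofConv h) (M.isEquivariant a)
  change (toConv M.vertex * convConst H (M.edge a)) h =
    (toConv _ * toConv M.vertex : WithConv (H →ₗ[ℂ] B)) h at h1
  rw [mul_convConst_apply, (ℛ ℂ h).convMul_apply] at h1
  exact h1

theorem crossedRep_crossedMul (u w : A ⊗[ℂ] H) :
    M.crossedRep (X.crossedMul (u ⊗ₜ w)) = M.crossedRep u * M.crossedRep w := by
  induction u with
  | zero => simp
  | add x y hx hy => simp only [TensorProduct.add_tmul, map_add, add_mul, hx, hy]
  | tmul a h =>
    induction w with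
    | zero => simp
    | add x y hx hy => simp only [TensorProduct.tmul_add, map_add, mul_add, hx, hy]
    | tmul b k =>
      rw [X.crossedMul_tmul, map_sum, crossedRep_tmul, crossedRep_tmul, mul_assoc,
        ← mul_assoc (M.vertex h), vertex_mul_edge, Finset.sum_mul, Finset.mul_sum]
      simp only [crossedRep_tmul, M.isRep_edge.2, M.isRep_vertex.2, mul_assoc]

variable [FiniteDimensional ℂ H] [IsSemisimpleRing H]

theorem rep_twist (φ : Module.Dual ℂ H) (u : A ⊗[ℂ] H) :
    M.rep (twist (HopfAlgebra.antipode ℂ ∘ₗ X.proj) X.proj (φ ⊗ₜ u)) =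
      M.crossedRep u * evalDual B H φ M.reading :=
  Intertwines.twist (antipode_antipode H)
    (by rw [X.proj_eq]; exact M.intertwines_edge.tensor M.intertwines_vertex) X.comul_proj
    X.counit_proj φ u

theorem rep_localMul (x y : Module.Dual ℂ H ⊗[ℂ] (A ⊗[ℂ] H)) :
    M.rep (X.localMul (x ⊗ₜ y)) = M.rep x * M.rep y := by
  induction x with
  | zero => simp
  | add x y hx hy => simp only [TensorProduct.add_tmul, map_add, add_mul, hx, hy]
  | tmul φ u =>
    induction y with
    | zero => simp
    | add x y hx hy => simp only [TensorProduct.tmul_add, map_add, mul_add, hx, hy]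
    | tmul ψ w =>
      rw [HopfCrossedModule.localMul, doubleMul_tmul, rep_tmul, rep_tmul, mul_assoc,
        ← mul_assoc (M.crossedRep u), ← rep_twist]
      generalize twist (HopfAlgebra.antipode ℂ ∘ₗ X.proj) X.proj (ψ ⊗ₜ u) = t
      induction t with
      | zero => simp
      | add x y hx hy => simp only [map_add, mul_add, add_mul, hx, hy]
      | tmul χ x =>
        rw [TensorProduct.map_tmul, rep_tmul, rep_tmul]
        change evalDual B H (dualMul H (φ ⊗ₜ χ)) M.reading *
          M.crossedRep (X.crossedMul (x ⊗ₜ w)) = _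
        rw [M.evalDual_dualMul, crossedRep_crossedMul]
        simp only [mul_assoc]

theorem rep_one : M.rep (counit ⊗ₜ (1 ⊗ₜ 1)) = 1 := by
  rw [rep_tmul, M.evalDual_counit, crossedRep_tmul, M.isRep_edge.1, M.isRep_vertex.1]
  simp

end LocalModel

end LocalModel

/-! ### The regular representation of the algebra of local operators -/

section DualBasis

variable {B H : Type*} [Ring B] [Algebra ℂ B] [Ring H] [HopfAlgebra ℂ H] [FiniteDimensional ℂ H]

/-- The element `r` of `B ⊗ H` with `(id ⊗ φ) r = F φ`. -/
def dualReading (F : Module.Dual ℂ H →ₗ[ℂ] B) : B ⊗[ℂ] H :=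
  ∑ i, F ((Module.finBasis ℂ H).coord i) ⊗ₜ Module.finBasis ℂ H i

theorem evalDual_dualReading (F : Module.Dual ℂ H →ₗ[ℂ] B) (φ : Module.Dual ℂ H) :
    evalDual B H φ (dualReading F) = F φ := by
  conv_rhs => rw [← (Module.finBasis ℂ H).sum_dual_apply_smul_coord φ, map_sum]
  simp [dualReading]

theorem eq_sum_evalDual_coord (z : B ⊗[ℂ] H) :
    z = ∑ i, evalDual B H ((Module.finBasis ℂ H).coord i) z ⊗ₜ[ℂ] Module.finBasis ℂ H i := by
  induction z with
  | zero => simp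
  | add x y hx hy =>
    simp only [map_add, TensorProduct.add_tmul, Finset.sum_add_distrib, ← hx, ← hy]
  | tmul b x =>
    conv_lhs => rw [← (Module.finBasis ℂ H).sum_repr x, TensorProduct.tmul_sum]
    simp [TensorProduct.smul_tmul']

theorem evalDual_ext {z w : B ⊗[ℂ] H} (h : ∀ φ, evalDual B H φ z = evalDual B H φ w) : z = w := by
  rw [eq_sum_evalDual_coord z, eq_sum_evalDual_coord w]
  simp only [h]

end DualBasis

section DualOperators

variable (H : Type*) [Ring H] [HopfAlgebra ℂ H]

/-- The operators `ψ ↦ ψ(? h)` on `H*`. -/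
def dualMulRight : H →ₗ[ℂ] Module.End ℂ (Module.Dual ℂ H) :=
  LinearMap.mk₂ ℂ (fun h ψ => sandwich H ψ h 1) (by intros; ext; simp)
    (by intros; ext; simp) (by intros; ext; simp) (by intros; ext; simp)

/-- The operators `ψ ↦ ψ(S h ?)` on `H*`. -/
def dualMulLeft : H →ₗ[ℂ] Module.End ℂ (Module.Dual ℂ H) :=
  LinearMap.mk₂ ℂ (fun h ψ => sandwich H ψ 1 (HopfAlgebra.antipode ℂ h))
    (by intros; ext; simp) (by intros; ext; simp) (by intros; ext; simp) (by intros; ext; simp)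

variable {H}

theorem dualMulRight_apply (h : H) (ψ : Module.Dual ℂ H) (x : H) :
    dualMulRight H h ψ x = ψ (x * h) := by
  change ψ (1 * (x * h)) = _
  rw [one_mul]

theorem dualMulLeft_apply (h : H) (ψ : Module.Dual ℂ H) (x : H) :
    dualMulLeft H h ψ x = ψ (HopfAlgebra.antipode ℂ h * x) := by
  change ψ (_ * (x * 1)) = _
  rw [mul_one]

theorem isRep_dualMulRight : IsRep (dualMulRight H) :=
  ⟨by ext; simp [dualMulRight_apply], fun x y => by ext; simp [dualMulRight_apply, mul_assoc]⟩

theorem isRep_dualMulLeft : IsRep (dualMulLeft H) :=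
  ⟨by ext; simp [dualMulLeft_apply], fun x y => by
    ext; simp [dualMulLeft_apply, HopfAlgebra.antipode_mul_antidistrib, mul_assoc]⟩

theorem commute_dualMulLeft_dualMulRight (h k : H) :
    Commute (dualMulLeft H h) (dualMulRight H k) := by
  ext ψ x
  simp [dualMulRight_apply, dualMulLeft_apply, mul_assoc]

variable (H) in
/-- Left multiplication in the dual Hopf algebra. -/
def dualLeft : Module.Dual ℂ H →ₗ[ℂ] Module.End ℂ (Module.Dual ℂ H) :=
  TensorProduct.curry (dualMul H)

theorem dualMul_tmul_apply (φ ψ : Module.Dual ℂ H) (x : H) : dualMul H (φ ⊗ₜ ψ) x =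
    TensorProduct.dualDistrib ℂ H H (φ ⊗ₜ ψ) (comul (R := ℂ) x) := rfl

theorem dualMul_apply (φ ψ : Module.Dual ℂ H) (x : H) : dualMul H (φ ⊗ₜ ψ) x =
    ∑ i ∈ (ℛ ℂ x).index, φ ((ℛ ℂ x).left i) * ψ ((ℛ ℂ x).right i) := by
  rw [dualMul_tmul_apply, ← (ℛ ℂ x).eq]
  simp

theorem dualMul_assoc (φ ψ χ : Module.Dual ℂ H) :
    dualMul H (dualMul H (φ ⊗ₜ ψ) ⊗ₜ χ) = dualMul H (φ ⊗ₜ dualMul H (ψ ⊗ₜ χ)) := by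
  ext x
  have h := sum_comul_assoc (LinearMap.mk₂ ℂ (fun p q => (φ p * ψ q) • χ)
    (by intros; ext; simp [add_mul]) (by intros; ext; simp [mul_assoc])
    (by intros; ext; simp [mul_add, add_mul]) (by intros; ext; simp; ring)) x
  simpa [dualMul_apply, Finset.sum_mul, Finset.mul_sum, mul_assoc] using h

theorem counit_dualMul (φ : Module.Dual ℂ H) : dualMul H (counit ⊗ₜ φ) = φ := by
  ext x
  conv_rhs => rw [← sum_counit_smul (ℛ ℂ x)]
  simp [dualMul_apply]

theorem dualMul_counit (φ : Module.Dual ℂ H) : dualMul H (φ ⊗ₜ counit) = φ := by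
  ext x
  conv_rhs => rw [← sum_counit_right_smul x]
  simp [dualMul_apply, mul_comm]

variable [FiniteDimensional ℂ H]

/-- `φ(? h₁) ψ(? h₂) = (φ ψ)(? h)` in the dual Hopf algebra, as a property of the reading whose
components are the left multiplications of the dual. -/
theorem dualReading_mul_dualMulRight :
    convConst H (dualReading (dualLeft H)) * (convRight _ (toConv LinearMap.id) *
        convLeft H (toConv (dualMulRight H))) =
      convLeft H (toConv (dualMulRight H)) * convConst H (dualReading (dualLeft H)) := by
  refine conv_ext fun h => evalDual_ext fun φ => ?_
  rw [convConst_mul_apply, mul_convConst_apply, (ℛ ℂ h).convMul_apply, convLeft_apply,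
    evalDual_tmul_one_mul, evalDual_dualReading, Finset.mul_sum, map_sum]
  have h1 : ∀ (x : H) (b : Module.End ℂ (Module.Dual ℂ H)),
      evalDual _ H φ (dualReading (dualLeft H) * ((1 ⊗ₜ x) * (b ⊗ₜ 1))) =
        dualLeft H (sandwich H φ x 1) * b := fun x b => by
    rw [← mul_assoc, evalDual_mul_tmul_one, ← evalDual_dualReading, evalDual_sandwich,
      ← Algebra.TensorProduct.one_def, one_mul]
  simp only [convRight_apply, convLeft_apply, h1]
  ext ψ x
  simp only [LinearMap.sum_apply, Module.End.mul_apply, dualMulRight_apply]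
  change ∑ i ∈ (ℛ ℂ h).index, dualMul H (sandwich H φ ((ℛ ℂ h).left i) 1 ⊗ₜ
    dualMulRight H ((ℛ ℂ h).right i) ψ) x = dualMul H (φ ⊗ₜ ψ) (x * h)
  rw [dualMul_tmul_apply φ ψ, comul_mul_eq_sum, Finset.sum_comm]
  simp [dualMul_apply, dualMulRight_apply]

theorem sum_right_mul_antipode_left [IsSemisimpleRing H] (h : H) :
    ∑ i ∈ (ℛ ℂ h).index, (ℛ ℂ h).right i * HopfAlgebra.antipode ℂ ((ℛ ℂ h).left i) =
      counit (R := ℂ) h • (1 : H) := by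
  have h := congrArg (HopfAlgebra.antipode ℂ) (HopfAlgebra.sum_mul_antipode_eq_smul (ℛ ℂ h))
  simpa [HopfAlgebra.antipode_mul_antidistrib, antipode_antipode] using h

omit [FiniteDimensional ℂ H] in
theorem dualMul_apply_antipode_mul (φ ψ : Module.Dual ℂ H) (y x : H) :
    dualMul H (φ ⊗ₜ ψ) (HopfAlgebra.antipode ℂ y * x) = ∑ j ∈ (ℛ ℂ y).index,
      ∑ k ∈ (ℛ ℂ x).index, φ (HopfAlgebra.antipode ℂ ((ℛ ℂ y).right j) * (ℛ ℂ x).left k) *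
        ψ (HopfAlgebra.antipode ℂ ((ℛ ℂ y).left j) * (ℛ ℂ x).right k) := by
  rw [dualMul_tmul_apply, Bialgebra.comul_mul, ← sum_antipode_tmul_antipode, ← (ℛ ℂ x).eq,
    Finset.sum_mul_sum]
  simp

/-- `φ ψ(S h ?) = (φ(h₂ ?) ψ)(S h₁ ?)`, as a property of the same reading. -/
theorem dualReading_mul_dualMulLeft [IsSemisimpleRing H] :
    convConst H (dualReading (dualLeft H)) * convLeft H (toConv (dualMulLeft H)) =
      convLeft H (toConv (dualMulLeft H)) * convRight _ (toConv LinearMap.id) *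
        convConst H (dualReading (dualLeft H)) := by
  refine conv_ext fun h => evalDual_ext fun φ => ?_
  rw [convConst_mul_apply, mul_convConst_apply, (ℛ ℂ h).convMul_apply, convLeft_apply,
    evalDual_mul_tmul_one, evalDual_dualReading, Finset.sum_mul, map_sum]
  have h1 : ∀ (x : H) (b : Module.End ℂ (Module.Dual ℂ H)),
      evalDual _ H φ (((b ⊗ₜ 1) * (1 ⊗ₜ x)) * dualReading (dualLeft H)) =
        b * dualLeft H (sandwich H φ 1 x) := fun x b => by
    rw [mul_assoc, evalDual_tmul_one_mul, ← evalDual_dualReading, evalDual_sandwich,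
      ← Algebra.TensorProduct.one_def, mul_one]
  simp only [convRight_apply, convLeft_apply, h1]
  ext ψ x
  simp only [LinearMap.sum_apply, Module.End.mul_apply, dualMulLeft_apply]
  change dualMul H (φ ⊗ₜ dualMulLeft H h ψ) x = ∑ i ∈ (ℛ ℂ h).index,
    dualMul H (sandwich H φ 1 ((ℛ ℂ h).right i) ⊗ₜ ψ)
      (HopfAlgebra.antipode ℂ ((ℛ ℂ h).left i) * x)
  simp only [dualMul_apply_antipode_mul, sandwich_apply]
  have key := sum_comul_assoc (LinearMap.mk₂ ℂ (fun p q =>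
      (∑ k ∈ (ℛ ℂ x).index, ψ (HopfAlgebra.antipode ℂ p * (ℛ ℂ x).right k) •
        (φ ∘ₗ LinearMap.mulRight ℂ (HopfAlgebra.antipode ℂ q * (ℛ ℂ x).left k))))
    (by intros; ext; simp [add_mul, Finset.sum_add_distrib])
    (by intros; ext; simp [Finset.mul_sum, mul_assoc])
    (by intros; ext; simp [add_mul, mul_add, Finset.sum_add_distrib, mul_assoc])
    (by intros; ext; simp [Finset.mul_sum, mul_left_comm, mul_assoc])) h
  simp only [LinearMap.mk₂_apply, LinearMap.sum_apply, LinearMap.smul_apply, LinearMap.comp_apply,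
    LinearMap.mulRight_apply, smul_eq_mul] at key
  trans ∑ i ∈ (ℛ ℂ h).index, ∑ k ∈ (ℛ ℂ x).index,
    ψ (HopfAlgebra.antipode ℂ ((ℛ ℂ h).left i) * (ℛ ℂ x).right k) *
      φ ((∑ j ∈ (ℛ ℂ ((ℛ ℂ h).right i)).index, (ℛ ℂ ((ℛ ℂ h).right i)).right j *
        HopfAlgebra.antipode ℂ ((ℛ ℂ ((ℛ ℂ h).right i)).left j)) * (ℛ ℂ x).left k)
  · rw [dualMul_apply, Finset.sum_comm]
    refine Finset.sum_congr rfl fun k _ => ?_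
    rw [dualMulLeft_apply]
    conv_lhs => rw [← sum_counit_right_smul h]
    simp only [sum_right_mul_antipode_left, map_sum, map_smul, Finset.sum_mul, smul_mul_assoc,
      one_mul, smul_eq_mul, Finset.mul_sum]
    exact Finset.sum_congr rfl fun i _ => by ring
  · trans ∑ i ∈ (ℛ ℂ h).index, ∑ j ∈ (ℛ ℂ ((ℛ ℂ h).right i)).index, ∑ k ∈ (ℛ ℂ x).index,
      ψ (HopfAlgebra.antipode ℂ ((ℛ ℂ h).left i) * (ℛ ℂ x).right k) *
        φ ((ℛ ℂ ((ℛ ℂ h).right i)).right j *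
          (HopfAlgebra.antipode ℂ ((ℛ ℂ ((ℛ ℂ h).right i)).left j) * (ℛ ℂ x).left k))
    · refine Finset.sum_congr rfl fun i _ => ?_
      rw [Finset.sum_comm]
      simp only [Finset.sum_mul, map_sum, Finset.mul_sum, mul_assoc]
    · rw [← key]
      simp [mul_comm]

end DualOperators

/-! ### The regular representation of the algebra of local operators -/

section Regular

variable {A B C H T : Type*} [Ring A] [HopfAlgebra ℂ A] [Ring H] [HopfAlgebra ℂ H] [Ring B]
  [Algebra ℂ B] [AddCommGroup T] [Module ℂ T]

/-- The operators `ψ ⊗ n ↦ ψ(S(g c₃) ? g c₁) ⊗ Y c₂ n`, for operators `Y c` that commute with an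
action of the endomorphisms of `H*`. -/
def regularOp [AddCommGroup C] [Module ℂ C] [Coalgebra ℂ C]
    (j : Module.End ℂ (Module.Dual ℂ H) →ₐ[ℂ] B) (g : C →ₗ[ℂ] H) (Y : C →ₗ[ℂ] B) : C →ₗ[ℂ] B :=
  (toConv (j.toLinearMap ∘ₗ dualMulRight H ∘ₗ g) * toConv Y *
    toConv (j.toLinearMap ∘ₗ dualMulLeft H ∘ₗ g)).ofConv

theorem isRep_regularOp [Ring C] [HopfAlgebra ℂ C] {j : Module.End ℂ (Module.Dual ℂ H) →ₐ[ℂ] B}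
    {g : C →ₐ[ℂ] H} {Y : C →ₗ[ℂ] B} (hY : IsRep Y) (hj : ∀ f c, Commute (j f) (Y c)) :
    IsRep (regularOp j g.toLinearMap Y) := by
  have h : ∀ {Z : H →ₗ[ℂ] Module.End ℂ (Module.Dual ℂ H)}, IsRep Z →
      IsRep (Z ∘ₗ g.toLinearMap) := fun hZ => ⟨by simp [hZ.1], fun x y => by simp [hZ.2]⟩
  refine IsRep.convMul (IsRep.convMul ((h isRep_dualMulRight).comp j) hY
    fun x y => hj _ _) ((h isRep_dualMulLeft).comp j) fun x y => ?_
  exact (convMul_commute (fun c => (commute_dualMulLeft_dualMulRight _ _).map j)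
    (fun c => hj _ _) x).symm

/-- The outer factors of a regular operator act trivially on the unit of `H*`. -/
theorem regularOp_apply_of_counit [AddCommGroup C] [Module ℂ C] [Coalgebra ℂ C]
    {j : Module.End ℂ (Module.Dual ℂ H) →ₐ[ℂ] Module.End ℂ T} {g : C →ₗ[ℂ] H}
    (hg : ∀ c, counit (R := ℂ) (g c) = counit (R := ℂ) c) {Y : C →ₗ[ℂ] Module.End ℂ T} {t : T}
    (ht : ∀ f (z : ℂ), f counit = z • counit → j f t = z • t)
    (hY : ∀ f c, Commute (j f) (Y c)) (c : C) : regularOp j g Y c t = Y c t := by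
  have h1 : ∀ c : C, j (dualMulLeft H (g c)) t = counit (R := ℂ) c • t := fun c => ht _ _ <| by
    ext x
    simp [dualMulLeft_apply, HopfAlgebra.counit_antipode, hg]
  have h2 : ∀ c : C, j (dualMulRight H (g c)) t = counit (R := ℂ) c • t := fun c => ht _ _ <| by
    ext x
    simp [dualMulRight_apply, hg, mul_comm]
  change (_ * toConv (j.toLinearMap ∘ₗ dualMulLeft H ∘ₗ g) :
    WithConv (C →ₗ[ℂ] Module.End ℂ T)) c t = _
  rw [(ℛ ℂ c).convMul_apply, LinearMap.sum_apply]
  have h3 : ∀ f : WithConv (C →ₗ[ℂ] Module.End ℂ T), ∑ i ∈ (ℛ ℂ c).index,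
      (f ((ℛ ℂ c).left i) * j (dualMulLeft H (g ((ℛ ℂ c).right i)))) t = f c t := fun f => by
    conv_rhs => rw [← sum_counit_right_smul c, map_sum, LinearMap.sum_apply]
    simp [h1]
  refine (h3 _).trans ?_
  rw [(ℛ ℂ c).convMul_apply, LinearMap.sum_apply]
  conv_rhs => rw [← sum_counit_smul (ℛ ℂ c), map_sum, LinearMap.sum_apply]
  refine Finset.sum_congr rfl fun i _ => ?_
  change (j (dualMulRight H (g _)) * Y _) t = _
  rw [(hY _ _).eq, Module.End.mul_apply, h2]
  simp

/-- The reading that defines the left multiplication by elements of `H*`. -/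
def regularReading [FiniteDimensional ℂ H] (j : Module.End ℂ (Module.Dual ℂ H) →ₐ[ℂ] B) :
    B ⊗[ℂ] H :=
  dualReading (j.toLinearMap ∘ₗ dualLeft H)

variable [FiniteDimensional ℂ H]

theorem regularReading_eq (j : Module.End ℂ (Module.Dual ℂ H) →ₐ[ℂ] B) : regularReading j =
    Algebra.TensorProduct.map j (AlgHom.id ℂ H) (dualReading (dualLeft H)) := by
  simp only [regularReading, dualReading, map_sum]
  rfl

/-- Left multiplication by elements of `H*` is intertwined by the regular operators: `dualMulRight`
is absorbed on one side and `dualMulLeft` is produced on the other. -/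
theorem intertwines_regularOp [IsSemisimpleRing H] [AddCommGroup C] [Module ℂ C] [Coalgebra ℂ C]
    {j : Module.End ℂ (Module.Dual ℂ H) →ₐ[ℂ] B} (g : C →ₗc[ℂ] H) {Y : C →ₗ[ℂ] B}
    (hY : ∀ f c, Commute (j f) (Y c)) :
    Intertwines (regularReading j) g.toLinearMap (regularOp j g.toLinearMap Y) := by
  have h1 := congrArg (convComp _ g) (congrArg (convMap H (Algebra.TensorProduct.map j
    (AlgHom.id ℂ H))) (dualReading_mul_dualMulRight (H := H)))
  have h3 := congrArg (convComp _ g) (congrArg (convMap H (Algebra.TensorProduct.map j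
    (AlgHom.id ℂ H))) (dualReading_mul_dualMulLeft (H := H)))
  simp only [map_mul, convMap_convConst, convMap_map_convLeft, convMap_map_convRight,
    ← regularReading_eq, convComp_convConst] at h1 h3
  have h2 : Commute (convConst C (regularReading j)) (convLeft H (toConv Y)) := by
    rw [regularReading_eq]
    exact commute_convConst fun c => commute_map_tmul_one _ _ fun f => hY _ _
  unfold Intertwines regularOp
  rw [toConv_ofConv, convLeft_mul, convLeft_mul]
  change convConst C (regularReading j) * (convComp _ g (convRight _ (toConv LinearMap.id)) *
    (convComp _ g (convLeft H (toConv (j.toLinearMap ∘ₗ dualMulRight H))) *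
      convLeft H (toConv Y) *
        convComp _ g (convLeft H (toConv (j.toLinearMap ∘ₗ dualMulLeft H))))) =
    (convComp _ g (convLeft H (toConv (j.toLinearMap ∘ₗ dualMulRight H))) *
      convLeft H (toConv Y) * convComp _ g (convLeft H (toConv (j.toLinearMap ∘ₗ dualMulLeft H)))) *
      convComp _ g (convRight _ (toConv LinearMap.id)) * convConst C (regularReading j)
  generalize convConst C (regularReading j) = r at *
  generalize convComp (B ⊗[ℂ] H) g (convRight _ (toConv LinearMap.id)) = k at *
  generalize convComp (B ⊗[ℂ] H) g
    (convLeft H (toConv (j.toLinearMap ∘ₗ dualMulRight H))) = y₁ at *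
  generalize convComp (B ⊗[ℂ] H) g
    (convLeft H (toConv (j.toLinearMap ∘ₗ dualMulLeft H))) = y₃ at *
  generalize convLeft H (toConv Y) = y₂ at *
  calc r * (k * (y₁ * y₂ * y₃)) = (r * (k * y₁)) * y₂ * y₃ := by simp only [mul_assoc]
    _ = y₁ * (r * y₂) * y₃ := by rw [h1]; simp only [mul_assoc]
    _ = y₁ * y₂ * (r * y₃) := by rw [h2.eq]; simp only [mul_assoc]
    _ = y₁ * y₂ * y₃ * k * r := by rw [h3]; simp only [mul_assoc]

end Regular

section CrossedProduct

variable {A H B : Type*} [Ring A] [HopfAlgebra ℂ A] [Ring H] [HopfAlgebra ℂ H] [Ring B]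
  [Algebra ℂ B] (X : HopfCrossedModule A H)

theorem IsRep.isEquivariant {Y : H →ₗ[ℂ] B} (hY : IsRep Y) :
    IsEquivariant X (toConv Y) (Y ∘ₗ X.bd.toCoalgHom.toLinearMap) := by
  refine fun a => conv_ext fun h => ?_
  have h1 := congrArg Y (X.sum_bd_act_mul h a)
  rw [mul_convConst_apply, (ℛ ℂ h).convMul_apply]
  simp only [map_sum, hY.2] at h1
  exact h1.symm

variable {X} in
theorem isEquivariant_regularOp {j : Module.End ℂ (Module.Dual ℂ H) →ₐ[ℂ] B} {V : H →ₗ[ℂ] B}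
    {E : A →ₗ[ℂ] B} (h : IsEquivariant X (toConv V) E) (hV : ∀ f c, Commute (j f) (V c))
    (hE : ∀ f c, Commute (j f) (E c)) : IsEquivariant X (toConv (regularOp j LinearMap.id V))
      (regularOp j X.bd.toCoalgHom.toLinearMap E) := by
  have h1 : IsEquivariant X _ _ := ((isRep_dualMulRight (H := H)).isEquivariant X).map j
  have h3 : IsEquivariant X _ _ := ((isRep_dualMulLeft (H := H)).isEquivariant X).map j
  refine IsEquivariant.conv_mul (IsEquivariant.conv_mul ?_ ?_) ?_
  · exact (h1.mul_right fun x a => (hV _ _).symm).mul_right fun x a =>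
      (commute_dualMulLeft_dualMulRight _ _).map j
  · exact (h.mul_left fun x a => hE _ _).mul_right fun x a => hE _ _
  · exact h3.mul_left fun x a => (convMul_commute (fun c =>
      (commute_dualMulLeft_dualMulRight _ _).map j) (fun c => hV _ _) x).symm

namespace HopfCrossedModule

/-- Left multiplication by elements of `A` in the crossed product. -/
def crossedLeft (i : Module.End ℂ A →ₐ[ℂ] B) : A →ₗ[ℂ] B := i.toLinearMap ∘ₗ LinearMap.mul ℂ A

/-- Left multiplication by elements of `H` in the crossed product: `b ⊗ k ↦ (h₁ ▷ b) ⊗ h₂ k`. -/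
def crossedRight (i : Module.End ℂ A →ₐ[ℂ] B) (k : Module.End ℂ H →ₐ[ℂ] B) : H →ₗ[ℂ] B :=
  (toConv (i.toLinearMap ∘ₗ X.act.toLinearMap) *
    toConv (k.toLinearMap ∘ₗ LinearMap.mul ℂ H)).ofConv

variable {i : Module.End ℂ A →ₐ[ℂ] B} {k : Module.End ℂ H →ₐ[ℂ] B}

theorem isRep_crossedRight (h : ∀ f g, Commute (i f) (k g)) : IsRep (X.crossedRight i k) :=
  IsRep.convMul ((isRep_algHom X.act).comp i) ((isRep_mul H).comp k) fun _ _ => h _ _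

theorem isEquivariant_crossedRight (h : ∀ f g, Commute (i f) (k g)) :
    IsEquivariant X (toConv (X.crossedRight i k)) (crossedLeft i) :=
  (IsEquivariant.map (V := toConv X.act.toLinearMap) X.act_mul_convConst_mul i).mul_right
    fun _ _ => (h _ _).symm

theorem crossedRight_apply {T : Type*} [AddCommGroup T] [Module ℂ T]
    {i : Module.End ℂ A →ₐ[ℂ] Module.End ℂ T} {k : Module.End ℂ H →ₐ[ℂ] Module.End ℂ T}
    (τ : A →ₗ[ℂ] H →ₗ[ℂ] T) (hi : ∀ f a h, i f (τ a h) = τ (f a) h)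
    (hk : ∀ f a h, k f (τ a h) = τ a (f h)) (h : H) :
    X.crossedRight i k h (τ 1 1) = τ 1 h := by
  change (toConv _ * toConv _ : WithConv (H →ₗ[ℂ] Module.End ℂ T)) h _ = _
  rw [(ℛ ℂ h).convMul_apply, LinearMap.sum_apply]
  conv_rhs => rw [← sum_counit_smul (ℛ ℂ h), map_sum]
  refine Finset.sum_congr rfl fun n _ => ?_
  change i (X.act _) (k (LinearMap.mul ℂ H _) _) = _
  rw [hk, hi, X.act_one]
  simp

variable (A H) in
/-- The action of the endomorphisms of `H*` on `H* ⊗ (A ⊗ H)`. -/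
def onDual : Module.End ℂ (Module.Dual ℂ H) →ₐ[ℂ] Module.End ℂ (Module.Dual ℂ H ⊗[ℂ] (A ⊗[ℂ] H)) :=
  Module.End.rTensorAlgHom ℂ (Module.Dual ℂ H) (A ⊗[ℂ] H)

variable (A H) in
/-- The action of the endomorphisms of `A` on `H* ⊗ (A ⊗ H)`. -/
def onLeft : Module.End ℂ A →ₐ[ℂ] Module.End ℂ (Module.Dual ℂ H ⊗[ℂ] (A ⊗[ℂ] H)) :=
  (Module.End.lTensorAlgHom ℂ (A ⊗[ℂ] H) (Module.Dual ℂ H)).comp (Module.End.rTensorAlgHom ℂ A H)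

variable (A H) in
/-- The action of the endomorphisms of `H` on `H* ⊗ (A ⊗ H)`. -/
def onRight : Module.End ℂ H →ₐ[ℂ] Module.End ℂ (Module.Dual ℂ H ⊗[ℂ] (A ⊗[ℂ] H)) :=
  (Module.End.lTensorAlgHom ℂ (A ⊗[ℂ] H) (Module.Dual ℂ H)).comp (Module.End.lTensorAlgHom ℂ H A)

theorem commute_onDual_onLeft (f : Module.End ℂ (Module.Dual ℂ H)) (g : Module.End ℂ A) :
    Commute (onDual A H f) (onLeft A H g) :=
  TensorProduct.ext' fun _ _ => rfl

theorem commute_onDual_onRight (f : Module.End ℂ (Module.Dual ℂ H)) (g : Module.End ℂ H) :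
    Commute (onDual A H f) (onRight A H g) :=
  TensorProduct.ext' fun _ _ => rfl

theorem commute_onLeft_onRight (f : Module.End ℂ A) (g : Module.End ℂ H) :
    Commute (onLeft A H f) (onRight A H g) := by
  ext ψ a h
  rfl

theorem commute_onDual_crossedRight (f : Module.End ℂ (Module.Dual ℂ H)) (h : H) :
    Commute (onDual A H f) (X.crossedRight (onLeft A H) (onRight A H) h) :=
  convMul_commute (fun _ => commute_onDual_onLeft _ _) (fun _ => commute_onDual_onRight _ _) h

variable [FiniteDimensional ℂ H] [IsSemisimpleRing H]

/-- The regular representation of the algebra of local operators. -/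
def regularModel : LocalModel X (Module.End ℂ (Module.Dual ℂ H ⊗[ℂ] (A ⊗[ℂ] H))) where
  reading := regularReading (onDual A H)
  edge := regularOp (onDual A H) X.bd.toCoalgHom.toLinearMap (crossedLeft (onLeft A H))
  vertex := regularOp (onDual A H) LinearMap.id (X.crossedRight (onLeft A H) (onRight A H))
  evalDual_counit := by
    rw [regularReading, evalDual_dualReading]
    exact TensorProduct.ext' fun φ u => congrArg (· ⊗ₜ u) (counit_dualMul φ)
  evalDual_dualMul φ ψ := by
    simp only [regularReading, evalDual_dualReading]
    exact TensorProduct.ext' fun χ u => congrArg (· ⊗ₜ u) (dualMul_assoc φ ψ χ)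
  isRep_edge := isRep_regularOp (g := (X.bd : A →ₐ[ℂ] H)) ((isRep_mul A).comp _)
    fun _ _ => commute_onDual_onLeft _ _
  isRep_vertex := isRep_regularOp (g := AlgHom.id ℂ H)
    (X.isRep_crossedRight commute_onLeft_onRight) X.commute_onDual_crossedRight
  isEquivariant := isEquivariant_regularOp (X.isEquivariant_crossedRight commute_onLeft_onRight)
    X.commute_onDual_crossedRight fun _ _ => commute_onDual_onLeft _ _
  intertwines_edge := intertwines_regularOp X.bd.toCoalgHom fun _ _ => commute_onDual_onLeft _ _
  intertwines_vertex := intertwines_regularOp (CoalgHom.id ℂ H) X.commute_onDual_crossedRight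

/-- In the regular representation an element is recovered from its action on the unit. -/
theorem regularModel_rep_apply_one (x : Module.Dual ℂ H ⊗[ℂ] (A ⊗[ℂ] H)) :
    X.regularModel.rep x (counit ⊗ₜ (1 ⊗ₜ 1)) = x := by
  induction x with
  | zero => simp
  | add x y hx hy => rw [map_add, LinearMap.add_apply, hx, hy]
  | tmul φ u =>
    induction u with
    | zero => simp
    | add x y hx hy => rw [TensorProduct.tmul_add, map_add, LinearMap.add_apply, hx, hy]
    | tmul a h =>
      have hd : ∀ (u : A ⊗[ℂ] H) (f : Module.End ℂ (Module.Dual ℂ H)) (z : ℂ),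
          f counit = z • counit → onDual A H f (counit ⊗ₜ u) = z • (counit ⊗ₜ u) :=
        fun u f z hf => (congrArg (· ⊗ₜ u) hf).trans (TensorProduct.smul_tmul' _ _ _).symm
      have hc : X.crossedRight (B := Module.End ℂ (Module.Dual ℂ H ⊗[ℂ] (A ⊗[ℂ] H))) (onLeft A H)
          (onRight A H) h (counit ⊗ₜ (1 ⊗ₜ 1)) =
          counit ⊗ₜ (1 ⊗ₜ h) :=
        X.crossedRight_apply (i := onLeft A H) (k := onRight A H)
          ((TensorProduct.mk ℂ A H).compr₂
            (TensorProduct.mk ℂ (Module.Dual ℂ H) (A ⊗[ℂ] H) counit))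
          (fun _ _ _ => rfl) (fun _ _ _ => rfl) h
      have hv : X.regularModel.vertex h (counit ⊗ₜ (1 ⊗ₜ 1)) = counit ⊗ₜ (1 ⊗ₜ h) :=
        (regularOp_apply_of_counit (fun _ => rfl) (hd _) X.commute_onDual_crossedRight h).trans hc
      have he : X.regularModel.edge a (counit ⊗ₜ (1 ⊗ₜ h)) = counit ⊗ₜ ((a * 1) ⊗ₜ h) :=
        regularOp_apply_of_counit X.counit_bd (hd _) (fun _ _ => commute_onDual_onLeft _ _) a
      have hf : evalDual _ H φ X.regularModel.reading (counit ⊗ₜ ((a * 1) ⊗ₜ h)) =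
          dualMul H (φ ⊗ₜ counit) ⊗ₜ ((a * 1) ⊗ₜ h) :=
        congrArg (fun f : Module.End ℂ (Module.Dual ℂ H ⊗[ℂ] (A ⊗[ℂ] H)) =>
          f (counit ⊗ₜ ((a * 1) ⊗ₜ h))) (evalDual_dualReading _ φ)
      rw [LocalModel.rep_tmul, LocalModel.crossedRep_tmul, Module.End.mul_apply,
        Module.End.mul_apply, hv, he, hf, dualMul_counit, mul_one]

/-- The regular representation is given by the product. -/
theorem localMul_tmul (x y : Module.Dual ℂ H ⊗[ℂ] (A ⊗[ℂ] H)) :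
    X.localMul (x ⊗ₜ y) = X.regularModel.rep x y := by
  rw [← X.regularModel_rep_apply_one (X.localMul (x ⊗ₜ y)), LocalModel.rep_localMul,
    Module.End.mul_apply, regularModel_rep_apply_one]

/-- The product is associative because the regular representation is multiplicative. -/
theorem localMul_assoc (x y z : Module.Dual ℂ H ⊗[ℂ] (A ⊗[ℂ] H)) :
    X.localMul (X.localMul (x ⊗ₜ y) ⊗ₜ z) = X.localMul (x ⊗ₜ X.localMul (y ⊗ₜ z)) := by
  rw [localMul_tmul, LocalModel.rep_localMul, Module.End.mul_apply, ← localMul_tmul,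
    ← localMul_tmul]

theorem one_localMul (x : Module.Dual ℂ H ⊗[ℂ] (A ⊗[ℂ] H)) :
    X.localMul ((counit ⊗ₜ (1 ⊗ₜ 1)) ⊗ₜ x) = x := by
  rw [localMul_tmul, LocalModel.rep_one, Module.End.one_apply]

theorem localMul_one (x : Module.Dual ℂ H ⊗[ℂ] (A ⊗[ℂ] H)) :
    X.localMul (x ⊗ₜ (counit ⊗ₜ (1 ⊗ₜ 1))) = x := by
  rw [localMul_tmul, regularModel_rep_apply_one]

end HopfCrossedModule

end CrossedProduct

/-! ### The local operators on the state space -/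

section StateSpace

variable {L0 L1 L2 A H : Type*} [Fintype L1] [DecidableEq L1] [Fintype L2] [DecidableEq L2]
  [DecidableEq L0] [Ring A] [HopfAlgebra ℂ A] [Ring H] [HopfAlgebra ℂ H]

/-- The actions of `End H` and `End A` on the tensor factors of the state space. -/
def stateSlots (L1 L2 A H : Type*) [Fintype L1] [DecidableEq L1] [Fintype L2] [DecidableEq L2]
    [Ring A] [HopfAlgebra ℂ A] [Ring H] [HopfAlgebra ℂ H] :
    SlotSystem L1 L2 A H (Module.End ℂ (StateSpace L1 L2 A H)) where
  edge := onEdgeHom L2 A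
  plaq := onPlaqHom L1 H
  edge_commute h f g := onEdgeHom_commute h f g
  plaq_commute h f g := onPlaqHom_commute h f g
  edge_plaq_commute e p f g := onEdgeHom_commute_onPlaqHom e p f g

namespace HopfCrossedModule

variable (X : HopfCrossedModule A H) (L : CellDecomposition L0 L1 L2)

theorem vertexOp_eq (v : L0) (p : L2) (hs : L.IsSite v p) :
    X.vertexOp L v p hs = (stateSlots L1 L2 A H).vertexOp X L v p hs := rfl

variable [FiniteDimensional ℂ H] [FiniteDimensional ℂ A]

theorem edgeOp_eq [IsSemisimpleRing H] (e : L1) :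
    X.edgeOp L e = (stateSlots L1 L2 A H).edgeOp X L e := by
  rw [edgeOp, edgeOpLeft_eq, edgeOpRight_eq]
  rfl

theorem plaqOp_eq_evalDual_hol (p : L2) (φ : Module.Dual ℂ H) :
    X.plaqOp L p φ = evalDual _ H φ ((stateSlots L1 L2 A H).hol X L p) :=
  X.plaqOp_eq L p φ

variable [IsSemisimpleRing H]

/-- The local operators at the corner of a plaquette at its base-point. -/
def stateModel {e : L1} (hb : L.base (L.left (e, true)) = L.src (e, true))
    (hs : L.IsSite (L.src (e, true)) (L.left (e, true))) :
    LocalModel X (Module.End ℂ (StateSpace L1 L2 A H)) where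
  reading := (stateSlots L1 L2 A H).hol X L (L.left (e, true))
  edge := (stateSlots L1 L2 A H).edgeOp X L e
  vertex := (stateSlots L1 L2 A H).vertexOp X L (L.src (e, true)) (L.left (e, true)) hs
  evalDual_counit := ((stateSlots L1 L2 A H).isCoaction_hol X L _).1
  evalDual_dualMul := ((stateSlots L1 L2 A H).isCoaction_hol X L _).evalDual_dualMul
  isRep_edge := (stateSlots L1 L2 A H).isRep_edgeOp X L e
  isRep_vertex := (stateSlots L1 L2 A H).isRep_vertexOp X L _ _ hs
  isEquivariant := (stateSlots L1 L2 A H).isEquivariant_edgeOp X L hb hs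
  intertwines_edge := (stateSlots L1 L2 A H).intertwines_hol_edgeOp X L hb
  intertwines_vertex := (stateSlots L1 L2 A H).intertwines_hol_vertexOp X L hb hs

end HopfCrossedModule

end StateSpace

/-! ### The Drinfeld double -/

section Drinfeld

variable {C D H : Type*} [Ring H] [HopfAlgebra ℂ H] [AddCommGroup C] [Module ℂ C] [Coalgebra ℂ C]
  [AddCommGroup D] [Module ℂ D] [Coalgebra ℂ D]

/-- The map `φ ⊗ c ↦ φ(f c₃ ? g c₁) ⊗ c₂` is natural in the coalgebra. -/
theorem lTensor_twist (θ : C →ₗc[ℂ] D) {f g : C →ₗ[ℂ] H} {f' g' : D →ₗ[ℂ] H}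
    (hf : f' ∘ₗ θ.toLinearMap = f) (hg : g' ∘ₗ θ.toLinearMap = g)
    (x : Module.Dual ℂ H ⊗[ℂ] C) :
    θ.toLinearMap.lTensor (Module.Dual ℂ H) (twist f g x) =
      twist f' g' (θ.toLinearMap.lTensor (Module.Dual ℂ H) x) := by
  induction x with
  | zero => simp
  | add x y hx hy => simp only [map_add, hx, hy]
  | tmul φ c =>
    subst hf hg
    have h : ∀ c : C, comul (R := ℂ) (θ c) = TensorProduct.map θ.toLinearMap θ.toLinearMap
        (comul (R := ℂ) c) := fun c => (CoalgHomClass.map_comp_comul_apply θ c).symm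
    have h2 : ∀ t : C ⊗[ℂ] C, comul.rTensor D (TensorProduct.map θ.toLinearMap θ.toLinearMap t) =
        TensorProduct.map (TensorProduct.map θ.toLinearMap θ.toLinearMap) θ.toLinearMap
          ((comul (R := ℂ)).rTensor C t) := fun t => by
      induction t with
      | zero => simp
      | add x y hx hy => simp only [map_add, hx, hy]
      | tmul a b =>
        rw [TensorProduct.map_tmul, LinearMap.rTensor_tmul, LinearMap.rTensor_tmul,
          TensorProduct.map_tmul]
        exact congrArg (· ⊗ₜ _) (h a)
    simp only [twist, TensorProduct.lift.tmul, LinearMap.mk₂_apply, LinearMap.lTensor_tmul]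
    change _ = (TensorProduct.lift ((sandwich H φ).compl₁₂ g' f')).rTensor D
      ((TensorProduct.rightComm ℂ D D D)
      ((comul (R := ℂ) (A := D)).rTensor D (comul (R := ℂ) (θ c))))
    rw [h, h2]
    generalize (comul (R := ℂ) (A := C)).rTensor C (comul (R := ℂ) c) = t
    induction t with
    | zero => simp
    | add x y hx hy => simp only [map_add, hx, hy]
    | tmul s d =>
      induction s with
      | zero => simp
      | add x y hx hy => simp only [TensorProduct.add_tmul, map_add, hx, hy]
      | tmul a b => rfl

/-- The product on `H* ⊗ C` is natural in the coalgebra with product `C`. -/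
theorem lTensor_doubleMul (θ : C →ₗc[ℂ] D) {f g : C →ₗ[ℂ] H} {f' g' : D →ₗ[ℂ] H}
    (hf : f' ∘ₗ θ.toLinearMap = f) (hg : g' ∘ₗ θ.toLinearMap = g) {m : C ⊗[ℂ] C →ₗ[ℂ] C}
    {m' : D ⊗[ℂ] D →ₗ[ℂ] D} (hm : ∀ u w, θ (m (u ⊗ₜ w)) = m' (θ u ⊗ₜ θ w))
    (x y : Module.Dual ℂ H ⊗[ℂ] C) :
    θ.toLinearMap.lTensor (Module.Dual ℂ H) (doubleMul f g m (x ⊗ₜ y)) =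
      doubleMul f' g' m' (θ.toLinearMap.lTensor (Module.Dual ℂ H) x ⊗ₜ
        θ.toLinearMap.lTensor (Module.Dual ℂ H) y) := by
  induction x with
  | zero => simp
  | add x y hx hy => simp only [TensorProduct.add_tmul, map_add, hx, hy]
  | tmul φ u =>
    induction y with
    | zero => simp
    | add x y hx hy => simp only [TensorProduct.tmul_add, map_add, hx, hy]
    | tmul ψ w =>
      rw [LinearMap.lTensor_tmul, LinearMap.lTensor_tmul, doubleMul_tmul, doubleMul_tmul,
        ← LinearMap.lTensor_tmul, ← lTensor_twist θ hf hg]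
      generalize twist f g (ψ ⊗ₜ u) = t
      induction t with
      | zero => simp
      | add x y hx hy => simp only [map_add, hx, hy]
      | tmul χ c => exact congrArg (dualMul H (φ ⊗ₜ χ) ⊗ₜ ·) (hm c w)

variable [FiniteDimensional ℂ H] [IsSemisimpleRing H]

/-- The antipode is an involution, so that the inverse in the product of the Drinfeld double is `S`.
-/
theorem inverse_antipode :
    Ring.inverse (HopfAlgebra.antipode ℂ : Module.End ℂ H) = HopfAlgebra.antipode ℂ := by
  have h : (HopfAlgebra.antipode ℂ : Module.End ℂ H) * HopfAlgebra.antipode ℂ = 1 :=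
    LinearMap.ext (antipode_antipode H)
  exact Ring.inverse_unit (⟨HopfAlgebra.antipode ℂ, HopfAlgebra.antipode ℂ, h, h⟩ :
    (Module.End ℂ H)ˣ)

/-- For `A = ℂ` the algebra of local operators is the Drinfeld double. -/
theorem lTensor_lid_localMul (x y : Module.Dual ℂ H ⊗[ℂ] (ℂ ⊗[ℂ] H)) :
    (TensorProduct.lid ℂ H).toLinearMap.lTensor (Module.Dual ℂ H)
        ((HopfCrossedModule.trivial H).localMul (x ⊗ₜ y)) =
      drinfeldMul H ((TensorProduct.lid ℂ H).toLinearMap.lTensor (Module.Dual ℂ H) x ⊗ₜ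
        (TensorProduct.lid ℂ H).toLinearMap.lTensor (Module.Dual ℂ H) y) := by
  rw [drinfeldMul, inverse_antipode]
  have hp : LinearMap.id ∘ₗ (Coalgebra.TensorProduct.lid ℂ H).toCoalgHom.toLinearMap =
      (HopfCrossedModule.trivial H).proj := TensorProduct.ext' fun z h => Algebra.smul_def z h
  refine lTensor_doubleMul (Coalgebra.TensorProduct.lid ℂ H).toCoalgHom (by rw [← hp]; rfl) hp
    (fun u w => ?_) x y
  induction u with
  | zero => simp
  | add x y hx hy => simp only [TensorProduct.add_tmul, map_add, hx, hy]
  | tmul z h =>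
    induction w with
    | zero => simp
    | add x y hx hy => simp only [TensorProduct.tmul_add, map_add, hx, hy]
    | tmul c k =>
      rw [HopfCrossedModule.crossedMul_tmul, map_sum]
      change ∑ i ∈ (ℛ ℂ h).index, (z * (counit (R := ℂ) ((ℛ ℂ h).left i) * c)) •
        ((ℛ ℂ h).right i * k) = (z • h) * (c • k)
      conv_rhs => rw [← sum_counit_smul (ℛ ℂ h)]
      simp only [Finset.smul_sum, Finset.sum_mul, smul_mul_smul_comm, smul_smul]
      exact Finset.sum_congr rfl fun i _ => by
        rw [mul_assoc]

end Drinfeld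
end

theorem mainTheorem2
    {A H : Type*}
    [Ring A] [HopfAlgebra ℂ A] [FiniteDimensional ℂ A] [IsSemisimpleRing A]
    [Ring H] [HopfAlgebra ℂ H] [FiniteDimensional ℂ H] [IsSemisimpleRing H]
    (X : HopfCrossedModule A H)
    {L0 L1 L2 : Type*} [DecidableEq L0] [Fintype L1] [DecidableEq L1] [Fintype L2] [DecidableEq L2]
    (L : CellDecomposition L0 L1 L2)
    -- a plaquette `P`, its base-point `v`, and an edge `e` in its boundary, oriented
    -- counter-clockwise around `P`, that starts at `v`
    (P : L2) (v : L0) (hv : L.base P = v) (hs : L.IsSite v P)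
    (e : L1) (heP : L.left (e, true) = P) (hev : L.src (e, true) = v) :
    -- the vertex, edge and plaquette operators are representations of `H`, `A` and `H*`
    (X.vertexOp L v P hs 1 = 1 ∧
      ∀ h k : H, X.vertexOp L v P hs (h * k) = X.vertexOp L v P hs h * X.vertexOp L v P hs k) ∧
    (X.edgeOp L e 1 = 1 ∧
      ∀ a b : A, X.edgeOp L e (a * b) = X.edgeOp L e a * X.edgeOp L e b) ∧
    (X.plaqOp L P Coalgebra.counit = 1 ∧
      ∀ φ ψ : Module.Dual ℂ H,
        X.plaqOp L P (dualMul H (φ ⊗ₜ[ℂ] ψ)) = X.plaqOp L P φ * X.plaqOp L P ψ) ∧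
    -- `E^{h₁ ▷ a} V^{h₂} = V^h E^a`
    (∀ (h : H) (a : A),
      LinearMap.mul' ℂ (Module.End ℂ (StateSpace L1 L2 A H))
        (TensorProduct.map (X.edgeOp L e ∘ₗ X.act.toLinearMap.flip a) (X.vertexOp L v P hs)
          (Coalgebra.comul (R := ℂ) h)) =
      X.vertexOp L v P hs h * X.edgeOp L e a) ∧
    -- `F^{φ(S ∂a₃ · ? · ∂a₁)} E^{a₂} = E^a F^φ`
    (∀ (a : A) (φ : Module.Dual ℂ H),
      LinearMap.mul' ℂ (Module.End ℂ (StateSpace L1 L2 A H))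
        (TensorProduct.map (X.plaqOp L P) (X.edgeOp L e)
          (twist (HopfAlgebra.antipode ℂ ∘ₗ X.bd.toCoalgHom.toLinearMap)
            X.bd.toCoalgHom.toLinearMap (φ ⊗ₜ[ℂ] a))) =
      X.edgeOp L e a * X.plaqOp L P φ) ∧
    -- an edge of `P` oriented clockwise that starts at `v` gives `E^a F^φ = F^φ E^a` instead
    (∀ e' : L1, L.left (e', false) = P → L.src (e', true) = v →
      ∀ (a : A) (φ : Module.Dual ℂ H),
        X.edgeOp L e' a * X.plaqOp L P φ = X.plaqOp L P φ * X.edgeOp L e' a) ∧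
    -- `F^{φ(S h₃ · ? · h₁)} V^{h₂} = V^h F^φ`
    (∀ (h : H) (φ : Module.Dual ℂ H),
      LinearMap.mul' ℂ (Module.End ℂ (StateSpace L1 L2 A H))
        (TensorProduct.map (X.plaqOp L P) (X.vertexOp L v P hs)
          (twist (HopfAlgebra.antipode ℂ) LinearMap.id (φ ⊗ₜ[ℂ] h))) =
      X.vertexOp L v P hs h * X.plaqOp L P φ) ∧
    -- `H* ⊗ (A ⋊ H)` is an associative algebra with unit `ε ⊗ (1 ⊗ 1)`
    (∀ x y z : Module.Dual ℂ H ⊗[ℂ] (A ⊗[ℂ] H),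
      X.localMul (X.localMul (x ⊗ₜ[ℂ] y) ⊗ₜ[ℂ] z) = X.localMul (x ⊗ₜ[ℂ] X.localMul (y ⊗ₜ[ℂ] z))) ∧
    (∀ x : Module.Dual ℂ H ⊗[ℂ] (A ⊗[ℂ] H),
      X.localMul ((Coalgebra.counit ⊗ₜ[ℂ] (1 ⊗ₜ[ℂ] 1)) ⊗ₜ[ℂ] x) = x ∧
      X.localMul (x ⊗ₜ[ℂ] (Coalgebra.counit ⊗ₜ[ℂ] (1 ⊗ₜ[ℂ] 1))) = x) ∧
    -- `φ ⊗ (a ⊗ h) ↦ F^φ E^a V^h` is a representation of this algebra on the state space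
    (∃ ρ : Module.Dual ℂ H ⊗[ℂ] (A ⊗[ℂ] H) →ₗ[ℂ] Module.End ℂ (StateSpace L1 L2 A H),
      (∀ (φ : Module.Dual ℂ H) (a : A) (h : H),
        ρ (φ ⊗ₜ[ℂ] (a ⊗ₜ[ℂ] h)) = X.plaqOp L P φ * X.edgeOp L e a * X.vertexOp L v P hs h) ∧
      ρ (Coalgebra.counit ⊗ₜ[ℂ] (1 ⊗ₜ[ℂ] 1)) = 1 ∧
      ∀ x y, ρ (X.localMul (x ⊗ₜ[ℂ] y)) = ρ x * ρ y) ∧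
    -- for `A = ℂ`, the identification `H* ⊗ (ℂ ⊗ H) = H* ⊗ H` turns this algebra into the Drinfeld
    -- double of `H`
    (∀ x y : Module.Dual ℂ H ⊗[ℂ] (ℂ ⊗[ℂ] H),
      (TensorProduct.lid ℂ H).toLinearMap.lTensor (Module.Dual ℂ H)
        ((HopfCrossedModule.trivial H).localMul (x ⊗ₜ[ℂ] y)) =
      drinfeldMul H
        ((TensorProduct.lid ℂ H).toLinearMap.lTensor (Module.Dual ℂ H) x ⊗ₜ[ℂ]
          (TensorProduct.lid ℂ H).toLinearMap.lTensor (Module.Dual ℂ H) y)) := by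
  subst heP hev
  set M := X.stateModel L hv hs with hM
  have hV : ∀ h, X.vertexOp L (L.src (e, true)) (L.left (e, true)) hs h = M.vertex h :=
    fun h => congrArg (· h) (X.vertexOp_eq L _ _ hs)
  have hE : X.edgeOp L e = M.edge := X.edgeOp_eq L e
  have hF : X.plaqOp L (L.left (e, true)) = (evalDual _ H).flip M.reading :=
    LinearMap.ext fun φ => X.plaqOp_eq_evalDual_hol L _ φ
  have hV' : X.vertexOp L (L.src (e, true)) (L.left (e, true)) hs = M.vertex := LinearMap.ext hV
  refine ⟨?_, ?_, ?_, ?_, ?_, ?_, ?_, X.localMul_assoc,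
    fun x => ⟨X.one_localMul x, X.localMul_one x⟩, ⟨M.rep, ?_, M.rep_one, M.rep_localMul⟩,
    lTensor_lid_localMul⟩
  · rw [hV']
    exact M.isRep_vertex
  · rw [hE]
    exact M.isRep_edge
  · rw [hF]
    exact ⟨M.evalDual_counit, M.evalDual_dualMul⟩
  · intro h a
    rw [hV', hE]
    have h1 := congrArg (fun f => f.ofConv h) (M.isEquivariant a)
    exact (h1.symm.trans (mul_convConst_apply _ _ _))
  · intro a φ
    rw [hE, hF]
    exact Intertwines.twist (antipode_antipode H) M.intertwines_edge X.comul_bd X.counit_bd φ a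
  · intro e' hl hs' a φ
    have hb : L.base (L.left (e', false)) = L.src (e', true) := by rw [hl, hs', hv]
    have h1 := congrArg (evalDual _ H φ)
      ((stateSlots L1 L2 A H).commute_hol_edgeOp X L hb a).eq
    rw [evalDual_mul_tmul_one, evalDual_tmul_one_mul, hl] at h1
    rw [X.edgeOp_eq L e', hF]
    exact h1.symm
  · intro h φ
    rw [hV', hF]
    exact Intertwines.twist (g := LinearMap.id) (antipode_antipode H) M.intertwines_vertex
      (fun _ => by simp) (fun _ => rfl) φ h
  · intro φ a h
    rw [M.rep_tmul, M.crossedRep_tmul, hE, hF, hV', mul_assoc]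
    rfl
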